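/- **Conventions.** Maps are finite connected planar graphs (multiple edges allowed) embedded in the sphere, up to orientation-preserving homeomorphism; the size of a map is its number of vertices; a rooted map is a map with a distinguished oriented edge. A quadrangulation is a bipartite map all of whose faces have degree $4$; the map that consists of a single edge is also counted as a quadrangulation. Let $\mathcal Q_k$ be the set of rooted quadrangulations with $k$ vertices. Let $\mathrm Q=(Q,e)$ be a rooted quadrangulation. Its *pre-root-block* is the submap $Q[B]$ induced by the largest vertex set $B$ that contains both endpoints of $e$ and for which $Q[B]$ is $2$-connected (connected, and still connected after the removal of any one vertex); its *root block* $R(\mathrm Q)$ is obtained from $Q[B]$ by collapsing every facial $2$-cycle to an edge. Let $\mathcal F(\mathrm Q)$ be the set of faces of $Q[B]$ that are bounded by a $2$-cycle. Order the oriented edges of $Q$ by breadth-first search: vertices are listed in the order of discovery, starting from the tail of $e$, and the oriented edges leaving a vertex are listed clockwise, starting from $e$ at the first vertex and, at any other vertex, from the edge through which it was discovered. List $\mathcal F(\mathrm Q)$ as $f(1),\dots,f(|\mathcal F(\mathrm Q)|)$ in the order of the first oriented edge of $Q[B]$ incident to each face (that is, with the face on its right). The submap $P_i(\mathrm Q)$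 pendant to the root block in $f(i)$ is the maximal connected non-singleton submap of $Q$ that lies in $f(i)$ and contains no edge of the $2$-cycle around $f(i)$. Put $Y_i(\mathrm Q)=|v(P_i(\mathrm Q))|-1$. For $n,r,N\in\mathbb N=\{1,2,\dots\}$ let $$\mathcal Q_{n,r,N}=\{\mathrm Q\in\mathcal Q_n:\ |v(R(\mathrm Q))|=r,\ |\mathcal F(\mathrm Q)|=N\}.$$ Define $\psi:\mathbb N\to\mathbb R$ by $$|\mathcal Q_k|=\frac{2}{\sqrt\pi}\,\frac{12^{k-2}\,(1+\psi(k-1))}{(k-1)^{5/2}}\qquad(k\ge 2),$$ and let $w(k)=\frac{1+\psi(k)}{k^{5/2}}$, $\overline w=\sum_{\ell\ge1}w(\ell)$. Let $\xi$ be a random variable with values in $\mathbb N$ and $\mathbb P(\xi=k)=w(k)/\overline w$ for all $k\in\mathbb N$, let $\xi_1,\dots,\xi_N$ be independent copies of $\xi$, and let $S_N=\xi_1+\dots+\xi_N$. **Proposition.** Let $n,r,N\in\mathbb N$ with $1\le N\le n-r$ and $r>1$, let $(y_1,\dots,y_N)\in\mathbb N^N$ with $y_1+\dots+y_N=n-r$,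 and let $\mathrm Q_n$ be uniformly distributed on $\mathcal Q_{n,r,N}$ (assumed non-empty). Then $\mathbb P(S_N=n-r)>0$ and $$\mathbb P\big(Y_i(\mathrm Q_n)=y_i,\ 1\le i\le N\big)=\mathbb P\big(\xi_i=y_i,\ 1\le i\le N\ \big|\ S_N=n-r\big).$$ -/

import Mathlib

open MeasureTheory ProbabilityTheory

/-- The set of orbits of a permutation. -/
abbrev OrbitsOf {D : Type} (π : Equiv.Perm D) : Type :=
  Quotient (Equiv.Perm.SameCycle.setoid π)

/-- A rooted planar map with at least one edge, encoded combinatorially as a rotation system on the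
sphere. The darts are the oriented edges; a dart points away from its tail.
* `next d` is the dart that follows `d` in clockwise order around the tail of `d`;
* `rev d` is the same edge with the opposite orientation;
* `root` is the root edge, with its orientation.

Vertices, edges and faces are the orbits of `next`, of `rev` and of `next⁻¹ * rev`. The last
permutation walks along a face with the face on the right, so a dart belongs to the face on its
right. Connectedness together with Euler's formula says that the surface is the sphere. -/
structure RootedMap where
  numDarts : ℕ
  next : Equiv.Perm (Fin numDarts)
  rev : Equiv.Perm (Fin numDarts)
  root : Fin numDarts
  rev_rev : ∀ d, rev (rev d) = d
  rev_ne : ∀ d, rev d ≠ d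
  connected : ∀ d, Relation.ReflTransGen (fun a b => b = next a ∨ b = rev a) root d
  euler : Nat.card (OrbitsOf next) + Nat.card (OrbitsOf (next⁻¹ * rev))
    = Nat.card (OrbitsOf rev) + 2

/-- A graph `G`, restricted to the vertex set `S`, is `2`-connected: it is connected, and the
removal of any vertex does not disconnect it (in particular a single edge is `2`-connected). -/
def TwoConnectedOn {V : Type} (G : SimpleGraph V) (S : Set V) : Prop :=
  (G.induce S).Connected ∧ ∀ w ∈ S, (G.induce (S \ {w})).Preconnected

namespace RootedMap

abbrev Dart (M : RootedMap) : Type := Fin M.numDarts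

abbrev Vertex (M : RootedMap) : Type := OrbitsOf M.next

def tail (M : RootedMap) (d : M.Dart) : M.Vertex := Quotient.mk _ d

def head (M : RootedMap) (d : M.Dart) : M.Vertex := M.tail (M.rev d)

/-- The face permutation: the dart after `d` on the boundary of the face on the right of `d`. -/
def faceNext (M : RootedMap) : Equiv.Perm M.Dart := M.next⁻¹ * M.rev

/-- The size of a map is its number of vertices. -/
noncomputable def numVertices (M : RootedMap) : ℕ := Nat.card M.Vertex

/-- The simple graph that underlies `M` (multiple edges are irrelevant to connectivity). -/
def graph (M : RootedMap) : SimpleGraph M.Vertex :=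
  SimpleGraph.fromRel fun x y => ∃ d, M.tail d = x ∧ M.head d = y

/-- A quadrangulation is a (connected) bipartite map all of whose faces have degree `4`; by
convention the map that consists of a single edge, with its two darts, is also a quadrangulation. -/
def IsQuadrangulation (M : RootedMap) : Prop :=
  (∃ c : M.Vertex → Bool, ∀ d, c (M.tail d) ≠ c (M.head d)) ∧
    (M.numDarts = 2 ∨ ∀ d, Function.minimalPeriod M.faceNext d = 4)

/-! ### The pre-root-block and its faces -/

/-- The vertex set of the pre-root-block: the largest vertex set that contains both endpoints of the
root edge and induces a `2`-connected submap. It is written as the union of all such sets, which is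
again such a set, because any two of them share an edge. -/
def blockVertices (M : RootedMap) : Set M.Vertex :=
  ⋃₀ {S | M.tail M.root ∈ S ∧ M.head M.root ∈ S ∧ TwoConnectedOn M.graph S}

/-- The number of vertices of the root block. Collapsing the facial `2`-cycles of the pre-root-block
into edges identifies parallel edges only, so the root block has the vertices of the
pre-root-block. -/
noncomputable def rootBlockSize (M : RootedMap) : ℕ := M.blockVertices.ncard

/-- The oriented edges of the pre-root-block, the submap induced by its vertex set. -/
def blockDarts (M : RootedMap) : Set M.Dart :=
  {d | M.tail d ∈ M.blockVertices ∧ M.head d ∈ M.blockVertices}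

/-- One step between sides of edges of `M` that lie in the same face of the pre-root-block: go on
along a face of `M`, or cross an edge that does not belong to the pre-root-block. -/
def regionStep (M : RootedMap) (a b : M.Dart) : Prop :=
  b = M.faceNext a ∨ (a ∉ M.blockDarts ∧ b = M.rev a)

/-- The faces of the pre-root-block, that is the connected components of its complement in the
sphere: each is made of the faces of `M` and the edges of `M` outside the pre-root-block that lie
in it. -/
abbrev BlockFace (M : RootedMap) : Type := Quotient (Relation.EqvGen.setoid M.regionStep)

/-- The face of the pre-root-block on the right of a dart (or around it, if the edge does not belong
to the pre-root-block). -/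
def blockFace (M : RootedMap) (d : M.Dart) : M.BlockFace := Quotient.mk _ d

/-- The darts of the pre-root-block that have the face `f` on their right. -/
def boundary (M : RootedMap) (f : M.BlockFace) : Set M.Dart :=
  {d | d ∈ M.blockDarts ∧ M.blockFace d = f}

/-- The faces of the pre-root-block that are enclosed by a facial `2`-cycle: the boundary consists
of two darts, from two different edges. -/
def digonFaces (M : RootedMap) : Set M.BlockFace :=
  {f | ∃ a b, a ≠ b ∧ a ≠ M.rev b ∧ M.boundary f = {a, b}}

/-- The vertices of the submap pendant to the pre-root-block in `f`. Its edges are all the edges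
of `M` that lie strictly inside `f`; for a face enclosed by a `2`-cycle they form a connected
submap. -/
def pendantVertices (M : RootedMap) (f : M.BlockFace) : Set M.Vertex :=
  M.tail '' {d | d ∉ M.blockDarts ∧ M.blockFace d = f}

/-! ### The breadth-first order -/

/-- The darts around the tail of `d`, in clockwise order from `d`. -/
noncomputable def star (M : RootedMap) (d : M.Dart) : List M.Dart :=
  List.iterate M.next d (Function.minimalPeriod M.next d)

open Classical in
/-- Breadth-first search. The list holds the darts around the vertices discovered so far; the
vertices come in the order of discovery, and around each vertex the darts come in clockwise order,
from the root at the first vertex, and from the edge through which the vertex was discovered at any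
other. Step `i` inspects the `i`-th dart of the list, and appends the darts around its head if this
vertex is new. -/
noncomputable def search (M : RootedMap) : ℕ → List M.Dart
  | 0 => M.star M.root
  | i + 1 =>
    match (M.search i)[i]? with
    | none => M.search i
    | some d => if M.rev d ∈ M.search i then M.search i else M.search i ++ M.star (M.rev d)

/-- All the oriented edges of `M`, in increasing breadth-first order. -/
noncomputable def dartList (M : RootedMap) : List M.Dart := M.search M.numDarts

/-- The position of an oriented edge in the breadth-first order. -/
noncomputable def rank (M : RootedMap) (d : M.Dart) : ℕ := M.dartList.idxOf d

/-- `d` is the first among the oriented edges incident to a face enclosed by a facial `2`-cycle of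
the pre-root-block. -/
def IsLeading (M : RootedMap) (d : M.Dart) : Prop :=
  M.blockFace d ∈ M.digonFaces ∧ d ∈ M.boundary (M.blockFace d) ∧
    ∀ d' ∈ M.boundary (M.blockFace d), M.rank d ≤ M.rank d'

open Classical in
/-- The faces enclosed by the facial `2`-cycles of the pre-root-block in the canonical order, which
is the breadth-first order of their first incident oriented edges. -/
noncomputable def orderedFaces (M : RootedMap) : List M.BlockFace :=
  (M.dartList.filter fun d => M.IsLeading d).map M.blockFace

/-- The sizes of the submaps pendant to the root block, in the canonical order. -/
noncomputable def pendantSizes (M : RootedMap) : List ℕ :=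
  M.orderedFaces.map fun f => (M.pendantVertices f).ncard

/-! ### Isomorphism -/

/-- An isomorphism of rooted maps (an orientation-preserving homeomorphism of the sphere that
respects the maps and their roots, seen on the darts). -/
structure Iso (M M' : RootedMap) where
  toEquiv : M.Dart ≃ M'.Dart
  map_next : ∀ d, toEquiv (M.next d) = M'.next (toEquiv d)
  map_rev : ∀ d, toEquiv (M.rev d) = M'.rev (toEquiv d)
  map_root : toEquiv M.root = M'.root

namespace Iso

def refl (M : RootedMap) : Iso M M := ⟨Equiv.refl _, fun _ => rfl, fun _ => rfl, rfl⟩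

def symm {M M' : RootedMap} (e : Iso M M') : Iso M' M where
  toEquiv := e.toEquiv.symm
  map_next d := by rw [Equiv.symm_apply_eq, e.map_next, Equiv.apply_symm_apply]
  map_rev d := by rw [Equiv.symm_apply_eq, e.map_rev, Equiv.apply_symm_apply]
  map_root := by rw [Equiv.symm_apply_eq, e.map_root]

def trans {M M' M'' : RootedMap} (e : Iso M M') (e' : Iso M' M'') : Iso M M'' where
  toEquiv := e.toEquiv.trans e'.toEquiv
  map_next d := by simp [e.map_next, e'.map_next]
  map_rev d := by simp [e.map_rev, e'.map_rev]
  map_root := by simp [e.map_root, e'.map_root]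

variable {M M' : RootedMap}

theorem symm_apply (e : Iso M M') (d : M.Dart) : e.symm.toEquiv (e.toEquiv d) = d := e.toEquiv.symm_apply_apply d

theorem map_faceNext (e : Iso M M') (d : M.Dart) : e.toEquiv (M.faceNext d) = M'.faceNext (e.toEquiv d) := by
  simp only [faceNext, Equiv.Perm.mul_apply]
  rw [Equiv.Perm.eq_inv_iff_eq, ← e.map_next]
  simp [e.map_rev]

theorem sameCycle_iff (e : Iso M M') (a b : M.Dart) :
    M.next.SameCycle a b ↔ M'.next.SameCycle (e.toEquiv a) (e.toEquiv b) := by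
  have h : M'.next = e.toEquiv.permCongr M.next := by
    ext d
    simp [Equiv.permCongr_apply, e.map_next]
  have hz : ∀ i : ℤ, (M'.next ^ i) (e.toEquiv a) = e.toEquiv ((M.next ^ i) a) := by
    intro i
    have : M'.next ^ i = e.toEquiv.permCongr (M.next ^ i) := by
      rw [h]; exact (map_zpow e.toEquiv.permCongrHom M.next i).symm
    rw [this]; simp [Equiv.permCongr_apply]
  simp only [Equiv.Perm.SameCycle, hz, e.toEquiv.injective.eq_iff]

def vertexEquiv (e : Iso M M') : M.Vertex ≃ M'.Vertex :=
  Quotient.congr e.toEquiv fun a b => e.sameCycle_iff a b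

theorem map_tail (e : Iso M M') (d : M.Dart) : M'.tail (e.toEquiv d) = e.vertexEquiv (M.tail d) := rfl

theorem map_head (e : Iso M M') (d : M.Dart) : M'.head (e.toEquiv d) = e.vertexEquiv (M.head d) := by
  rw [head, head, ← e.map_rev, e.map_tail]

theorem numVertices_eq (e : Iso M M') : M.numVertices = M'.numVertices := Nat.card_congr e.vertexEquiv

theorem numDarts_eq (e : Iso M M') : M.numDarts = M'.numDarts := by
  simpa using Fintype.card_congr e.toEquiv

theorem minimalPeriod_eq {D D' : Type} (g : D ≃ D') (f : D → D) (f' : D' → D')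
    (h : ∀ d, g (f d) = f' (g d)) (d : D) :
    Function.minimalPeriod f' (g d) = Function.minimalPeriod f d := by
  have hs : Function.Semiconj g f f' := h
  rw [Function.minimalPeriod_eq_minimalPeriod_iff]
  intro n
  simp only [Function.IsPeriodicPt, Function.IsFixedPt]
  rw [← (hs.iterate_right n) d, g.injective.eq_iff]

theorem isQuadrangulation (e : Iso M M') (h : M.IsQuadrangulation) : M'.IsQuadrangulation := by
  obtain ⟨⟨c, hc⟩, h⟩ := h
  refine ⟨⟨c ∘ e.symm.vertexEquiv, fun d => ?_⟩, ?_⟩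
  · simp only [Function.comp, ← e.symm.map_tail, ← e.symm.map_head]
    exact hc _
  · refine h.imp (fun h => e.numDarts_eq ▸ h) fun h d => ?_
    rw [← minimalPeriod_eq e.symm.toEquiv _ M.faceNext e.symm.map_faceNext]
    exact h _

def graphIso (e : Iso M M') : M.graph ≃g M'.graph where
  toEquiv := e.vertexEquiv
  map_rel_iff' {x y} := by
    have key : ∀ x y, (∃ d, M'.tail d = e.vertexEquiv x ∧ M'.head d = e.vertexEquiv y) ↔
        ∃ d, M.tail d = x ∧ M.head d = y := by
      intro x y
      rw [← e.toEquiv.exists_congr_right]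
      simp only [e.map_tail, e.map_head, e.vertexEquiv.injective.eq_iff]
    simp only [graph, SimpleGraph.fromRel_adj, key, ne_eq, e.vertexEquiv.injective.eq_iff]

theorem twoConnectedOn_image {V V' : Type} {G : SimpleGraph V} {G' : SimpleGraph V'}
    (g : G ≃g G') {S : Set V} (h : TwoConnectedOn G S) : TwoConnectedOn G' (g '' S) := by
  have hi : ∀ T : Set V, Nonempty (G.induce T ≃g G'.induce (g '' T)) := fun T =>
    ⟨{ toEquiv := g.toEquiv.image T
       map_rel_iff' := by
         intro a b
         exact g.map_adj_iff }⟩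
  refine ⟨(hi S).some.connected_iff.1 h.1, ?_⟩
  rintro _ ⟨w, hw, rfl⟩
  have : (g '' S) \ {g w} = g '' (S \ {w}) := by
    rw [Set.image_sdiff g.injective, Set.image_singleton]
  rw [this]
  exact (hi _).some.preconnected_iff.1 (h.2 w hw)

theorem mem_blockVertices_of (e : Iso M M') {x : M.Vertex} (h : x ∈ M.blockVertices) :
    e.vertexEquiv x ∈ M'.blockVertices := by
  obtain ⟨S, ⟨h1, h2, h3⟩, hx⟩ := h
  refine ⟨e.graphIso '' S, ⟨?_, ?_, twoConnectedOn_image e.graphIso h3⟩, ⟨x, hx, rfl⟩⟩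
  · rw [← e.map_root, e.map_tail]; exact ⟨_, h1, rfl⟩
  · rw [← e.map_root, e.map_head]; exact ⟨_, h2, rfl⟩

theorem vertexEquiv_symm (e : Iso M M') (x : M.Vertex) : e.symm.vertexEquiv (e.vertexEquiv x) = x := by
  induction x using Quotient.inductionOn with
  | h d => exact congrArg M.tail (e.symm_apply d)

theorem mem_blockVertices_iff (e : Iso M M') (x : M.Vertex) :
    e.vertexEquiv x ∈ M'.blockVertices ↔ x ∈ M.blockVertices :=
  ⟨fun h => by simpa [vertexEquiv_symm] using e.symm.mem_blockVertices_of h,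
    e.mem_blockVertices_of⟩

theorem rootBlockSize_eq (e : Iso M M') : M.rootBlockSize = M'.rootBlockSize := by
  have : M'.blockVertices = e.vertexEquiv '' M.blockVertices := by
    ext x
    obtain ⟨x, rfl⟩ := e.vertexEquiv.surjective x
    simp [mem_blockVertices_iff]
  rw [rootBlockSize, rootBlockSize, this, Set.ncard_image_of_injective _ e.vertexEquiv.injective]

theorem mem_blockDarts_iff (e : Iso M M') (d : M.Dart) : e.toEquiv d ∈ M'.blockDarts ↔ d ∈ M.blockDarts := by
  simp only [blockDarts, Set.mem_ofPred_eq, e.map_tail, e.map_head, mem_blockVertices_iff]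

theorem regionStep_of (e : Iso M M') {a b : M.Dart} (h : M.regionStep a b) :
    M'.regionStep (e.toEquiv a) (e.toEquiv b) := by
  rcases h with rfl | ⟨h, rfl⟩
  · exact Or.inl (e.map_faceNext a)
  · exact Or.inr ⟨fun h' => h ((e.mem_blockDarts_iff a).1 h'), e.map_rev a⟩

theorem sameRegion_of (e : Iso M M') {a b : M.Dart} (h : Relation.EqvGen M.regionStep a b) :
    Relation.EqvGen M'.regionStep (e.toEquiv a) (e.toEquiv b) := by
  induction h with
  | rel _ _ h => exact .rel _ _ (e.regionStep_of h)
  | refl _ => exact .refl _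
  | symm _ _ _ ih => exact .symm _ _ ih
  | trans _ _ _ _ _ ih ih' => exact .trans _ _ _ ih ih'

def faceEquiv (e : Iso M M') : M.BlockFace ≃ M'.BlockFace :=
  Quotient.congr e.toEquiv fun a b =>
    ⟨fun h => e.sameRegion_of h, fun h => by
      have := e.symm.sameRegion_of h
      rwa [symm_apply, symm_apply] at this⟩

theorem map_blockFace (e : Iso M M') (d : M.Dart) : M'.blockFace (e.toEquiv d) = e.faceEquiv (M.blockFace d) := rfl

theorem mem_boundary_iff (e : Iso M M') (f : M.BlockFace) (d : M.Dart) :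
    e.toEquiv d ∈ M'.boundary (e.faceEquiv f) ↔ d ∈ M.boundary f := by
  simp only [boundary, Set.mem_ofPred_eq, e.map_blockFace, mem_blockDarts_iff,
    e.faceEquiv.injective.eq_iff]

theorem mem_digonFaces_iff (e : Iso M M') (f : M.BlockFace) :
    e.faceEquiv f ∈ M'.digonFaces ↔ f ∈ M.digonFaces := by
  have hb : M'.boundary (e.faceEquiv f) = e.toEquiv '' M.boundary f := by
    ext d
    obtain ⟨d, rfl⟩ := e.toEquiv.surjective d
    simp [mem_boundary_iff]
  simp only [digonFaces, Set.mem_ofPred_eq, hb]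
  rw [← e.toEquiv.exists_congr_right]
  refine exists_congr fun a => ?_
  rw [← e.toEquiv.exists_congr_right]
  refine exists_congr fun b => ?_
  rw [← e.map_rev, ← Set.image_pair, e.toEquiv.injective.image_injective.eq_iff]
  simp only [ne_eq, e.toEquiv.injective.eq_iff]

theorem ncard_digonFaces_eq (e : Iso M M') : M.digonFaces.ncard = M'.digonFaces.ncard := by
  have : M'.digonFaces = e.faceEquiv '' M.digonFaces := by
    ext f
    obtain ⟨f, rfl⟩ := e.faceEquiv.surjective f
    simp [mem_digonFaces_iff]
  rw [this, Set.ncard_image_of_injective _ e.faceEquiv.injective]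

theorem ncard_pendantVertices_eq (e : Iso M M') (f : M.BlockFace) :
    (M'.pendantVertices (e.faceEquiv f)).ncard = (M.pendantVertices f).ncard := by
  have : M'.pendantVertices (e.faceEquiv f) = e.vertexEquiv '' M.pendantVertices f := by
    ext x
    simp only [pendantVertices, Set.mem_image, Set.mem_ofPred_eq, exists_exists_and_eq_and]
    rw [← e.toEquiv.exists_congr_right]
    simp only [mem_blockDarts_iff, map_blockFace, e.faceEquiv.injective.eq_iff, map_tail]
  rw [this, Set.ncard_image_of_injective _ e.vertexEquiv.injective]

theorem map_star (e : Iso M M') (d : M.Dart) : M'.star (e.toEquiv d) = (M.star d).map e.toEquiv := by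
  have h : ∀ (n : ℕ) (d : M.Dart),
      List.iterate M'.next (e.toEquiv d) n = (List.iterate M.next d n).map e.toEquiv := by
    intro n
    induction n with
    | zero => intro d; rfl
    | succ n ih => intro d; simp [List.iterate, ← e.map_next, ih]
  rw [star, star, h, minimalPeriod_eq e.toEquiv _ _ e.map_next]

theorem map_search (e : Iso M M') (i : ℕ) : M'.search i = (M.search i).map e.toEquiv := by
  induction i with
  | zero => rw [search, search, ← e.map_root, map_star]
  | succ i ih =>
    rw [search, search, ih, List.getElem?_map]
    cases h : (M.search i)[i]? with
    | none => rfl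
    | some d =>
      simp only [Option.map_some, ← e.map_rev, List.mem_map, e.toEquiv.injective.eq_iff,
        exists_eq_right]
      split_ifs
      · rfl
      · rw [List.map_append, map_star]

theorem map_dartList (e : Iso M M') : M'.dartList = M.dartList.map e.toEquiv := by
  rw [dartList, dartList, ← e.numDarts_eq, map_search]

theorem rank_eq (e : Iso M M') (d : M.Dart) : M'.rank (e.toEquiv d) = M.rank d := by
  rw [rank, rank, e.map_dartList]
  induction M.dartList with
  | nil => rfl
  | cons a l ih =>
    have : (e.toEquiv a == e.toEquiv d) = (a == d) := by
      rw [Bool.eq_iff_iff]; simp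
    simp only [List.map_cons, List.idxOf_cons, ih, this]

theorem isLeading_iff (e : Iso M M') (d : M.Dart) : M'.IsLeading (e.toEquiv d) ↔ M.IsLeading d := by
  simp only [IsLeading, map_blockFace, mem_digonFaces_iff, mem_boundary_iff, rank_eq]
  rw [← e.toEquiv.forall_congr_right]
  simp only [mem_boundary_iff, rank_eq]

theorem pendantSizes_eq (e : Iso M M') : M.pendantSizes = M'.pendantSizes := by
  simp only [pendantSizes, orderedFaces, e.map_dartList, List.filter_map, List.map_map]
  simp only [Function.comp_def, e.map_blockFace, e.ncard_pendantVertices_eq]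
  rw [List.filter_congr fun d _ => decide_eq_decide.2 (e.isLeading_iff d)]

end Iso

instance isoSetoid : Setoid RootedMap where
  r M M' := Nonempty (Iso M M')
  iseqv := ⟨fun M => ⟨Iso.refl M⟩, fun ⟨e⟩ => ⟨e.symm⟩, fun ⟨e⟩ ⟨e'⟩ => ⟨e.trans e'⟩⟩

end RootedMap

/-- Rooted planar maps up to orientation-preserving homeomorphism. -/
def RootedMapClass : Type := Quotient RootedMap.isoSetoid

namespace RootedMapClass

instance : MeasurableSpace RootedMapClass := ⊤

def IsQuadrangulation : RootedMapClass → Prop :=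
  Quotient.lift RootedMap.IsQuadrangulation fun _ _ ⟨e⟩ =>
    propext ⟨e.isQuadrangulation, e.symm.isQuadrangulation⟩

noncomputable def numVertices : RootedMapClass → ℕ :=
  Quotient.lift RootedMap.numVertices fun _ _ ⟨e⟩ => e.numVertices_eq

noncomputable def rootBlockSize : RootedMapClass → ℕ :=
  Quotient.lift RootedMap.rootBlockSize fun _ _ ⟨e⟩ => e.rootBlockSize_eq

/-- The number of faces enclosed by the facial `2`-cycles of the pre-root-block. -/
noncomputable def numDigonFaces : RootedMapClass → ℕ :=
  Quotient.lift (fun M => M.digonFaces.ncard) fun _ _ ⟨e⟩ => e.ncard_digonFaces_eq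

/-- The sizes of the submaps pendant to the root block, in the canonical order. -/
noncomputable def pendantSizes : RootedMapClass → List ℕ :=
  Quotient.lift RootedMap.pendantSizes fun _ _ ⟨e⟩ => e.pendantSizes_eq

/-- The size, minus one, of the `i`-th submap pendant to the root block, with `i` counted
from `0`. -/
noncomputable def Y (q : RootedMapClass) (i : ℕ) : ℕ := q.pendantSizes.getD i 0 - 1

end RootedMapClass

/-- The rooted quadrangulations with `n` vertices. -/
def quadrangulations (n : ℕ) : Set RootedMapClass :=
  {q | q.IsQuadrangulation ∧ q.numVertices = n}

/-- The rooted quadrangulations with `n` vertices, `r` of them in the root block, for which `N`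
faces are enclosed by the facial `2`-cycles of the pre-root-block. -/
def quadrangulationsWith (n r N : ℕ) : Set RootedMapClass :=
  {q ∈ quadrangulations n | q.rootBlockSize = r ∧ q.numDigonFaces = N}

/-- For `k ≥ 1`, the number `psi k` that is determined by the equation
`|Q_{k+1}| = (2 / √π) * 12 ^ (k - 1) * (1 + psi k) / k ^ (5 / 2)`, where `Q_{k+1}` is the set
of rooted quadrangulations with `k + 1` vertices. -/
noncomputable def psi (k : ℕ) : ℝ :=
  (quadrangulations (k + 1)).ncard * (k : ℝ) ^ (5 / 2 : ℝ) * √Real.pi / (2 * 12 ^ (k - 1)) - 1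

/-- The defining equation of `psi`. -/
theorem ncard_quadrangulations (k : ℕ) (hk : 2 ≤ k) : ((quadrangulations k).ncard : ℝ) =
    2 / √Real.pi * (12 ^ (k - 2) * (1 + psi (k - 1)) / ((k : ℝ) - 1) ^ (5 / 2 : ℝ)) := by
  obtain ⟨j, rfl⟩ := Nat.exists_eq_add_of_le hk
  have h1 : √Real.pi ≠ 0 := by positivity
  have h2 : ((1 + j : ℕ) : ℝ) ^ (5 / 2 : ℝ) ≠ 0 := by positivity
  have e1 : 2 + j - 1 = 1 + j := by omega
  have e2 : ((2 + j : ℕ) : ℝ) - 1 = ((1 + j : ℕ) : ℝ) := by push_cast; ring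
  have e3 : 1 + j + 1 = 2 + j := by omega
  have e4 : 2 + j - 2 = j := by omega
  have e5 : 1 + j - 1 = j := by omega
  rw [psi, e1, e2, e3, e4, e5]
  field_simp
  ring

/-- The weight `(1 + psi k) / k ^ (5 / 2)`, for `k ≥ 1`. -/
noncomputable def weight (k : ℕ) : ℝ := (1 + psi k) / (k : ℝ) ^ (5 / 2 : ℝ)

/-- The point probabilities of `ξ` at the integers `k ≥ 1`. -/
noncomputable def xiProb (k : ℕ) : ℝ := weight k / ∑' l : ℕ, weight (l + 1)

/-! ### Orbits of permutations of a finite set -/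

/-! The statement is an enumeration in disguise. For a list `L` of sizes at least `2`, the number of
rooted quadrangulations with root block of size `r` and pendant sizes `L` is `C * ∏ |Q_k|`, the
product over `k` in `L`, where `C` counts those with the same number of pendant submaps, all of size
`2` (`ncard_quadrangulationsOfSizes`). Hence the law of `(Y_i)` gives `(y_i)` a mass proportional to
`∏ |Q_{y_i + 1}|`. The weight `w(k)` is a constant times `12 ^ (-k) * |Q_{k+1}|`, and the powers of
`12` multiply to a number that depends only on `∑ y_i = n - r`. So the law of `(ξ_i)` on the event
`S_N = n - r` is proportional to the same product, and conditioning makes both laws probabilities on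
the same finite set of allocations. The conditioning event has positive probability because the sum
of these products is nonzero, being the normalisation of the law of `(Y_i)`.

The product formula is obtained by exchanging one pendant submap at a time for a single edge
(`ncard_quadrangulationsOfSizes_append_cons`). If the pendant submap in a face is a single edge,
that edge and the root edge of a quadrangulation `P` are slit open and glued along the slits.
`EdgeSum` records this on darts: the face permutation is a direct sum, and the reversal is altered
at four darts only. Face degrees therefore survive. Counting orbits shows that the result is planar
(`exists_edgeSum`). The attaching vertex is a cut vertex, so the pre-root-block and its faces are
unchanged (`EdgeSum.blockVertices_eq`, `EdgeSum.faceMap`). The breadth-first order of the remaining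
darts is unchanged too (`EdgeSum.filter_dartList`), so the faces keep their indices and only one
pendant size is altered (`EdgeSum.pendantSizes_eq`).

For the converse, maximality of the pre-root-block forbids short ears. A face of the quadrangulation
where the boundary of the block runs into a pendant submap therefore has two sides `a`, `b` in the
block and two sides `p`, `q` that go out and come back to the same vertex
(`face_of_notMem_blockDarts`). If `p` and `q` lie on different edges, these edges are zipped
together. This raises the Euler characteristic to `4`, so by nonnegativity of the genus
(`Equiv.Perm.card_orbits_add_le`) the map falls into two planar maps `M` and `P`
(`exists_edgeSum_of_face`). The dart `p` is determined by the index of the face, hence gluing and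
cutting are inverse to each other up to isomorphism (`EdgeSum.nonempty_iso`,
`EdgeSum.nonempty_iso_summands`). -/

theorem card_quotient_join {D : Type} [Finite D] (r s : Setoid D) (x y : D) (hxy : ¬ r x y)
    (h : ∀ a b, s a b ↔ r a b ∨ (r a x ∧ r y b) ∨ (r a y ∧ r x b)) :
    Nat.card (Quotient s) + 1 = Nat.card (Quotient r) := by
  classical
  have hle : ∀ a b, r a b → s a b := fun a b hab => (h a b).2 (Or.inl hab)
  -- Every class of `s` contains exactly one class of `r` other than that of `y`.
  have e : {c : Quotient r // c ≠ Quotient.mk r y} ≃ Quotient s := by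
    refine Equiv.ofBijective
      (fun c => Quotient.map' (s₁ := r) (s₂ := s) id hle c.1) ⟨?_, ?_⟩
    · rintro ⟨c, hc⟩ ⟨c', hc'⟩ heq
      induction c using Quotient.inductionOn with | h a => ?_
      induction c' using Quotient.inductionOn with | h b => ?_
      have hs : s a b := Quotient.exact heq
      have ha : ¬ r a y := fun h => hc (Quotient.sound h)
      have hb : ¬ r b y := fun h => hc' (Quotient.sound h)
      rcases (h a b).1 hs with h | ⟨_, h⟩ | ⟨h, _⟩
      · exact Subtype.ext (Quotient.sound h)
      · exact absurd (r.symm' h) hb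
      · exact absurd h ha
    · intro c
      induction c using Quotient.inductionOn with | h a => ?_
      by_cases ha : r a y
      · refine ⟨⟨Quotient.mk r x, fun h => hxy (Quotient.exact h)⟩, ?_⟩
        exact Quotient.sound ((h x a).2 (Or.inr (Or.inl ⟨r.refl' x, r.symm' ha⟩)))
      · exact ⟨⟨Quotient.mk r a, fun h => ha (Quotient.exact h)⟩, rfl⟩
  have : Finite (Quotient r) := Quotient.finite _
  have : Fintype (Quotient r) := Fintype.ofFinite _
  rw [← Nat.card_congr e, Nat.card_eq_fintype_card, Nat.card_eq_fintype_card,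
    Fintype.card_subtype_compl, Fintype.card_subtype_eq]
  have : 0 < Fintype.card (Quotient r) := Fintype.card_pos_iff.2 ⟨Quotient.mk r y⟩
  omega

namespace Equiv.Perm

variable {D : Type}

/-- The orbits of a permutation are the classes of the least equivalence relation that relates every
point to its image. -/
theorem SameCycle.rel_of_step {π : Equiv.Perm D} (r : Setoid D) (h : ∀ a, r a (π a)) {a b : D}
    (hab : π.SameCycle a b) : r a b := by
  obtain ⟨i, rfl⟩ := hab
  induction i using Int.induction_on with
  | zero => exact r.refl' _
  | succ i ih => rw [add_comm, zpow_add, zpow_one]; exact r.trans' ih (h _)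
  | pred i ih =>
    refine r.trans' ih (r.symm' ?_)
    have := h ((π ^ (-(i : ℤ) - 1)) a)
    rwa [← Equiv.Perm.mul_apply, ← zpow_one_add, show 1 + (-(i : ℤ) - 1) = -i by ring] at this

theorem SameCycle.map_eq {β : Sort*} {π : Equiv.Perm D} (g : D → β) (h : ∀ a, g (π a) = g a)
    {a b : D} (hab : π.SameCycle a b) : g a = g b :=
  SameCycle.rel_of_step (π := π) ⟨fun a b => g a = g b, fun _ => Eq.refl _, Eq.symm, Eq.trans⟩
    (fun a => (h a).symm) hab


/-- Until `π` first returns to `x`, its orbit meets neither `x` nor `y`, so the swap does nothing.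
At the return the swap diverts the orbit to `y`. -/
theorem sameCycle_swap_mul_self [Finite D] [DecidableEq D]
    {π : Equiv.Perm D} {x y : D}
    (hxy : ¬ π.SameCycle x y) : (Equiv.swap x y * π).SameCycle x y := by
  have hp : ∃ k, 0 < k ∧ (π ^ k) x = x :=
    ⟨orderOf π, orderOf_pos π, by rw [pow_orderOf_eq_one]; rfl⟩
  classical
  obtain ⟨hk, hkx⟩ := Nat.find_spec hp
  have hmin : ∀ j, 0 < j → j < Nat.find hp → (π ^ j) x ≠ x := fun j h0 hj h =>
    Nat.find_min hp hj ⟨h0, h⟩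
  generalize Nat.find hp = k at hk hkx hmin
  have hny : ∀ j, (π ^ j) x ≠ y := fun j h => hxy ⟨j, by simpa using h⟩
  have key : ∀ j, j < k → ((Equiv.swap x y * π) ^ j) x = (π ^ j) x := by
    intro j
    induction j with
    | zero => intro _; rfl
    | succ j ih =>
      intro hj
      rw [pow_succ', mul_apply, ih (by omega), mul_apply, ← mul_apply π, ← pow_succ']
      exact Equiv.swap_apply_of_ne_of_ne (hmin _ (by omega) hj) (hny _)
  refine ⟨(k : ℤ), ?_⟩
  obtain ⟨j, rfl⟩ : ∃ j, k = j + 1 := ⟨k - 1, by omega⟩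
  rw [zpow_natCast, pow_succ', mul_apply, key j (by omega), mul_apply, ← mul_apply π, ← pow_succ',
    hkx, Equiv.swap_apply_left]

theorem sameCycle_swap_mul_of_sameCycle [Finite D] [DecidableEq D]
    {π : Equiv.Perm D} {x y : D}
    (hxy : ¬ π.SameCycle x y) {a b : D} (h : π.SameCycle a b) :
    (Equiv.swap x y * π).SameCycle a b := by
  have hm := sameCycle_swap_mul_self hxy
  refine h.rel_of_step (SameCycle.setoid (Equiv.swap x y * π)) fun a => ?_
  change (Equiv.swap x y * π).SameCycle a (π a)
  have h1 : (Equiv.swap x y * π).SameCycle a (Equiv.swap x y (π a)) :=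
    sameCycle_apply_right.2 (SameCycle.refl _ a)
  by_cases hx : π a = x
  · rw [hx, Equiv.swap_apply_left] at h1; rw [hx]; exact h1.trans hm.symm
  by_cases hy : π a = y
  · rw [hy, Equiv.swap_apply_right] at h1; rw [hy]; exact h1.trans hm
  · rwa [Equiv.swap_apply_of_ne_of_ne hx hy] at h1

theorem sameCycle_swap_mul_iff [Finite D] [DecidableEq D]
    {π : Equiv.Perm D} {x y : D}
    (hxy : ¬ π.SameCycle x y) (a b : D) : (Equiv.swap x y * π).SameCycle a b ↔
      π.SameCycle a b ∨ (π.SameCycle a x ∧ π.SameCycle y b) ∨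
        (π.SameCycle a y ∧ π.SameCycle x b) := by
  constructor
  · intro h
    classical
    have hc : ∀ a b, π.SameCycle a b →
        ((if π.SameCycle a y then x else a) = (if π.SameCycle b y then x else b) ∨
          π.SameCycle (if π.SameCycle a y then x else a) (if π.SameCycle b y then x else b)) := by
      intro a b hab
      have : π.SameCycle a y ↔ π.SameCycle b y := ⟨hab.symm.trans, hab.trans⟩
      split_ifs <;> tauto
    -- The orbit of `y` is identified with that of `x`; this makes `g` an invariant of the swapped
    -- permutation.
    let g : D → OrbitsOf π := fun a => Quotient.mk _ (if π.SameCycle a y then x else a)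
    have hπ : ∀ a b, π.SameCycle a b → g a = g b := by
      intro a b hab
      rcases hc a b hab with h | h
      · simp only [g, h]
      · exact Quotient.sound h
    have hgxy : g x = g y := by simp [g, hxy, SameCycle.refl]
    have hg : ∀ a, g ((Equiv.swap x y * π) a) = g a := by
      intro a
      have h0 : g (π a) = g a := hπ _ _ (sameCycle_apply_left.2 (SameCycle.refl _ a))
      rw [← h0, mul_apply]
      by_cases hx : π a = x
      · rw [hx, Equiv.swap_apply_left, hgxy]
      by_cases hy : π a = y
      · rw [hy, Equiv.swap_apply_right, hgxy]
      · rw [Equiv.swap_apply_of_ne_of_ne hx hy]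
    have := Quotient.exact (h.map_eq g hg)
    change π.SameCycle _ _ at this
    split_ifs at this with h1 h2 h2
    · exact Or.inl (h1.trans h2.symm)
    · exact Or.inr (Or.inr ⟨h1, this⟩)
    · exact Or.inr (Or.inl ⟨this, h2.symm⟩)
    · exact Or.inl this
  · have hm := sameCycle_swap_mul_self hxy
    rintro (h | ⟨h, h'⟩ | ⟨h, h'⟩)
    · exact sameCycle_swap_mul_of_sameCycle hxy h
    · exact (sameCycle_swap_mul_of_sameCycle hxy h).trans
        (hm.trans (sameCycle_swap_mul_of_sameCycle hxy h'))
    · exact (sameCycle_swap_mul_of_sameCycle hxy h).trans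
        (hm.symm.trans (sameCycle_swap_mul_of_sameCycle hxy h'))

/-- When the orbit of `x` is about to reach `y` for the first time, the swap sends it back to `x`.
The new cycle of `x` closes before `y`. -/
theorem not_sameCycle_swap_mul [Finite D] [DecidableEq D]
    {π : Equiv.Perm D} {x y : D} (hne : x ≠ y)
    (hxy : π.SameCycle x y) : ¬ (Equiv.swap x y * π).SameCycle x y := by
  have hp : ∃ k : ℕ, (π ^ k) x = y := by
    obtain ⟨i, -, hi⟩ := hxy.exists_pow_eq'
    exact ⟨i, hi⟩
  classical
  have hk := Nat.find_spec hp
  have hmin : ∀ j, j < Nat.find hp → (π ^ j) x ≠ y := fun j hj h => Nat.find_min hp hj h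
  generalize Nat.find hp = k at hk hmin
  have hk0 : 0 < k := Nat.pos_of_ne_zero fun h => hne (by simpa [h] using hk)
  have hnx : ∀ j, 0 < j → j < k → (π ^ j) x ≠ x := by
    intro j h0 hj h
    refine hmin (k - j) (by omega) ?_
    rw [← hk]
    conv_rhs => rw [show k = (k - j) + j by omega, pow_add, mul_apply, h]
  have key : ∀ j, j < k → ((Equiv.swap x y * π) ^ j) x = (π ^ j) x := by
    intro j
    induction j with
    | zero => intro _; rfl
    | succ j ih =>
      intro hj
      rw [pow_succ', mul_apply, ih (by omega), mul_apply, ← mul_apply π, ← pow_succ']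
      exact Equiv.swap_apply_of_ne_of_ne (hnx _ (by omega) hj) (hmin _ hj)
  have hper : ((Equiv.swap x y * π) ^ k) x = x := by
    obtain ⟨j, rfl⟩ : ∃ j, k = j + 1 := ⟨k - 1, by omega⟩
    rw [pow_succ', mul_apply, key j (by omega), mul_apply, ← mul_apply π, ← pow_succ',
      hk, Equiv.swap_apply_right]
  intro h
  obtain ⟨m, -, hm⟩ := h.exists_pow_eq'
  have hper' : ∀ i : ℕ, ((Equiv.swap x y * π) ^ (k * i)) x = x := by
    intro i
    induction i with
    | zero => rfl
    | succ i ih => rw [mul_add, pow_add, mul_apply, mul_one, hper, ih]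
  rw [← Nat.mod_add_div m k, pow_add, mul_apply, hper', key _ (Nat.mod_lt _ hk0)] at hm
  exact hmin _ (Nat.mod_lt _ hk0) hm

theorem card_orbits_swap_mul_of_not_sameCycle [Finite D] [DecidableEq D]
    {π : Equiv.Perm D} {x y : D}
    (hxy : ¬ π.SameCycle x y) :
    Nat.card (OrbitsOf (Equiv.swap x y * π)) + 1 = Nat.card (OrbitsOf π) :=
  card_quotient_join (SameCycle.setoid π) (SameCycle.setoid (Equiv.swap x y * π)) x y hxy
    (sameCycle_swap_mul_iff hxy)

theorem card_orbits_swap_mul_of_sameCycle [Finite D] [DecidableEq D]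
    {π : Equiv.Perm D} {x y : D}
    (hne : x ≠ y) (hxy : π.SameCycle x y) :
    Nat.card (OrbitsOf (Equiv.swap x y * π)) = Nat.card (OrbitsOf π) + 1 := by
  have := card_orbits_swap_mul_of_not_sameCycle (not_sameCycle_swap_mul hne hxy)
  rw [← mul_assoc, Equiv.swap_mul_self, one_mul] at this
  omega

theorem card_orbits_swap_mul_le [Finite D] [DecidableEq D]
    {π : Equiv.Perm D} {x y : D} (hne : x ≠ y) :
    Nat.card (OrbitsOf (Equiv.swap x y * π)) ≤ Nat.card (OrbitsOf π) + 1 := by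
  by_cases h : π.SameCycle x y
  · exact (card_orbits_swap_mul_of_sameCycle hne h).le
  · have := card_orbits_swap_mul_of_not_sameCycle h
    omega

theorem card_orbits_inv (π : Equiv.Perm D) : Nat.card (OrbitsOf π⁻¹) = Nat.card (OrbitsOf π) :=
  Nat.card_congr (Quotient.congr (Equiv.refl D) fun _ _ => sameCycle_inv)

theorem card_orbits_one : Nat.card (OrbitsOf (1 : Equiv.Perm D)) = Nat.card D := by
  refine (Nat.card_congr (Equiv.ofBijective (fun d : D => (Quotient.mk _ d : OrbitsOf 1))
    ⟨fun a b h => ?_, fun c => ?_⟩)).symm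
  · obtain ⟨i, hi⟩ : SameCycle 1 a b := Quotient.exact h
    simpa using hi
  · induction c using Quotient.inductionOn with | h a => exact ⟨a, rfl⟩

/-! ### Connected components and nonnegativity of the genus -/

/-- The classes of darts under two permutations, that is the connected components of a map. -/
abbrev jointOrbit {D : Type} (φ α : Equiv.Perm D) : Setoid D :=
  Relation.EqvGen.setoid fun a b => b = φ a ∨ b = α a

theorem jointOrbit_le {φ α : Equiv.Perm D} (r : Setoid D) (h₁ : ∀ a, r a (φ a))
    (h₂ : ∀ a, r a (α a)) {a b : D} (h : jointOrbit φ α a b) : r a b := by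
  change Relation.EqvGen _ a b at h
  induction h with
  | rel a b h => rcases h with rfl | rfl <;> [exact h₁ a; exact h₂ a]
  | refl a => exact r.refl' a
  | symm _ _ _ ih => exact r.symm' ih
  | trans _ _ _ _ _ ih ih' => exact r.trans' ih ih'

theorem jointOrbit_left (φ α : Equiv.Perm D) (a : D) : jointOrbit φ α a (φ a) :=
  Relation.EqvGen.rel _ _ (Or.inl rfl)

theorem jointOrbit_right (φ α : Equiv.Perm D) (a : D) : jointOrbit φ α a (α a) :=
  Relation.EqvGen.rel _ _ (Or.inr rfl)

/-- The join of an equivalence relation with a single pair. -/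
def joinPair (r : Setoid D) (x y : D) : Setoid D where
  r a b := r a b ∨ (r a x ∧ r y b) ∨ (r a y ∧ r x b)
  iseqv := by
    refine ⟨fun a => Or.inl (r.refl' a), ?_, ?_⟩
    · intro a b h
      have := @r.symm'
      rcases h with h | ⟨h, h'⟩ | ⟨h, h'⟩
      · exact Or.inl (r.symm' h)
      · exact Or.inr (Or.inr ⟨r.symm' h', r.symm' h⟩)
      · exact Or.inr (Or.inl ⟨r.symm' h', r.symm' h⟩)
    · intro a b c h h'
      rcases h with h | ⟨h, h1⟩ | ⟨h, h1⟩ <;> rcases h' with h2 | ⟨h2, h3⟩ | ⟨h2, h3⟩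
      · exact Or.inl (r.trans' h h2)
      · exact Or.inr (Or.inl ⟨r.trans' h h2, h3⟩)
      · exact Or.inr (Or.inr ⟨r.trans' h h2, h3⟩)
      · exact Or.inr (Or.inl ⟨h, r.trans' h1 h2⟩)
      · exact Or.inl (r.trans' h (r.trans' (r.symm' (r.trans' h1 h2)) h3))
      · exact Or.inl (r.trans' h h3)
      · exact Or.inr (Or.inr ⟨h, r.trans' h1 h2⟩)
      · exact Or.inl (r.trans' h h3)
      · exact Or.inl (r.trans' h (r.trans' (r.symm' (r.trans' h1 h2)) h3))

/-- The genus of a rotation system is nonnegative. -/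
theorem card_orbits_add_le [Finite D] [DecidableEq D] (φ α : Equiv.Perm D) (hα : ∀ a, α (α a) = a) :
    Nat.card (OrbitsOf (α * φ⁻¹)) + Nat.card (OrbitsOf φ) + Nat.card (OrbitsOf α) ≤
      Nat.card D + 2 * Nat.card (Quotient (jointOrbit φ α)) := by
  classical
  have : Fintype D := Fintype.ofFinite D
  -- Induction on the number of darts that `α` moves: one transposition of `α` (an edge) is removed.
  -- Fixed points of `α` count as orbits, so that the case without edges is an equality.
  induction hn : α.support.card using Nat.strong_induction_on generalizing α with
  | _ n ih =>
  by_cases h1 : α = 1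
  · subst h1
    rw [one_mul, card_orbits_inv, card_orbits_one]
    have : Nat.card (Quotient (jointOrbit φ 1)) = Nat.card (OrbitsOf φ) := by
      refine Nat.card_congr (Quotient.congr (Equiv.refl D) fun a b => ⟨fun h => ?_, fun h => ?_⟩)
      · exact jointOrbit_le (SameCycle.setoid φ) (fun a => sameCycle_apply_right.2 (.refl _ a))
          (fun a => SameCycle.refl _ a) h
      · exact SameCycle.rel_of_step (jointOrbit φ 1) (jointOrbit_left φ 1) h
    omega
  · obtain ⟨x, hx⟩ : ∃ x, α x ≠ x := by
      by_contra! h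
      exact h1 (Equiv.ext h)
    set y := α x with hy
    have hyx : α y = x := hα x
    set β := Equiv.swap x y * α with hβ
    have hαβ : α = Equiv.swap x y * β := by rw [hβ, ← mul_assoc, Equiv.swap_mul_self, one_mul]
    have hβx : β x = x := by simp [hβ, ← hy]
    have hβy : β y = y := by simp [hβ, hyx]
    have hβo : ∀ a, a ≠ x → a ≠ y → β a = α a := by
      intro a hax hay
      rw [hβ, mul_apply, Equiv.swap_apply_of_ne_of_ne]
      · intro h; exact hay (α.injective (h.trans hyx.symm))
      · intro h; exact hax (α.injective (h.trans hy))
    have hββ : ∀ a, β (β a) = a := by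
      intro a
      by_cases hax : a = x
      · rw [hax, hβx, hβx]
      by_cases hay : a = y
      · rw [hay, hβy, hβy]
      · rw [hβo a hax hay, hβo, hα]
        · intro h; exact hay (by rw [hy, ← h, hα])
        · intro h; exact hax (by rw [← hyx, ← h, hα])
    have hsupp : β.support.card < n := by
      rw [← hn]
      refine Finset.card_lt_card ⟨fun a ha => ?_, fun h => ?_⟩
      · rw [mem_support] at ha ⊢
        intro h
        by_cases hax : a = x
        · exact ha (hax ▸ hβx)
        by_cases hay : a = y
        · exact ha (hay ▸ hβy)
        · exact ha (by rw [hβo a hax hay, h])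
      · have := h (mem_support.2 hx)
        exact mem_support.1 this hβx
    have IH := ih _ hsupp β hββ rfl
    have hnxy : ¬ β.SameCycle x y := by
      intro h
      obtain ⟨i, hi⟩ := h
      rw [Function.IsFixedPt.perm_zpow (e := β) hβx] at hi
      exact hx hi.symm
    have hcα : Nat.card (OrbitsOf α) + 1 = Nat.card (OrbitsOf β) := by
      rw [hαβ]; exact card_orbits_swap_mul_of_not_sameCycle hnxy
    have hprod : α * φ⁻¹ = Equiv.swap x y * (β * φ⁻¹) := by rw [← mul_assoc, ← hαβ]
    have hjoin : ∀ a b, jointOrbit φ α a b ↔ joinPair (jointOrbit φ β) x y a b := by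
      intro a b
      constructor
      · refine fun h => jointOrbit_le (joinPair (jointOrbit φ β) x y)
          (fun a => Or.inl (jointOrbit_left φ β a)) (fun a => ?_) h
        by_cases hax : a = x
        · rw [hax, ← hy]
          exact Or.inr (Or.inl ⟨Setoid.refl' _ _, Setoid.refl' _ _⟩)
        by_cases hay : a = y
        · rw [hay, hyx]
          exact Or.inr (Or.inr ⟨Setoid.refl' _ _, Setoid.refl' _ _⟩)
        · rw [← hβo a hax hay]
          exact Or.inl (jointOrbit_right φ β a)
      · have hle : ∀ {a b}, jointOrbit φ β a b → jointOrbit φ α a b := by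
          refine fun h => jointOrbit_le _ (jointOrbit_left φ α) (fun a => ?_) h
          by_cases hax : a = x
          · rw [hax, hβx]
          by_cases hay : a = y
          · rw [hay, hβy]
          · rw [hβo a hax hay]; exact jointOrbit_right φ α a
        have hxy : jointOrbit φ α x y := jointOrbit_right φ α x
        rintro (h | ⟨h, h'⟩ | ⟨h, h'⟩)
        · exact hle h
        · exact Setoid.trans' _ (hle h) (Setoid.trans' _ hxy (hle h'))
        · exact Setoid.trans' _ (hle h) (Setoid.trans' _ (Setoid.symm' _ hxy) (hle h'))
    -- Within one component the new edge adds at most one orbit of `α * φ⁻¹`, which offsets the lost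
    -- orbit of `α`. Between two components it also merges two orbits of `α * φ⁻¹`, and both sides
    -- drop by two.
    by_cases hc : jointOrbit φ β x y
    · have h2 : Nat.card (Quotient (jointOrbit φ α)) = Nat.card (Quotient (jointOrbit φ β)) := by
        refine Nat.card_congr (Quotient.congr (Equiv.refl D) fun a b => (hjoin a b).trans ?_)
        constructor
        · rintro (h | ⟨h, h'⟩ | ⟨h, h'⟩)
          · exact h
          · exact Setoid.trans' _ h (Setoid.trans' _ hc h')
          · exact Setoid.trans' _ h (Setoid.trans' _ (Setoid.symm' _ hc) h')
        · exact Or.inl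
      have h3 := card_orbits_swap_mul_le (π := β * φ⁻¹) hx.symm
      rw [← hprod] at h3
      omega
    · have h2 := card_quotient_join _ _ x y hc hjoin
      have h3 : ¬ (β * φ⁻¹).SameCycle x y := by
        refine fun h => hc (h.rel_of_step (jointOrbit φ β) fun a => ?_)
        refine Setoid.trans' _ (Setoid.symm' _ ?_) (jointOrbit_right φ β (φ⁻¹ a))
        have := jointOrbit_left φ β (φ⁻¹ a)
        rwa [show φ (φ⁻¹ a) = a from φ.apply_symm_apply a] at this
      have h4 := card_orbits_swap_mul_of_not_sameCycle h3
      rw [← hprod] at h4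
      omega

theorem mul_card_orbits [Finite D] (π : Equiv.Perm D) (k : ℕ)
    (h : ∀ d, Function.minimalPeriod π d = k) : k * Nat.card (OrbitsOf π) = Nat.card D := by
  classical
  have : Fintype D := Fintype.ofFinite D
  have : Fintype (OrbitsOf π) := Fintype.ofFinite _
  rw [Nat.card_eq_fintype_card, Nat.card_eq_fintype_card, ← Finset.card_univ (α := D),
    Finset.card_eq_sum_card_fiberwise (f := fun d => (Quotient.mk _ d : OrbitsOf π))
      (t := Finset.univ) (fun _ _ => Finset.mem_univ _)]
  rw [Finset.sum_congr rfl (g := fun _ => k), Finset.sum_const, smul_eq_mul, mul_comm,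
    Finset.card_univ]
  intro c _
  induction c using Quotient.inductionOn with | h a => ?_
  rw [← Finset.card_range k]
  symm
  refine Finset.card_bij (fun j _ => π^[j] a) (fun j _ => ?_) (fun i hi j hj hij => ?_) ?_
  · simp only [Finset.mem_filter, Finset.mem_univ, true_and]
    refine Quotient.sound (s := SameCycle.setoid π) ?_
    change π.SameCycle _ _
    rw [Equiv.Perm.iterate_eq_pow]
    exact sameCycle_pow_left.2 (SameCycle.refl _ _)
  · rw [Finset.mem_range, ← h a] at hi hj
    exact Function.iterate_injOn_Iio_minimalPeriod hi hj hij
  · intro b hb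
    simp only [Finset.mem_filter, Finset.mem_univ, true_and] at hb
    have hb : π.SameCycle b a := Quotient.exact hb
    obtain ⟨i, -, hi⟩ := hb.symm.exists_pow_eq'
    have hk : 0 < k := by
      rw [← h a]
      refine Function.minimalPeriod_pos_of_mem_periodicPts ⟨orderOf π, orderOf_pos π, ?_⟩
      rw [Function.IsPeriodicPt, Equiv.Perm.iterate_eq_pow, pow_orderOf_eq_one]
      rfl
    refine ⟨i % k, Finset.mem_range.2 (Nat.mod_lt _ hk), ?_⟩
    rw [← hi, ← h a, Function.iterate_mod_minimalPeriod_eq, Equiv.Perm.iterate_eq_pow]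

end Equiv.Perm

/-! ### Permutations of disjoint unions and conjugate permutations -/

theorem Function.minimalPeriod_eq_of_semiconj {D D' : Type*} {g : D → D'}
    (hg : Function.Injective g) {f : D → D} {f' : D' → D'} (h : ∀ d, g (f d) = f' (g d)) (d : D) :
    Function.minimalPeriod f' (g d) = Function.minimalPeriod f d := by
  have hs : Function.Semiconj g f f' := h
  rw [Function.minimalPeriod_eq_minimalPeriod_iff]
  intro n
  simp only [Function.IsPeriodicPt, Function.IsFixedPt]
  rw [← (hs.iterate_right n) d, hg.eq_iff]

namespace Equiv.Perm

theorem sameCycle_sumCongr_inl {D D' : Type} {π : Equiv.Perm D} {π' : Equiv.Perm D'} {a b : D} :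
    (Equiv.Perm.sumCongr π π').SameCycle (Sum.inl a) (Sum.inl b) ↔ π.SameCycle a b := by
  have : ∀ i : ℤ, ((Equiv.Perm.sumCongr π π') ^ i) = Equiv.Perm.sumCongr (π ^ i) (π' ^ i) :=
    fun i => (map_zpow (Equiv.Perm.sumCongrHom D D') (π, π') i).symm
  simp [SameCycle, this]

theorem sameCycle_sumCongr_inr {D D' : Type} {π : Equiv.Perm D} {π' : Equiv.Perm D'} {a b : D'} :
    (Equiv.Perm.sumCongr π π').SameCycle (Sum.inr a) (Sum.inr b) ↔ π'.SameCycle a b := by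
  have : ∀ i : ℤ, ((Equiv.Perm.sumCongr π π') ^ i) = Equiv.Perm.sumCongr (π ^ i) (π' ^ i) :=
    fun i => (map_zpow (Equiv.Perm.sumCongrHom D D') (π, π') i).symm
  simp [SameCycle, this]

theorem not_sameCycle_sumCongr {D D' : Type} {π : Equiv.Perm D} {π' : Equiv.Perm D'} (a : D)
    (b : D') : ¬ (Equiv.Perm.sumCongr π π').SameCycle (Sum.inl a) (Sum.inr b) := by
  intro h
  have := h.map_eq Sum.isLeft (by rintro (a | a) <;> rfl)
  simp at this

theorem card_orbits_sumCongr {D D' : Type} [Finite D] [Finite D'] (π : Equiv.Perm D)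
    (π' : Equiv.Perm D') : Nat.card (OrbitsOf (Equiv.Perm.sumCongr π π')) =
      Nat.card (OrbitsOf π) + Nat.card (OrbitsOf π') := by
  rw [← Nat.card_sum]
  refine (Nat.card_congr (Equiv.ofBijective
    (Sum.elim (Quotient.map' (s₁ := SameCycle.setoid π)
        (s₂ := SameCycle.setoid (Equiv.Perm.sumCongr π π')) Sum.inl
        fun _ _ h => sameCycle_sumCongr_inl.2 h)
      (Quotient.map' (s₁ := SameCycle.setoid π')
        (s₂ := SameCycle.setoid (Equiv.Perm.sumCongr π π')) Sum.inr
        fun _ _ h => sameCycle_sumCongr_inr.2 h)) ⟨?_, ?_⟩)).symm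
  · rintro (a | a) (b | b) h <;> induction a using Quotient.inductionOn <;>
      induction b using Quotient.inductionOn
    · exact congrArg Sum.inl (Quotient.sound (sameCycle_sumCongr_inl.1 (Quotient.exact h)))
    · exact absurd (Quotient.exact h) (not_sameCycle_sumCongr _ _)
    · exact absurd (SameCycle.symm (Quotient.exact h)) (not_sameCycle_sumCongr _ _)
    · exact congrArg Sum.inr (Quotient.sound (sameCycle_sumCongr_inr.1 (Quotient.exact h)))
  · intro c
    induction c using Quotient.inductionOn with | h a => ?_
    rcases a with a | a
    · exact ⟨Sum.inl (Quotient.mk _ a), rfl⟩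
    · exact ⟨Sum.inr (Quotient.mk _ a), rfl⟩

theorem sameCycle_of_semiconj {D D' : Type} {π : Equiv.Perm D} {π' : Equiv.Perm D'} (g : D → D')
    (h : ∀ d, g (π d) = π' (g d)) {a b : D} (hab : π.SameCycle a b) :
    π'.SameCycle (g a) (g b) :=
  SameCycle.rel_of_step ((SameCycle.setoid π').comap g)
    (fun d => by
      change π'.SameCycle (g d) (g (π d))
      rw [h]
      exact sameCycle_apply_right.2 (SameCycle.refl _ _)) hab

theorem card_orbits_of_semiconj {D D' : Type} {π : Equiv.Perm D} {π' : Equiv.Perm D'} (e : D ≃ D')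
    (h : ∀ d, e (π d) = π' (e d)) : Nat.card (OrbitsOf π) = Nat.card (OrbitsOf π') := by
  refine Nat.card_congr (Quotient.congr e fun a b => ⟨sameCycle_of_semiconj e h, fun hab => ?_⟩)
  have := sameCycle_of_semiconj (π' := π) e.symm (fun d => by
    rw [Equiv.symm_apply_eq, h, Equiv.apply_symm_apply]) hab
  rwa [e.symm_apply_apply, e.symm_apply_apply] at this

end Equiv.Perm

/-! ### Elementary facts on rooted maps, and maps built from permutations -/

namespace RootedMap

section Basic

variable {M : RootedMap}

theorem next_faceNext (M : RootedMap) (d : M.Dart) : M.next (M.faceNext d) = M.rev d :=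
  M.next.apply_symm_apply _

theorem next_eq (M : RootedMap) (d : M.Dart) : M.next d = M.rev (M.faceNext.symm d) := by
  rw [← next_faceNext, Equiv.apply_symm_apply]

theorem rev_mul_faceNext_inv (M : RootedMap) : M.rev * M.faceNext⁻¹ = M.next :=
  Equiv.ext fun d => (M.next_eq d).symm

theorem tail_eq_iff {a b : M.Dart} : M.tail a = M.tail b ↔ M.next.SameCycle a b :=
  ⟨fun h => Quotient.exact h, fun h => Quotient.sound h⟩

theorem tail_surjective (M : RootedMap) : Function.Surjective M.tail := Quotient.mk_surjective

theorem tail_next (d : M.Dart) : M.tail (M.next d) = M.tail d :=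
  tail_eq_iff.2 (Equiv.Perm.sameCycle_apply_left.2 (.refl _ _))

theorem tail_rev (d : M.Dart) : M.tail (M.rev d) = M.head d := rfl

theorem head_rev (d : M.Dart) : M.head (M.rev d) = M.tail d := by rw [head, rev_rev]

theorem tail_faceNext (d : M.Dart) : M.tail (M.faceNext d) = M.head d := by
  rw [← tail_next, next_faceNext]; rfl

theorem tail_induction {Pd : M.Dart → Prop} (h : ∀ d, Pd d → Pd (M.next d)) {a b : M.Dart}
    (hab : M.tail a = M.tail b) (ha : Pd a) : Pd b := by
  obtain ⟨i, -, hi⟩ := (tail_eq_iff.1 hab).exists_pow_eq'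
  subst hi
  induction i with
  | zero => exact ha
  | succ i ih =>
    rw [pow_succ']
    refine h _ (ih ?_)
    exact tail_eq_iff.2 (Equiv.Perm.sameCycle_pow_right.2 (.refl _ _))

theorem dart_induction {Pd : M.Dart → Prop} (hroot : Pd M.root) (h₁ : ∀ d, Pd d → Pd (M.next d))
    (h₂ : ∀ d, Pd d → Pd (M.rev d)) (d : M.Dart) : Pd d := by
  induction M.connected d with
  | refl => exact hroot
  | tail _ h ih => rcases h with rfl | rfl <;> [exact h₁ _ ih; exact h₂ _ ih]

theorem jointOrbit_root (M : RootedMap) (d : M.Dart) :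
    Equiv.Perm.jointOrbit M.faceNext M.rev M.root d := by
  refine dart_induction (Pd := fun d => Equiv.Perm.jointOrbit M.faceNext M.rev M.root d)
    (Setoid.refl' _ _) (fun d h => ?_) (fun d h => ?_) d
  · refine Setoid.trans' _ h (Setoid.trans' _ (y := M.faceNext.symm d) (Setoid.symm' _ ?_) ?_)
    · have := Equiv.Perm.jointOrbit_left M.faceNext M.rev (M.faceNext.symm d)
      rwa [Equiv.apply_symm_apply] at this
    · rw [next_eq]; exact Equiv.Perm.jointOrbit_right _ _ _
  · exact Setoid.trans' _ h (Equiv.Perm.jointOrbit_right _ _ _)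

/-- A relation between darts that contains the steps along faces and across edges is universal. -/
theorem rel_of_faceNext_of_rev (r : Setoid M.Dart) (h₁ : ∀ d, r d (M.faceNext d))
    (h₂ : ∀ d, r d (M.rev d)) (a b : M.Dart) : r a b :=
  Equiv.Perm.jointOrbit_le r h₁ h₂
    (Setoid.trans' _ (Setoid.symm' _ (M.jointOrbit_root a)) (M.jointOrbit_root b))

theorem numDarts_eq_two_mul (M : RootedMap) : 2 * Nat.card (OrbitsOf M.rev) = M.numDarts := by
  rw [Equiv.Perm.mul_card_orbits M.rev 2, Nat.card_eq_fintype_card, Fintype.card_fin]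
  intro d
  refine Function.minimalPeriod_eq_prime ?_ (M.rev_ne d)
  exact M.rev_rev d

theorem numVertices_le_numDarts (M : RootedMap) : M.numVertices ≤ M.numDarts := by
  have := Nat.card_le_card_of_surjective _ M.tail_surjective
  simpa [numVertices] using this

/-- A quadrangulation all of whose faces have degree `4` has at least three vertices. -/
theorem three_le_numVertices (h : ∀ d, Function.minimalPeriod M.faceNext d = 4) :
    3 ≤ M.numVertices := by
  have h₁ := M.numDarts_eq_two_mul
  have h₂ := Equiv.Perm.mul_card_orbits M.faceNext 4 h
  have h₄ : Nat.card M.Dart = M.numDarts := Nat.card_fin _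
  have h₃ := M.euler
  change Nat.card M.Vertex + Nat.card (OrbitsOf M.faceNext) = _ at h₃
  have : 0 < M.numDarts := M.root.pos
  -- From `4 F = D = 2 E` and Euler's formula, `V = D / 4 + 2` with `D > 0`.
  rw [numVertices]
  omega

/-- The colouring of darts by their tails refers only to face steps and reversal, the two
permutations that are tracked under gluing and cutting. -/
theorem exists_coloring_iff (M : RootedMap) :
    (∃ c : M.Vertex → Bool, ∀ d, c (M.tail d) ≠ c (M.head d)) ↔
      ∃ c : M.Dart → Bool, (∀ d, c (M.faceNext d) = !c d) ∧ ∀ d, c (M.rev d) = !c d := by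
  constructor
  · rintro ⟨c, hc⟩
    refine ⟨fun d => c (M.tail d), fun d => ?_, fun d => ?_⟩
    · change c (M.tail (M.faceNext d)) = _
      rw [tail_faceNext]; exact Bool.eq_not.2 (hc d).symm
    · exact Bool.eq_not.2 (hc d).symm
  · rintro ⟨c, h₁, h₂⟩
    refine ⟨Quotient.lift c fun a b h => h.map_eq c fun d => ?_, fun d => ?_⟩
    · rw [next_eq, h₂, ← h₁, Equiv.apply_symm_apply]
    · change c d ≠ c (M.rev d)
      rw [h₂]
      cases c d <;> decide

theorem IsQuadrangulation.tail_ne_head (h : M.IsQuadrangulation) (d : M.Dart) :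
    M.tail d ≠ M.head d := by
  obtain ⟨⟨c, hc⟩, -⟩ := h
  exact fun h => hc d (congrArg c h)

/-- A rooted map from its face permutation and its edges, on an arbitrary finite set of darts. -/
theorem exists_ofPerm {D : Type} [Finite D] (φ α : Equiv.Perm D) (root : D)
    (hα : ∀ d, α (α d) = d) (hne : ∀ d, α d ≠ d)
    (hconn : ∀ d, Equiv.Perm.jointOrbit φ α root d)
    (heuler : Nat.card (OrbitsOf (α * φ⁻¹)) + Nat.card (OrbitsOf φ) = Nat.card (OrbitsOf α) + 2) :
    ∃ (M : RootedMap) (e : D ≃ M.Dart), (∀ d, M.faceNext (e d) = e (φ d)) ∧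
      (∀ d, M.rev (e d) = e (α d)) ∧ M.root = e root := by
  let e := Finite.equivFin D
  have hr : ∀ d, e.permCongr α (e d) = e (α d) := fun d => by simp [Equiv.permCongr_apply]
  have hn : ∀ d, e.permCongr (α * φ⁻¹) (e (φ d)) = e (α d) := fun d => by
    simp [Equiv.permCongr_apply]
  have hfn : ∀ d, ((e.permCongr (α * φ⁻¹))⁻¹ * e.permCongr α) (e d) = e (φ d) := fun d => by
    rw [Equiv.Perm.mul_apply, Equiv.Perm.inv_eq_iff_eq, hr, hn]
  let R : Fin (Nat.card D) → Fin (Nat.card D) → Prop := fun a b =>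
    b = e.permCongr (α * φ⁻¹) a ∨ b = e.permCongr α a
  -- `R` is directed, but a permutation of finite order returns from `π a` to `a` by forward steps,
  -- so reachability is symmetric.
  have hpow : ∀ (π : Equiv.Perm (Fin (Nat.card D))), (∀ a, R a (π a)) → ∀ a,
      Relation.ReflTransGen R (π a) a := by
    intro π hπ a
    have h1 : ∀ (k : ℕ) (a), Relation.ReflTransGen R a ((π ^ k) a) := by
      intro k
      induction k with
      | zero => exact fun a => .refl
      | succ k ih =>
        intro a
        rw [pow_succ']
        exact (ih a).tail (hπ _)
    have h2 := h1 (orderOf π - 1) (π a)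
    rwa [← Equiv.Perm.mul_apply, ← pow_succ, Nat.sub_add_cancel (orderOf_pos π), pow_orderOf_eq_one,
      Equiv.Perm.one_apply] at h2
  have hs : ∀ a b, Relation.ReflTransGen R a b → Relation.ReflTransGen R b a := by
    intro a b h
    induction h with
    | refl => exact .refl
    | tail _ h ih =>
      refine Relation.ReflTransGen.trans ?_ ih
      rcases h with rfl | rfl
      · exact hpow _ (fun a => Or.inl rfl) _
      · exact hpow _ (fun a => Or.inr rfl) _
  let r : Setoid D := ⟨fun a b => Relation.ReflTransGen R (e a) (e b), fun _ => .refl,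
    fun h => hs _ _ h, fun h h' => h.trans h'⟩
  have hrc : ∀ d, r root d := by
    intro d
    refine Equiv.Perm.jointOrbit_le r (fun a => ?_) (fun a => ?_) (hconn d)
    · change Relation.ReflTransGen R _ _
      refine .trans (b := e (α a)) (.single (Or.inr (hr a).symm)) (hs _ _ (.single (Or.inl ?_)))
      exact (hn a).symm
    · exact .single (Or.inr (hr a).symm)
  refine ⟨⟨Nat.card D, e.permCongr (α * φ⁻¹), e.permCongr α, e root, fun d => ?_, fun d => ?_,
    fun d => ?_, ?_⟩, e, hfn, hr, rfl⟩
  · obtain ⟨d, rfl⟩ := e.surjective d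
    rw [hr, hr, hα]
  · obtain ⟨d, rfl⟩ := e.surjective d
    rw [hr]
    exact fun h => hne d (e.injective h)
  · obtain ⟨d, rfl⟩ := e.surjective d
    exact hrc d
  · rw [← Equiv.Perm.card_orbits_of_semiconj (π := φ) e (fun d => (hfn d).symm),
      ← Equiv.Perm.card_orbits_of_semiconj (π := α) e (fun d => (hr d).symm),
      ← Equiv.Perm.card_orbits_of_semiconj (π := α * φ⁻¹) e fun d => by
        simp [Equiv.permCongr_apply], heuler]

/-- An isomorphism from a bijection that respects faces, edges and roots. -/
def Iso.ofFaceNext {M M' : RootedMap} (e : M.Dart ≃ M'.Dart)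
    (h₁ : ∀ d, e (M.faceNext d) = M'.faceNext (e d)) (h₂ : ∀ d, e (M.rev d) = M'.rev (e d))
    (h₃ : e M.root = M'.root) : Iso M M' where
  toEquiv := e
  map_next d := by
    obtain ⟨d, rfl⟩ := M.faceNext.surjective d
    rw [next_faceNext, h₁, next_faceNext, h₂]
  map_rev := h₂
  map_root := h₃

end Basic

/-! ### Gluing two maps along an edge -/

/-- `S` arises from `M` and `P` by slitting both spheres along an edge and gluing them along the
slits: the edge of the dart `p` of `M`, which leads to a leaf of `M`, and the root edge of `P`. -/
structure EdgeSum (S M P : RootedMap) (p : M.Dart) where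
  equiv : M.Dart ⊕ P.Dart ≃ S.Dart
  faceNext_inl' : ∀ d, S.faceNext (equiv (.inl d)) = equiv (.inl (M.faceNext d))
  faceNext_inr' : ∀ d, S.faceNext (equiv (.inr d)) = equiv (.inr (P.faceNext d))
  rev_inl' : ∀ d, d ≠ p → d ≠ M.rev p → S.rev (equiv (.inl d)) = equiv (.inl (M.rev d))
  rev_inr' : ∀ d, d ≠ P.root → d ≠ P.rev P.root →
    S.rev (equiv (.inr d)) = equiv (.inr (P.rev d))
  rev_left' : S.rev (equiv (.inl p)) = equiv (.inr (P.rev P.root))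
  rev_right' : S.rev (equiv (.inl (M.rev p))) = equiv (.inr P.root)
  root_eq' : S.root = equiv (.inl M.root)
  leaf : M.next (M.rev p) = M.rev p
  root_ne : M.root ≠ p
  root_ne_rev : M.root ≠ M.rev p
  tail_ne_head_left : ∀ d, M.tail d ≠ M.head d
  tail_ne_head_right : ∀ d, P.tail d ≠ P.head d

/-- The faces and the numbers of edges add up. The new rotation around vertices is the direct sum
followed by two transpositions, each of which merges a vertex of `M` with one of `P`. So two
vertices are lost and the Euler characteristic is `2 + 2 - 2`. The second transposition still merges
distinct orbits because `p` is not a loop. -/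
theorem exists_edgeSum (M P : RootedMap) (p : M.Dart) (hM : ∀ d, M.tail d ≠ M.head d)
    (hP : ∀ d, P.tail d ≠ P.head d) (hleaf : M.next (M.rev p) = M.rev p) (h₁ : M.root ≠ p)
    (h₂ : M.root ≠ M.rev p) : ∃ S, Nonempty (EdgeSum S M P p) := by
  classical
  set q := M.rev p with hq
  set ρ := P.root
  set ρ' := P.rev P.root with hρ'
  have hqp : M.rev q = p := M.rev_rev p
  have hρρ : P.rev ρ' = ρ := P.rev_rev ρ
  have hpq : q ≠ p := M.rev_ne p
  have hρn : ρ' ≠ ρ := P.rev_ne ρ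
  let θ : Equiv.Perm (M.Dart ⊕ P.Dart) :=
    Equiv.swap (.inl p) (.inr ρ) * Equiv.swap (.inl q) (.inr ρ')
  let α : Equiv.Perm (M.Dart ⊕ P.Dart) := θ * Equiv.Perm.sumCongr M.rev P.rev
  let φ : Equiv.Perm (M.Dart ⊕ P.Dart) := Equiv.Perm.sumCongr M.faceNext P.faceNext
  have a1 : α (.inl p) = .inr ρ' := by
    simp [α, θ, ← hq, hρn, Equiv.swap_apply_def]
  have a2 : α (.inl q) = .inr ρ := by simp [α, θ, hqp, hpq.symm, Equiv.swap_apply_def]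
  have a3 : α (.inr ρ) = .inl q := by
    simp [α, θ, show P.rev ρ = ρ' from rfl, hpq, Equiv.swap_apply_def]
  have a4 : α (.inr ρ') = .inl p := by simp [α, θ, hρρ, hρn.symm, Equiv.swap_apply_def]
  have a5 : ∀ d, d ≠ p → d ≠ q → α (.inl d) = .inl (M.rev d) := by
    intro d hdp hdq
    have e1 : M.rev d ≠ p := fun h => hdq (M.rev.injective (h.trans hqp.symm))
    have e2 : M.rev d ≠ q := fun h => hdp (M.rev.injective h)
    simp [α, θ, e1, e2, Equiv.swap_apply_def]
  have a6 : ∀ d, d ≠ ρ → d ≠ ρ' → α (.inr d) = .inr (P.rev d) := by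
    intro d hdp hdq
    have e1 : P.rev d ≠ ρ := fun h => hdq (P.rev.injective (h.trans hρρ.symm))
    have e2 : P.rev d ≠ ρ' := fun h => hdp (P.rev.injective h)
    simp [α, θ, e1, e2, Equiv.swap_apply_def]
  have hα : ∀ d, α (α d) = d := by
    rintro (d | d)
    · by_cases hdp : d = p
      · rw [hdp, a1, a4]
      by_cases hdq : d = q
      · rw [hdq, a2, a3]
      rw [a5 d hdp hdq, a5, M.rev_rev]
      · exact fun h => hdq (M.rev.injective (h.trans hqp.symm))
      · exact fun h => hdp (M.rev.injective h)
    · by_cases hdp : d = ρ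
      · rw [hdp, a3, a2]
      by_cases hdq : d = ρ'
      · rw [hdq, a4, a1]
      rw [a6 d hdp hdq, a6, P.rev_rev]
      · exact fun h => hdq (P.rev.injective (h.trans hρρ.symm))
      · exact fun h => hdp (P.rev.injective h)
  have hne : ∀ d, α d ≠ d := by
    rintro (d | d)
    · by_cases hdp : d = p
      · rw [hdp, a1]; simp
      by_cases hdq : d = q
      · rw [hdq, a2]; simp
      rw [a5 d hdp hdq]; simpa using M.rev_ne d
    · by_cases hdp : d = ρ
      · rw [hdp, a3]; simp
      by_cases hdq : d = ρ'
      · rw [hdq, a4]; simp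
      rw [a6 d hdp hdq]; simpa using P.rev_ne d
  have hφpq : M.faceNext p = q := by
    rw [← M.next.injective.eq_iff, next_faceNext, hleaf]
  let J := Equiv.Perm.jointOrbit φ α
  have J1 : ∀ d, J d (φ d) := Equiv.Perm.jointOrbit_left φ α
  have J2 : ∀ d, J d (α d) := Equiv.Perm.jointOrbit_right φ α
  have Jpq : J (.inl p) (.inl q) := by
    have := J1 (.inl p)
    simpa [φ, hφpq] using this
  have Jρ : J (.inr ρ) (.inr ρ') := by
    have e1 := J2 (.inr ρ)
    have e2 := J2 (.inl p)
    rw [a3] at e1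
    rw [a1] at e2
    exact Setoid.trans' _ e1 (Setoid.trans' _ (Setoid.symm' _ Jpq) e2)
  have hinl : ∀ a b : M.Dart, J (.inl a) (.inl b) := by
    refine rel_of_faceNext_of_rev (J.comap Sum.inl) (fun d => J1 (.inl d)) fun d => ?_
    change J (.inl d) (.inl (M.rev d))
    by_cases hdp : d = p
    · rw [hdp]; exact Jpq
    by_cases hdq : d = q
    · rw [hdq, hqp]; exact Setoid.symm' _ Jpq
    rw [← a5 d hdp hdq]; exact J2 _
  have hinr : ∀ a b : P.Dart, J (.inr a) (.inr b) := by
    refine rel_of_faceNext_of_rev (J.comap Sum.inr) (fun d => J1 (.inr d)) fun d => ?_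
    change J (.inr d) (.inr (P.rev d))
    by_cases hdp : d = ρ
    · rw [hdp]; exact Jρ
    by_cases hdq : d = ρ'
    · rw [hdq, hρρ]; exact Setoid.symm' _ Jρ
    rw [← a6 d hdp hdq]; exact J2 _
  have hconn : ∀ d, J (.inl M.root) d := by
    rintro (d | d)
    · exact hinl _ _
    · have e2 := J2 (.inl p)
      rw [a1] at e2
      exact Setoid.trans' _ (hinl _ _) (Setoid.trans' _ e2 (hinr _ _))
  have hσ : α * φ⁻¹ = θ * Equiv.Perm.sumCongr M.next P.next := by
    rw [← rev_mul_faceNext_inv, ← rev_mul_faceNext_inv, ← Equiv.Perm.sumCongr_mul,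
      ← Equiv.Perm.sumCongr_inv, mul_assoc]
  have c1 : Nat.card (OrbitsOf (α * φ⁻¹)) + 2 = Nat.card M.Vertex + Nat.card P.Vertex := by
    have n1 := Equiv.Perm.not_sameCycle_sumCongr (π := M.next) (π' := P.next) q ρ'
    have n2 : ¬ (Equiv.swap (Sum.inl q) (Sum.inr ρ') *
        Equiv.Perm.sumCongr M.next P.next).SameCycle (.inl p) (.inr ρ) := by
      rw [Equiv.Perm.sameCycle_swap_mul_iff n1]
      rintro (h | ⟨h, -⟩ | ⟨h, -⟩)
      · exact Equiv.Perm.not_sameCycle_sumCongr _ _ h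
      · exact hM p (tail_eq_iff.2 (Equiv.Perm.sameCycle_sumCongr_inl.1 h))
      · exact Equiv.Perm.not_sameCycle_sumCongr _ _ h
    have e1 := Equiv.Perm.card_orbits_swap_mul_of_not_sameCycle n1
    have e2 := Equiv.Perm.card_orbits_swap_mul_of_not_sameCycle n2
    rw [Equiv.Perm.card_orbits_sumCongr] at e1
    rw [hσ, show θ * Equiv.Perm.sumCongr M.next P.next = Equiv.swap (.inl p) (.inr ρ) *
      (Equiv.swap (Sum.inl q) (Sum.inr ρ') * Equiv.Perm.sumCongr M.next P.next) from mul_assoc _ _ _]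
    change _ = Nat.card (OrbitsOf M.next) + Nat.card (OrbitsOf P.next)
    omega
  have c2 : Nat.card (OrbitsOf φ) = Nat.card (OrbitsOf M.faceNext) +
      Nat.card (OrbitsOf P.faceNext) := Equiv.Perm.card_orbits_sumCongr _ _
  have c3 : 2 * Nat.card (OrbitsOf α) = M.numDarts + P.numDarts := by
    rw [Equiv.Perm.mul_card_orbits α 2, Nat.card_sum, Nat.card_eq_fintype_card,
      Nat.card_eq_fintype_card, Fintype.card_fin, Fintype.card_fin]
    exact fun d => Function.minimalPeriod_eq_prime (hα d) (hne d)
  have c4 := M.euler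
  have c5 := P.euler
  have c6 := M.numDarts_eq_two_mul
  have c7 := P.numDarts_eq_two_mul
  change Nat.card M.Vertex + Nat.card (OrbitsOf M.faceNext) = _ at c4
  change Nat.card P.Vertex + Nat.card (OrbitsOf P.faceNext) = _ at c5
  obtain ⟨S, e, s1, s2, s3⟩ := exists_ofPerm φ α (.inl M.root) hα hne hconn (by omega)
  refine ⟨S, ⟨⟨e, fun d => s1 _, fun d => s1 _, fun d h h' => ?_, fun d h h' => ?_, ?_, ?_, s3,
    hleaf, h₁, h₂, hM, hP⟩⟩⟩
  · rw [s2, a5 d h h']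
  · rw [s2, a6 d h h']
  · rw [s2, a1]
  · rw [s2, a2]

end RootedMap

/-! ### Two-connected vertex sets -/

theorem TwoConnectedOn.preconnected_sdiff {V : Type} {G : SimpleGraph V} {S : Set V}
    (h : TwoConnectedOn G S) (w : V) : (G.induce (S \ {w})).Preconnected := by
  by_cases hw : w ∈ S
  · exact h.2 w hw
  · rw [Set.sdiff_singleton_eq_self hw]
    exact h.1.preconnected

/-- A `2`-connected set does not lie on both sides of a cut vertex. -/
theorem TwoConnectedOn.notMem_of_cut {V : Type} {G : SimpleGraph V} {S : Set V}
    (h : TwoConnectedOn G S) {C : Set V} {u r : V}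
    (hC : ∀ x ∈ C, ∀ y, G.Adj x y → y ∈ C ∨ y = u) (hu : u ∉ C) (hr : r ∈ S) (hrC : r ∉ C)
    (hru : r ≠ u) {z : V} (hz : z ∈ S) : z ∉ C := by
  intro hzC
  have hzu : z ≠ u := fun h => hu (h ▸ hzC)
  obtain ⟨w⟩ := h.preconnected_sdiff u ⟨z, hz, hzu⟩ ⟨r, hr, hru⟩
  have key : ∀ {a b : ↥(S \ {u})}, (G.induce (S \ {u})).Walk a b → a.1 ∈ C → b.1 ∈ C := by
    intro a b w
    induction w with
    | nil => exact id
    | cons hadj _ ih =>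
      intro ha
      rename_i a b c _
      exact ih ((hC _ ha _ hadj).resolve_right b.2.2)
  exact hrC (key w hzC)

theorem twoConnectedOn_image_iff {V V' : Type} {G : SimpleGraph V} {G' : SimpleGraph V'}
    {f : V → V'} (hf : Function.Injective f) {A : Set V}
    (h : ∀ a ∈ A, ∀ b ∈ A, G'.Adj (f a) (f b) ↔ G.Adj a b) :
    TwoConnectedOn G' (f '' A) ↔ TwoConnectedOn G A := by
  have hi : ∀ T : Set V, T ⊆ A → Nonempty (G.induce T ≃g G'.induce (f '' T)) := fun T hT =>
    ⟨{ toEquiv := Equiv.Set.image f T hf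
       map_rel_iff' := by
         intro a b
         exact h _ (hT a.2) _ (hT b.2) }⟩
  refine and_congr (hi A subset_rfl).some.connected_iff.symm ?_
  rw [Set.forall_mem_image]
  refine forall₂_congr fun w hw => ?_
  rw [← Set.image_singleton, ← Set.image_sdiff hf]
  exact (hi _ Set.sdiff_subset).some.preconnected_iff.symm

/-- Two common vertices are needed: whichever vertex is deleted, one of them is left to hold the two
parts together. -/
theorem TwoConnectedOn.union {V : Type} {G : SimpleGraph V} {S T : Set V}
    (hS : TwoConnectedOn G S) (hT : TwoConnectedOn G T) {a b : V} (hab : a ≠ b) (haS : a ∈ S)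
    (haT : a ∈ T) (hbS : b ∈ S) (hbT : b ∈ T) : TwoConnectedOn G (S ∪ T) := by
  refine ⟨SimpleGraph.induce_union_connected hS.1.preconnected hT.1.preconnected ⟨a, haS, haT⟩, ?_⟩
  intro w _
  rw [Set.union_sdiff_distrib]
  refine (SimpleGraph.induce_union_connected (hS.preconnected_sdiff w)
    (hT.preconnected_sdiff w) ?_).preconnected
  by_cases h : a = w
  · exact ⟨b, ⟨hbS, fun h' => hab (h.trans h'.symm)⟩, hbT, fun h' => hab (h.trans h'.symm)⟩
  · exact ⟨a, ⟨haS, h⟩, haT, h⟩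

namespace RootedMap

theorem graph_adj_iff {M : RootedMap} {x y : M.Vertex} :
    M.graph.Adj x y ↔ x ≠ y ∧ ∃ d, M.tail d = x ∧ M.head d = y := by
  rw [graph, SimpleGraph.fromRel_adj]
  refine and_congr_right fun _ => ⟨?_, Or.inl⟩
  rintro (h | ⟨d, h, h'⟩)
  · exact h
  · exact ⟨M.rev d, h', by rw [head_rev, h]⟩

theorem eq_of_tail_eq_of_leaf {M : RootedMap} {q d : M.Dart} (hq : M.next q = q)
    (h : M.tail q = M.tail d) : d = q :=
  tail_induction (Pd := fun d => d = q) (fun d hd => by rw [hd, hq]) h rfl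

/-- A leaf does not belong to a `2`-connected set with a further edge. -/
theorem tail_notMem_of_leaf {M : RootedMap} {q r : M.Dart} (hq : M.next q = q)
    (hl : ∀ d, M.tail d ≠ M.head d) (h₁ : r ≠ q) (h₂ : r ≠ M.rev q) {T : Set M.Vertex}
    (hT : TwoConnectedOn M.graph T) (ht : M.tail r ∈ T) (hh : M.head r ∈ T) : M.tail q ∉ T := by
  have h3 : M.tail r ≠ M.tail q := fun h => h₁ (eq_of_tail_eq_of_leaf hq h.symm)
  have h4 : M.head r ≠ M.tail q := fun h =>
    h₂ (by rw [← eq_of_tail_eq_of_leaf hq (h.symm : M.tail q = M.tail (M.rev r)), rev_rev])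
  have hC : ∀ x ∈ ({M.tail q} : Set M.Vertex), ∀ y, M.graph.Adj x y →
      y ∈ ({M.tail q} : Set M.Vertex) ∨ y = M.head q := by
    rintro x hx y hxy
    rw [Set.mem_singleton_iff] at hx
    subst hx
    obtain ⟨-, d, hd, rfl⟩ := graph_adj_iff.1 hxy
    rw [eq_of_tail_eq_of_leaf hq hd.symm]
    exact Or.inr rfl
  intro h
  by_cases hr : M.tail r = M.head q
  · refine hT.notMem_of_cut hC (hl q).symm hh h4 (fun h => hl r (hr.trans h.symm)) h rfl
  · exact hT.notMem_of_cut hC (hl q).symm ht h3 hr h rfl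

/-! ### Darts, vertices and the pre-root-block of a sum -/

namespace EdgeSum

variable {S M P : RootedMap} {p : M.Dart} (E : EdgeSum S M P p)

def inl (d : M.Dart) : S.Dart := E.equiv (.inl d)

def inr (d : P.Dart) : S.Dart := E.equiv (.inr d)

theorem inl_injective : Function.Injective E.inl :=
  fun _ _ h => Sum.inl_injective (E.equiv.injective h)

theorem inr_injective : Function.Injective E.inr :=
  fun _ _ h => Sum.inr_injective (E.equiv.injective h)

theorem inl_ne_inr (a : M.Dart) (b : P.Dart) : E.inl a ≠ E.inr b :=
  fun h => Sum.inl_ne_inr (E.equiv.injective h)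

theorem exists_inl_or_inr (d : S.Dart) : (∃ a, E.inl a = d) ∨ ∃ b, E.inr b = d := by
  obtain ⟨a | b, rfl⟩ := E.equiv.surjective d
  · exact Or.inl ⟨a, rfl⟩
  · exact Or.inr ⟨b, rfl⟩

theorem faceNext_inl (d : M.Dart) : S.faceNext (E.inl d) = E.inl (M.faceNext d) := E.faceNext_inl' d

theorem faceNext_inr (d : P.Dart) : S.faceNext (E.inr d) = E.inr (P.faceNext d) := E.faceNext_inr' d

theorem rev_inl {d : M.Dart} (h₁ : d ≠ p) (h₂ : d ≠ M.rev p) :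
    S.rev (E.inl d) = E.inl (M.rev d) := E.rev_inl' d h₁ h₂

theorem rev_inr {d : P.Dart} (h₁ : d ≠ P.root) (h₂ : d ≠ P.rev P.root) :
    S.rev (E.inr d) = E.inr (P.rev d) := E.rev_inr' d h₁ h₂

theorem rev_left : S.rev (E.inl p) = E.inr (P.rev P.root) := E.rev_left'

theorem rev_right : S.rev (E.inl (M.rev p)) = E.inr P.root := E.rev_right'

theorem rev_root : S.rev (E.inr P.root) = E.inl (M.rev p) := by rw [← E.rev_right, rev_rev]

theorem rev_rev_root : S.rev (E.inr (P.rev P.root)) = E.inl p := by rw [← E.rev_left, rev_rev]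

theorem root_eq : S.root = E.inl M.root := E.root_eq'

theorem faceNext_left (E : EdgeSum S M P p) : M.faceNext p = M.rev p := by
  rw [← M.next.injective.eq_iff, next_faceNext, E.leaf]

theorem next_inl {d : M.Dart} (h₁ : M.next d ≠ p) (h₂ : d ≠ M.rev p) :
    S.next (E.inl d) = E.inl (M.next d) := by
  obtain ⟨c, rfl⟩ := M.faceNext.surjective d
  rw [← faceNext_inl, next_faceNext, next_faceNext, rev_inl]
  · rintro rfl; exact h₂ E.faceNext_left
  · rintro rfl; exact h₁ (by rw [next_faceNext, rev_rev])

theorem next_inl_of_next_eq {d : M.Dart} (h : M.next d = p) : S.next (E.inl d) = E.inr P.root := by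
  obtain ⟨c, rfl⟩ := M.faceNext.surjective d
  rw [next_faceNext] at h
  rw [← faceNext_inl, next_faceNext, ← E.rev_right, show M.rev p = c by rw [← h, rev_rev]]

theorem next_inl_rev : S.next (E.inl (M.rev p)) = E.inr (P.rev P.root) := by
  rw [← E.faceNext_left, ← faceNext_inl, next_faceNext, rev_left]

theorem next_inr {d : P.Dart} (h₁ : P.next d ≠ P.root) (h₂ : P.next d ≠ P.rev P.root) :
    S.next (E.inr d) = E.inr (P.next d) := by
  obtain ⟨c, rfl⟩ := P.faceNext.surjective d
  rw [next_faceNext] at h₁ h₂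
  rw [← faceNext_inr, next_faceNext, next_faceNext, rev_inr]
  · rintro rfl; exact h₂ rfl
  · rintro rfl; exact h₁ (by rw [rev_rev])

theorem next_inr_of_next_eq_root {d : P.Dart} (h : P.next d = P.root) :
    S.next (E.inr d) = E.inl p := by
  obtain ⟨c, rfl⟩ := P.faceNext.surjective d
  rw [next_faceNext] at h
  rw [← faceNext_inr, next_faceNext, ← E.rev_rev_root, ← h, rev_rev]

theorem next_inr_of_next_eq_rev {d : P.Dart} (h : P.next d = P.rev P.root) :
    S.next (E.inr d) = E.inl (M.rev p) := by
  obtain ⟨c, rfl⟩ := P.faceNext.surjective d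
  rw [next_faceNext, P.rev.injective.eq_iff] at h
  rw [← faceNext_inr, next_faceNext, ← E.rev_root, ← h]

theorem tail_inl_rev : S.tail (E.inl (M.rev p)) = S.tail (E.inr (P.rev P.root)) := by
  rw [← E.next_inl_rev, tail_next]

/-- Rotation around the tail of `P.root` is copied in `S` until it is about to close at the root,
where it is diverted to `p`. It never meets `P.rev P.root`, since the root edge is not a loop. -/
theorem tail_inl_left : S.tail (E.inl p) = S.tail (E.inr P.root) := by
  obtain ⟨b, hb⟩ := P.next.surjective P.root
  have hbt : P.tail b = P.tail P.root := by rw [← hb, tail_next]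
  have key := tail_induction (M := P) (a := P.root) (b := b)
    (Pd := fun e => P.tail e = P.tail P.root ∧
      (S.tail (E.inr e) = S.tail (E.inr P.root) ∨ S.tail (E.inl p) = S.tail (E.inr P.root)))
    (fun e he => by
      refine ⟨by rw [tail_next, he.1], ?_⟩
      rcases he.2 with h | h
      · by_cases h1 : P.next e = P.root
        · rw [← E.next_inr_of_next_eq_root h1, tail_next]; exact Or.inr h
        · have h2 : P.next e ≠ P.rev P.root := by
            intro h2
            refine E.tail_ne_head_right P.root ?_
            rw [← tail_rev, ← h2, tail_next, he.1]
          rw [← E.next_inr h1 h2, tail_next]; exact Or.inl h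
      · exact Or.inr h) hbt.symm ⟨rfl, Or.inl rfl⟩
  rcases key.2 with h | h
  · rw [← E.next_inr_of_next_eq_root hb, tail_next]; exact h
  · exact h

theorem tail_inl_of_tail_eq {a b : M.Dart} (h : M.tail a = M.tail b) :
    S.tail (E.inl a) = S.tail (E.inl b) := by
  refine tail_induction (Pd := fun d => S.tail (E.inl a) = S.tail (E.inl d)) (fun d hd => ?_) h rfl
  rw [hd]
  by_cases h1 : M.next d = p
  · rw [h1, tail_inl_left, ← E.next_inl_of_next_eq h1, tail_next]
  by_cases h2 : d = M.rev p
  · rw [h2, E.leaf]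
  · rw [← E.next_inl h1 h2, tail_next]

theorem tail_inr_of_tail_eq {a b : P.Dart} (h : P.tail a = P.tail b) :
    S.tail (E.inr a) = S.tail (E.inr b) := by
  refine tail_induction (Pd := fun d => S.tail (E.inr a) = S.tail (E.inr d)) (fun d hd => ?_) h rfl
  rw [hd]
  by_cases h1 : P.next d = P.root
  · rw [h1, ← tail_inl_left, ← E.next_inr_of_next_eq_root h1, tail_next]
  by_cases h2 : P.next d = P.rev P.root
  · rw [h2, ← tail_inl_rev, ← E.next_inr_of_next_eq_rev h2, tail_next]
  · rw [← E.next_inr h1 h2, tail_next]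

/-- The inclusion of the vertices of the first summand. -/
def vertexInl : M.Vertex → S.Vertex :=
  Quotient.lift (fun d => S.tail (E.inl d)) fun _ _ h => E.tail_inl_of_tail_eq (tail_eq_iff.2 h)

/-- The inclusion of the vertices of the second summand. -/
def vertexInr : P.Vertex → S.Vertex :=
  Quotient.lift (fun d => S.tail (E.inr d)) fun _ _ h => E.tail_inr_of_tail_eq (tail_eq_iff.2 h)

theorem tail_inl (d : M.Dart) : S.tail (E.inl d) = E.vertexInl (M.tail d) := rfl

theorem tail_inr (d : P.Dart) : S.tail (E.inr d) = E.vertexInr (P.tail d) := rfl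

theorem vertexInl_left : E.vertexInl (M.tail p) = E.vertexInr (P.tail P.root) := E.tail_inl_left

theorem vertexInl_head : E.vertexInl (M.head p) = E.vertexInr (P.head P.root) := E.tail_inl_rev

theorem head_inl (d : M.Dart) : S.head (E.inl d) = E.vertexInl (M.head d) := by
  by_cases h1 : d = p
  · rw [h1, vertexInl_head, ← tail_rev, rev_left]; rfl
  by_cases h2 : d = M.rev p
  · rw [h2, head_rev, vertexInl_left, ← tail_rev, rev_right]; rfl
  · rw [← tail_rev, E.rev_inl h1 h2]; rfl

theorem head_inr (d : P.Dart) : S.head (E.inr d) = E.vertexInr (P.head d) := by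
  by_cases h1 : d = P.root
  · rw [h1, ← vertexInl_head, ← tail_rev, rev_root]; rfl
  by_cases h2 : d = P.rev P.root
  · rw [h2, head_rev, ← vertexInl_left, ← tail_rev, rev_rev_root]; rfl
  · rw [← tail_rev, E.rev_inr h1 h2]; rfl

/-- A retraction of `S` onto `M` that flattens `P` onto the slit edge. It yields injectivity of
`vertexInl` and shows that away from the leaf the two summands share only the image of `M.tail p`.
-/
theorem exists_collapse_left : ∃ g : S.Vertex → M.Vertex, (∀ v, g (E.vertexInl v) = v) ∧
    g (E.vertexInr (P.tail P.root)) = M.tail p ∧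
    ∀ v, v ≠ P.tail P.root → g (E.vertexInr v) = M.head p := by
  classical
  let g : M.Dart ⊕ P.Dart → M.Vertex := Sum.elim M.tail
    fun e => if P.tail e = P.tail P.root then M.tail p else M.head p
  let k : S.Dart → M.Vertex := fun d => g (E.equiv.symm d)
  have kl : ∀ d, k (E.inl d) = M.tail d := fun d => by simp [k, g, inl]
  have kr : ∀ d, k (E.inr d) = if P.tail d = P.tail P.root then M.tail p else M.head p :=
    fun d => by simp [k, g, inr]
  have hne := E.tail_ne_head_right P.root
  have hk : ∀ d, k (S.next d) = k d := by
    intro d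
    rcases E.exists_inl_or_inr d with ⟨a, rfl⟩ | ⟨a, rfl⟩
    · by_cases h1 : M.next a = p
      · rw [E.next_inl_of_next_eq h1, kl, kr, if_pos rfl, ← h1, tail_next]
      by_cases h2 : a = M.rev p
      · rw [h2, next_inl_rev, kl, kr, tail_rev, if_neg hne.symm]; rfl
      · rw [E.next_inl h1 h2, kl, kl, tail_next]
    · by_cases h1 : P.next a = P.root
      · rw [E.next_inr_of_next_eq_root h1, kl, kr, if_pos (by rw [← h1, tail_next])]
      by_cases h2 : P.next a = P.rev P.root
      · rw [E.next_inr_of_next_eq_rev h2, kl, kr, if_neg]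
        · rfl
        · rw [← tail_next, h2]; exact hne.symm
      · rw [E.next_inr h1 h2, kr, kr, tail_next]
  refine ⟨Quotient.lift k fun a b h => h.map_eq k hk, ?_, ?_, ?_⟩
  · intro v
    obtain ⟨d, rfl⟩ := M.tail_surjective v
    exact kl d
  · exact (kr _).trans (if_pos rfl)
  · intro v hv
    obtain ⟨d, rfl⟩ := P.tail_surjective v
    exact (kr d).trans (if_neg hv)

/-- The opposite retraction flattens `M` onto the root edge of `P`: the leaf goes to its head, all
other vertices of `M` to its tail. -/
theorem exists_collapse_right : ∃ g : S.Vertex → P.Vertex, (∀ v, g (E.vertexInr v) = v) := by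
  classical
  let g : M.Dart ⊕ P.Dart → P.Vertex := Sum.elim
    (fun e => if M.tail e = M.head p then P.head P.root else P.tail P.root) P.tail
  let k : S.Dart → P.Vertex := fun d => g (E.equiv.symm d)
  have kl : ∀ d, k (E.inl d) = if M.tail d = M.head p then P.head P.root else P.tail P.root :=
    fun d => by simp [k, g, inl]
  have kr : ∀ d, k (E.inr d) = P.tail d := fun d => by simp [k, g, inr]
  have hne := E.tail_ne_head_left p
  have hk : ∀ d, k (S.next d) = k d := by
    intro d
    rcases E.exists_inl_or_inr d with ⟨a, rfl⟩ | ⟨a, rfl⟩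
    · by_cases h1 : M.next a = p
      · rw [E.next_inl_of_next_eq h1, kl, kr, if_neg (by rw [← tail_next, h1]; exact hne)]
      by_cases h2 : a = M.rev p
      · rw [h2, next_inl_rev, kl, kr, tail_rev, tail_rev, if_pos rfl]
      · rw [E.next_inl h1 h2, kl, kl, tail_next]
    · by_cases h1 : P.next a = P.root
      · rw [E.next_inr_of_next_eq_root h1, kl, kr, if_neg hne, ← h1, tail_next]
      by_cases h2 : P.next a = P.rev P.root
      · rw [E.next_inr_of_next_eq_rev h2, kl, kr, tail_rev, if_pos rfl, ← tail_rev, ← h2, tail_next]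
      · rw [E.next_inr h1 h2, kr, kr, tail_next]
  refine ⟨Quotient.lift k fun a b h => h.map_eq k hk, fun v => ?_⟩
  obtain ⟨d, rfl⟩ := P.tail_surjective v
  exact kr d

theorem vertexInl_injective : Function.Injective E.vertexInl := by
  obtain ⟨g, hg, -⟩ := E.exists_collapse_left
  exact Function.LeftInverse.injective hg

theorem vertexInr_injective : Function.Injective E.vertexInr := by
  obtain ⟨g, hg⟩ := E.exists_collapse_right
  exact Function.LeftInverse.injective hg

theorem eq_of_vertexInl_eq_vertexInr {v : M.Vertex} {w : P.Vertex}
    (h : E.vertexInl v = E.vertexInr w) (hv : v ≠ M.head p) :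
    v = M.tail p ∧ w = P.tail P.root := by
  obtain ⟨g, hg, h1, h2⟩ := E.exists_collapse_left
  by_cases hw : w = P.tail P.root
  · subst hw
    exact ⟨by rw [← hg v, h, h1], rfl⟩
  · exact absurd (by rw [← hg v, h, h2 w hw]) hv

theorem exists_vertex (v : S.Vertex) : (∃ a, E.vertexInl a = v) ∨ ∃ b, E.vertexInr b = v := by
  obtain ⟨d, rfl⟩ := S.tail_surjective v
  rcases E.exists_inl_or_inr d with ⟨a, rfl⟩ | ⟨a, rfl⟩
  · exact Or.inl ⟨_, (E.tail_inl a).symm⟩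
  · exact Or.inr ⟨_, (E.tail_inr a).symm⟩

/-- A dart of `P` adds no adjacency here: away from the leaf, both of its ends would have to be the
image of `M.tail p`. -/
theorem graph_adj_vertexInl {a b : M.Vertex} (ha : a ≠ M.head p) (hb : b ≠ M.head p) :
    S.graph.Adj (E.vertexInl a) (E.vertexInl b) ↔ M.graph.Adj a b := by
  rw [graph_adj_iff, graph_adj_iff, E.vertexInl_injective.ne_iff]
  refine and_congr_right fun hab => ⟨?_, ?_⟩
  · rintro ⟨d, h1, h2⟩
    rcases E.exists_inl_or_inr d with ⟨d, rfl⟩ | ⟨d, rfl⟩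
    · rw [tail_inl] at h1
      rw [head_inl] at h2
      exact ⟨d, E.vertexInl_injective h1, E.vertexInl_injective h2⟩
    · rw [tail_inr] at h1
      rw [head_inr] at h2
      have e1 := (E.eq_of_vertexInl_eq_vertexInr h1.symm ha).1
      have e2 := (E.eq_of_vertexInl_eq_vertexInr h2.symm hb).1
      exact absurd (e1.trans e2.symm) hab
  · rintro ⟨d, rfl, rfl⟩
    exact ⟨E.inl d, E.tail_inl d, E.head_inl d⟩

theorem head_notMem (E : EdgeSum S M P p) {T : Set M.Vertex} (hT : TwoConnectedOn M.graph T) (h₁ : M.tail M.root ∈ T)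
    (h₂ : M.head M.root ∈ T) : M.head p ∉ T :=
  tail_notMem_of_leaf E.leaf E.tail_ne_head_left E.root_ne_rev
    (by rw [rev_rev]; exact E.root_ne) hT h₁ h₂

theorem tail_root_ne (E : EdgeSum S M P p) : M.tail M.root ≠ M.head p := fun h =>
  E.root_ne_rev (eq_of_tail_eq_of_leaf E.leaf h.symm)

theorem head_root_ne (E : EdgeSum S M P p) : M.head M.root ≠ M.head p := fun h =>
  E.root_ne (M.rev.injective (eq_of_tail_eq_of_leaf E.leaf h.symm))

/-- This makes the image of `M.tail p` a cut vertex, behind which lies the rest of `P`. -/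
theorem adj_vertexInr {w : P.Vertex} (hw : w ≠ P.tail P.root) {y : S.Vertex}
    (h : S.graph.Adj (E.vertexInr w) y) :
    y ∈ E.vertexInr '' {P.tail P.root}ᶜ ∨ y = E.vertexInl (M.tail p) := by
  obtain ⟨-, d, hd, rfl⟩ := graph_adj_iff.1 h
  suffices ∃ b, S.head d = E.vertexInr b by
    obtain ⟨b, hb⟩ := this
    rw [hb, vertexInl_left]
    by_cases h : b = P.tail P.root
    · exact Or.inr (by rw [h])
    · exact Or.inl ⟨b, h, rfl⟩
  rcases E.exists_inl_or_inr d with ⟨d, rfl⟩ | ⟨d, rfl⟩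
  · have : M.tail d = M.head p := by
      by_contra h'
      exact hw (E.eq_of_vertexInl_eq_vertexInr ((E.tail_inl d).symm.trans hd) h').2
    rw [eq_of_tail_eq_of_leaf E.leaf this.symm, head_inl, head_rev, vertexInl_left]
    exact ⟨_, rfl⟩
  · exact ⟨_, E.head_inr d⟩

theorem vertexInl_notMem {v : M.Vertex} (hv : v ≠ M.head p) :
    E.vertexInl v ∉ E.vertexInr '' {P.tail P.root}ᶜ := by
  rintro ⟨w, hw, h⟩
  exact hw (E.eq_of_vertexInl_eq_vertexInr h.symm hv).2

/-- A `2`-connected set with the root edge cannot reach past the cut vertex into `P`, so it comes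
from `M` without the leaf. Conversely such a set in `M` avoids the leaf, and away from the leaf the
adjacencies of `M` and `S` agree. -/
theorem blockVertices_eq : S.blockVertices = E.vertexInl '' M.blockVertices := by
  have hcut : ∀ x ∈ E.vertexInr '' {P.tail P.root}ᶜ, ∀ y, S.graph.Adj x y →
      y ∈ E.vertexInr '' {P.tail P.root}ᶜ ∨ y = E.vertexInl (M.tail p) := by
    rintro _ ⟨w, hw, rfl⟩ y h
    exact E.adj_vertexInr hw h
  have hu := E.vertexInl_notMem (E.tail_ne_head_left p)
  ext x
  constructor
  · rintro ⟨T, ⟨h1, h2, h3⟩, hx⟩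
    rw [root_eq, tail_inl] at h1
    rw [root_eq, head_inl] at h2
    have hT : ∀ z ∈ T, z ∉ E.vertexInr '' {P.tail P.root}ᶜ := by
      intro z hz
      -- At least one end of the root edge differs from the cut vertex; it serves as the point on
      -- the near side.
      by_cases hr : M.tail M.root = M.tail p
      · refine h3.notMem_of_cut hcut hu h2 (E.vertexInl_notMem E.head_root_ne) ?_ hz
        rw [E.vertexInl_injective.ne_iff, ← hr]
        exact (E.tail_ne_head_left _).symm
      · exact h3.notMem_of_cut hcut hu h1 (E.vertexInl_notMem E.tail_root_ne)
          (E.vertexInl_injective.ne hr) hz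
    have hT' : ∀ z ∈ T, ∃ v, v ≠ M.head p ∧ E.vertexInl v = z := by
      intro z hz
      have hh : E.vertexInl (M.head p) ∈ E.vertexInr '' {P.tail P.root}ᶜ :=
        ⟨P.head P.root, (E.tail_ne_head_right _).symm, E.vertexInl_head.symm⟩
      rcases E.exists_vertex z with ⟨v, rfl⟩ | ⟨w, rfl⟩
      · exact ⟨v, fun h => hT _ hz (h ▸ hh), rfl⟩
      · have : w = P.tail P.root := by
          by_contra h
          exact hT _ hz ⟨w, h, rfl⟩
        exact ⟨M.tail p, E.tail_ne_head_left p, by rw [this, vertexInl_left]⟩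
    have himg : T = E.vertexInl '' (E.vertexInl ⁻¹' T) := by
      refine (Set.image_preimage_eq_iff.2 ?_).symm
      intro z hz
      obtain ⟨v, -, rfl⟩ := hT' z hz
      exact ⟨v, rfl⟩
    have hne : ∀ v ∈ E.vertexInl ⁻¹' T, v ≠ M.head p := by
      intro v hv
      obtain ⟨w, hw, h⟩ := hT' _ hv
      rwa [E.vertexInl_injective h] at hw
    rw [himg, twoConnectedOn_image_iff E.vertexInl_injective
      fun a ha b hb => E.graph_adj_vertexInl (hne a ha) (hne b hb)] at h3
    obtain ⟨v, -, rfl⟩ := hT' x hx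
    exact ⟨v, ⟨_, ⟨h1, h2, h3⟩, hx⟩, rfl⟩
  · rintro ⟨v, ⟨T, ⟨h1, h2, h3⟩, hv⟩, rfl⟩
    have hne : ∀ v ∈ T, v ≠ M.head p := fun v hv h => E.head_notMem h3 h1 h2 (h ▸ hv)
    refine ⟨E.vertexInl '' T, ⟨?_, ?_, ?_⟩, ⟨v, hv, rfl⟩⟩
    · rw [root_eq, tail_inl]; exact ⟨_, h1, rfl⟩
    · rw [root_eq, head_inl]; exact ⟨_, h2, rfl⟩
    · rwa [twoConnectedOn_image_iff E.vertexInl_injective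
        fun a ha b hb => E.graph_adj_vertexInl (hne a ha) (hne b hb)]

theorem vertexInl_mem_blockVertices {v : M.Vertex} :
    E.vertexInl v ∈ S.blockVertices ↔ v ∈ M.blockVertices := by
  rw [blockVertices_eq, E.vertexInl_injective.mem_set_image]

theorem head_notMem_blockVertices (E : EdgeSum S M P p) : M.head p ∉ M.blockVertices := by
  rintro ⟨T, ⟨h1, h2, h3⟩, hv⟩
  exact E.head_notMem h3 h1 h2 hv

theorem vertexInr_mem_blockVertices {v : P.Vertex} (h : E.vertexInr v ∈ S.blockVertices) :
    v = P.tail P.root := by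
  rw [blockVertices_eq] at h
  obtain ⟨w, hw, h⟩ := h
  exact (E.eq_of_vertexInl_eq_vertexInr h fun h => E.head_notMem_blockVertices (h ▸ hw)).2

theorem rootBlockSize_eq (E : EdgeSum S M P p) : S.rootBlockSize = M.rootBlockSize := by
  rw [rootBlockSize, E.blockVertices_eq, Set.ncard_image_of_injective _ E.vertexInl_injective]; rfl

theorem inl_mem_blockDarts {d : M.Dart} : E.inl d ∈ S.blockDarts ↔ d ∈ M.blockDarts := by
  simp only [blockDarts, Set.mem_ofPred_eq, tail_inl, head_inl, vertexInl_mem_blockVertices]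

theorem inr_notMem_blockDarts (d : P.Dart) : E.inr d ∉ S.blockDarts := by
  rintro ⟨h1, h2⟩
  rw [tail_inr] at h1
  rw [head_inr] at h2
  exact E.tail_ne_head_right d
    ((E.vertexInr_mem_blockVertices h1).trans (E.vertexInr_mem_blockVertices h2).symm)

theorem left_notMem_blockDarts (E : EdgeSum S M P p) : p ∉ M.blockDarts :=
  fun h => E.head_notMem_blockVertices h.2

theorem rev_left_notMem_blockDarts (E : EdgeSum S M P p) : M.rev p ∉ M.blockDarts := fun h =>
  E.head_notMem_blockVertices h.1

end EdgeSum

end RootedMap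

/-! ### Faces of the pre-root-block and pendant submaps of a sum -/

namespace RootedMap

theorem blockFace_eq_iff {M : RootedMap} {a b : M.Dart} :
    M.blockFace a = M.blockFace b ↔ Relation.EqvGen M.regionStep a b :=
  ⟨fun h => Quotient.exact h, fun h => Quotient.sound h⟩

theorem blockFace_faceNext {M : RootedMap} (d : M.Dart) :
    M.blockFace (M.faceNext d) = M.blockFace d :=
  blockFace_eq_iff.2 (.symm _ _ (.rel _ _ (Or.inl rfl)))

theorem blockFace_rev {M : RootedMap} {d : M.Dart} (h : d ∉ M.blockDarts) :
    M.blockFace (M.rev d) = M.blockFace d :=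
  blockFace_eq_iff.2 (.symm _ _ (.rel _ _ (Or.inr ⟨h, rfl⟩)))

theorem blockFace_surjective (M : RootedMap) : Function.Surjective M.blockFace :=
  Quotient.mk_surjective

theorem blockFace_map_eq {M : RootedMap} {β : Type*} (g : M.Dart → β)
    (h₁ : ∀ d, g (M.faceNext d) = g d) (h₂ : ∀ d, d ∉ M.blockDarts → g (M.rev d) = g d)
    {a b : M.Dart} (h : M.blockFace a = M.blockFace b) : g a = g b := by
  replace h := blockFace_eq_iff.1 h
  induction h with
  | rel a b h =>
    rcases h with h | ⟨h, h'⟩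
    · rw [h, h₁]
    · rw [h', h₂ a h]
  | refl => rfl
  | symm _ _ _ ih => exact ih.symm
  | trans _ _ _ _ _ ih ih' => exact ih.trans ih'

theorem rev_mem_blockDarts {M : RootedMap} {d : M.Dart} :
    M.rev d ∈ M.blockDarts ↔ d ∈ M.blockDarts := by
  simp only [blockDarts, Set.mem_ofPred_eq, tail_rev, head_rev, and_comm]

theorem mem_boundary_iff {M : RootedMap} {f : M.BlockFace} {d : M.Dart} :
    d ∈ M.boundary f ↔ d ∈ M.blockDarts ∧ M.blockFace d = f := Iff.rfl

namespace EdgeSum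

variable {S M P : RootedMap} {p : M.Dart} (E : EdgeSum S M P p)

theorem blockFace_left_rev (E : EdgeSum S M P p) : M.blockFace (M.rev p) = M.blockFace p := by
  rw [← E.faceNext_left, blockFace_faceNext]

theorem blockFace_inl_left_rev : S.blockFace (E.inl (M.rev p)) = S.blockFace (E.inl p) := by
  rw [← E.faceNext_left, ← faceNext_inl, blockFace_faceNext]

theorem blockFace_inl_of_eq {a b : M.Dart} (h : M.blockFace a = M.blockFace b) :
    S.blockFace (E.inl a) = S.blockFace (E.inl b) := by
  refine blockFace_map_eq (fun d => S.blockFace (E.inl d)) (fun d => ?_) (fun d hd => ?_) h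
  · simp only [← faceNext_inl, blockFace_faceNext]
  · by_cases h1 : d = p
    · rw [h1]; exact E.blockFace_inl_left_rev
    by_cases h2 : d = M.rev p
    · rw [h2, rev_rev]; exact E.blockFace_inl_left_rev.symm
    · simp only [← E.rev_inl h1 h2]
      exact blockFace_rev fun h => hd (E.inl_mem_blockDarts.1 h)

/-- No edge of `P` belongs to the pre-root-block, so the connected map `P` lies in a single face of
it, which also contains the slit. -/
theorem blockFace_inr (d : P.Dart) : S.blockFace (E.inr d) = S.blockFace (E.inl p) := by
  have h1 : S.blockFace (E.inr P.root) = S.blockFace (E.inl p) := by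
    rw [← rev_right, blockFace_rev, blockFace_inl_left_rev]
    exact fun h => E.rev_left_notMem_blockDarts (E.inl_mem_blockDarts.1 h)
  have h2 : S.blockFace (E.inr (P.rev P.root)) = S.blockFace (E.inl p) := by
    rw [← rev_left, blockFace_rev]
    exact fun h => E.left_notMem_blockDarts (E.inl_mem_blockDarts.1 h)
  rw [← h1]
  refine rel_of_faceNext_of_rev ⟨fun a b => S.blockFace (E.inr a) = S.blockFace (E.inr b),
    fun _ => rfl, Eq.symm, Eq.trans⟩ (fun d => ?_) (fun d => ?_) _ _
  · change _ = _
    rw [← faceNext_inr, blockFace_faceNext]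
  · change _ = _
    by_cases e1 : d = P.root
    · rw [e1, h1, h2]
    by_cases e2 : d = P.rev P.root
    · rw [e2, rev_rev, h1, h2]
    · rw [← E.rev_inr e1 e2, blockFace_rev (E.inr_notMem_blockDarts _)]

/-- The faces of the pre-root-block are those of the first summand. -/
def faceMap : M.BlockFace → S.BlockFace :=
  Quotient.lift (fun d => S.blockFace (E.inl d)) fun _ _ h =>
    E.blockFace_inl_of_eq (blockFace_eq_iff.2 h)

theorem blockFace_inl (d : M.Dart) : S.blockFace (E.inl d) = E.faceMap (M.blockFace d) := rfl

theorem faceMap_surjective : Function.Surjective E.faceMap := by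
  intro f
  obtain ⟨d, rfl⟩ := S.blockFace_surjective f
  rcases E.exists_inl_or_inr d with ⟨a, rfl⟩ | ⟨a, rfl⟩
  · exact ⟨_, (E.blockFace_inl a).symm⟩
  · exact ⟨_, (E.blockFace_inl p).symm.trans (E.blockFace_inr a).symm⟩

/-- The map that sends a dart of `M` to its face and all darts of `P` to the face of `p` is constant
along the steps of `S`, so it is a left inverse. -/
theorem faceMap_injective : Function.Injective E.faceMap := by
  intro f f' h
  obtain ⟨a, rfl⟩ := M.blockFace_surjective f
  obtain ⟨b, rfl⟩ := M.blockFace_surjective f'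
  let g : M.Dart ⊕ P.Dart → M.BlockFace := Sum.elim M.blockFace fun _ => M.blockFace p
  have gl : ∀ d, g (E.equiv.symm (E.inl d)) = M.blockFace d := fun d => by simp [g, inl]
  have gr : ∀ d, g (E.equiv.symm (E.inr d)) = M.blockFace p := fun d => by simp [g, inr]
  have := blockFace_map_eq (fun d => g (E.equiv.symm d)) (fun d => ?_) (fun d hd => ?_) h
  · simpa only [gl] using this
  · rcases E.exists_inl_or_inr d with ⟨d, rfl⟩ | ⟨d, rfl⟩
    · simp only [faceNext_inl, gl, blockFace_faceNext]
    · simp only [faceNext_inr, gr]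
  · rcases E.exists_inl_or_inr d with ⟨d, rfl⟩ | ⟨d, rfl⟩
    · simp only [gl]
      by_cases e1 : d = p
      · rw [e1, rev_left, gr]
      by_cases e2 : d = M.rev p
      · rw [e2, rev_right, gr, E.blockFace_left_rev]
      · rw [E.rev_inl e1 e2, gl, blockFace_rev fun h => hd (E.inl_mem_blockDarts.2 h)]
    · simp only [gr]
      by_cases e1 : d = P.root
      · rw [e1, rev_root, gl, E.blockFace_left_rev]
      by_cases e2 : d = P.rev P.root
      · rw [e2, rev_rev_root, gl]
      · rw [E.rev_inr e1 e2, gr]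

theorem inl_mem_boundary {f : M.BlockFace} {d : M.Dart} :
    E.inl d ∈ S.boundary (E.faceMap f) ↔ d ∈ M.boundary f := by
  rw [mem_boundary_iff, mem_boundary_iff, inl_mem_blockDarts, blockFace_inl,
    E.faceMap_injective.eq_iff]

theorem boundary_faceMap (f : M.BlockFace) :
    S.boundary (E.faceMap f) = E.inl '' M.boundary f := by
  ext d
  rcases E.exists_inl_or_inr d with ⟨d, rfl⟩ | ⟨d, rfl⟩
  · rw [inl_mem_boundary, E.inl_injective.mem_set_image]
  · refine ⟨fun h => absurd h.1 (E.inr_notMem_blockDarts d), ?_⟩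
    rintro ⟨a, -, h⟩
    exact absurd h (E.inl_ne_inr a d)

theorem rev_inl_of_mem {d : M.Dart} (h : d ∈ M.blockDarts) : S.rev (E.inl d) = E.inl (M.rev d) :=
  E.rev_inl (fun h' => E.left_notMem_blockDarts (h' ▸ h))
    fun h' => E.rev_left_notMem_blockDarts (h' ▸ h)

theorem faceMap_mem_digonFaces {f : M.BlockFace} :
    E.faceMap f ∈ S.digonFaces ↔ f ∈ M.digonFaces := by
  constructor
  · rintro ⟨a, b, hab, hr, h⟩
    have ha : a ∈ S.boundary (E.faceMap f) := by rw [h]; exact Or.inl rfl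
    have hb : b ∈ S.boundary (E.faceMap f) := by rw [h]; exact Or.inr rfl
    rw [boundary_faceMap] at ha hb
    obtain ⟨a, ha, rfl⟩ := ha
    obtain ⟨b, hb, rfl⟩ := hb
    rw [boundary_faceMap, ← Set.image_pair, E.inl_injective.image_injective.eq_iff] at h
    rw [E.rev_inl_of_mem hb.1, E.inl_injective.ne_iff] at hr
    exact ⟨a, b, E.inl_injective.ne_iff.1 hab, hr, h⟩
  · rintro ⟨a, b, hab, hr, h⟩
    have hb : b ∈ M.boundary f := by rw [h]; exact Or.inr rfl
    refine ⟨E.inl a, E.inl b, E.inl_injective.ne hab, ?_, ?_⟩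
    · rw [E.rev_inl_of_mem hb.1]
      exact E.inl_injective.ne hr
    · rw [boundary_faceMap, h, Set.image_pair]

theorem digonFaces_eq : S.digonFaces = E.faceMap '' M.digonFaces := by
  ext f
  obtain ⟨f, rfl⟩ := E.faceMap_surjective f
  rw [faceMap_mem_digonFaces, E.faceMap_injective.mem_set_image]

theorem pendantVertices_faceMap {f : M.BlockFace} (hf : f ≠ M.blockFace p) :
    S.pendantVertices (E.faceMap f) = E.vertexInl '' M.pendantVertices f := by
  ext v
  constructor
  · rintro ⟨d, ⟨h1, h2⟩, rfl⟩
    rcases E.exists_inl_or_inr d with ⟨d, rfl⟩ | ⟨d, rfl⟩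
    · exact ⟨_, ⟨d, ⟨fun h => h1 (E.inl_mem_blockDarts.2 h), E.faceMap_injective h2⟩, rfl⟩,
        (E.tail_inl d).symm⟩
    · rw [blockFace_inr, blockFace_inl] at h2
      exact absurd (E.faceMap_injective h2).symm hf
  · rintro ⟨_, ⟨d, ⟨h1, rfl⟩, rfl⟩, rfl⟩
    exact ⟨E.inl d, ⟨fun h => h1 (E.inl_mem_blockDarts.1 h), rfl⟩, rfl⟩

/-- By hypothesis the pendant vertices of `M` in this face are just the two ends of the slit edge,
which are glued to the ends of the root edge of `P`. -/
theorem pendantVertices_left (h : (M.pendantVertices (M.blockFace p)).ncard = 2) :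
    S.pendantVertices (E.faceMap (M.blockFace p)) = Set.range E.vertexInr := by
  have hsub : ({M.tail p, M.head p} : Set M.Vertex) ⊆ M.pendantVertices (M.blockFace p) := by
    rintro v (rfl | rfl)
    · exact ⟨p, ⟨E.left_notMem_blockDarts, rfl⟩, rfl⟩
    · exact ⟨M.rev p, ⟨E.rev_left_notMem_blockDarts, E.blockFace_left_rev⟩, rfl⟩
  have heq := Set.eq_of_subset_of_ncard_le hsub (by
    rw [h, Set.ncard_pair (E.tail_ne_head_left p)])
  ext v
  constructor
  · rintro ⟨d, ⟨h1, h2⟩, rfl⟩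
    rcases E.exists_inl_or_inr d with ⟨d, rfl⟩ | ⟨d, rfl⟩
    · have : M.tail d ∈ M.pendantVertices (M.blockFace p) :=
        ⟨d, ⟨fun h => h1 (E.inl_mem_blockDarts.2 h), E.faceMap_injective h2⟩, rfl⟩
      rw [← heq] at this
      rw [tail_inl]
      rcases this with h | h
      · rw [h, vertexInl_left]; exact ⟨_, rfl⟩
      · rw [h, vertexInl_head]; exact ⟨_, rfl⟩
    · exact ⟨_, (E.tail_inr d).symm⟩
  · rintro ⟨w, rfl⟩
    obtain ⟨d, rfl⟩ := P.tail_surjective w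
    exact ⟨E.inr d, ⟨E.inr_notMem_blockDarts d, E.blockFace_inr d⟩, rfl⟩

theorem ncard_pendantVertices_left (h : (M.pendantVertices (M.blockFace p)).ncard = 2) :
    (S.pendantVertices (E.faceMap (M.blockFace p))).ncard = P.numVertices := by
  rw [E.pendantVertices_left h, ← Set.image_univ,
    Set.ncard_image_of_injective _ E.vertexInr_injective, Set.ncard_univ]
  rfl

theorem ncard_pendantVertices {f : M.BlockFace} (hf : f ≠ M.blockFace p) :
    (S.pendantVertices (E.faceMap f)).ncard = (M.pendantVertices f).ncard := by
  rw [E.pendantVertices_faceMap hf, Set.ncard_image_of_injective _ E.vertexInl_injective]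

/-- All faces are inherited. The map with a single edge has to be excluded, since its face has
degree `2`; for `M` this is automatic, because the root edge and the slit edge differ. The colouring
of `P` is shifted so that `P.root` gets the colour of `p`. -/
theorem isQuadrangulation (E : EdgeSum S M P p) (hM : M.IsQuadrangulation)
    (hP : P.IsQuadrangulation) (hP' : P.numDarts ≠ 2) : S.IsQuadrangulation := by
  have hM' : M.numDarts ≠ 2 := by
    intro h
    have h1 : ({M.root, p, M.rev p} : Finset M.Dart).card ≤ M.numDarts := by
      simpa using Finset.card_le_univ ({M.root, p, M.rev p} : Finset M.Dart)
    rw [Finset.card_eq_three.2 ⟨M.root, p, M.rev p, E.root_ne, E.root_ne_rev,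
      (M.rev_ne p).symm, rfl⟩] at h1
    omega
  refine ⟨?_, Or.inr fun d => ?_⟩
  · obtain ⟨cM, m1, m2⟩ := M.exists_coloring_iff.1 hM.1
    obtain ⟨cP, p1, p2⟩ := P.exists_coloring_iff.1 hP.1
    rw [exists_coloring_iff]
    let g : M.Dart ⊕ P.Dart → Bool := Sum.elim cM fun e => (cP e ^^ cP P.root ^^ cM p)
    have gl : ∀ d, g (E.equiv.symm (E.inl d)) = cM d := fun d => by simp [g, inl]
    have gr : ∀ d, g (E.equiv.symm (E.inr d)) = (cP d ^^ cP P.root ^^ cM p) :=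
      fun d => by simp [g, inr]
    refine ⟨fun d => g (E.equiv.symm d), fun d => ?_, fun d => ?_⟩
    · rcases E.exists_inl_or_inr d with ⟨d, rfl⟩ | ⟨d, rfl⟩
      · simp only [faceNext_inl, gl, m1]
      · simp only [faceNext_inr, gr, p1, Bool.not_xor]
    · rcases E.exists_inl_or_inr d with ⟨d, rfl⟩ | ⟨d, rfl⟩
      · simp only [gl]
        by_cases e1 : d = p
        · rw [e1, rev_left, gr, p2]; simp
        by_cases e2 : d = M.rev p
        · rw [e2, rev_right, gr, m2]; simp
        · rw [E.rev_inl e1 e2, gl, m2]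
      · simp only [gr]
        by_cases e1 : d = P.root
        · rw [e1, rev_root, gl, m2]; simp
        by_cases e2 : d = P.rev P.root
        · rw [e2, rev_rev_root, gl, p2]; simp
        · rw [E.rev_inr e1 e2, gr, p2, Bool.not_xor, Bool.not_xor]
  · rcases E.exists_inl_or_inr d with ⟨d, rfl⟩ | ⟨d, rfl⟩
    · rw [Function.minimalPeriod_eq_of_semiconj E.inl_injective fun d => (E.faceNext_inl d).symm]
      exact hM.2.resolve_left hM' d
    · rw [Function.minimalPeriod_eq_of_semiconj E.inr_injective fun d => (E.faceNext_inr d).symm]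
      exact hP.2.resolve_left hP' d

end EdgeSum

end RootedMap

/-! ### Orbit paths, stars and the breadth-first search -/

/-- `l` lists the successive iterates of `f` from `d` up to `e`, which is excluded. -/
def List.IsOrbitPath {D : Type*} (f : D → D) : D → List D → D → Prop
  | d, [], e => d = e
  | d, x :: l, e => x = d ∧ List.IsOrbitPath f (f d) l e

namespace List.IsOrbitPath

variable {D : Type*} {f : D → D}

theorem append_iff {d e : D} {l l' : List D} : IsOrbitPath f d (l ++ l') e ↔
    ∃ c, IsOrbitPath f d l c ∧ IsOrbitPath f c l' e := by
  induction l generalizing d with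
  | nil => simp [IsOrbitPath]
  | cons x l ih => simp [IsOrbitPath, ih, and_assoc]

theorem iterate (n : ℕ) (d : D) : IsOrbitPath f d (List.iterate f d n) (f^[n] d) := by
  induction n generalizing d with
  | zero => rfl
  | succ n ih => exact ⟨rfl, ih _⟩

theorem eq_iterate {d e : D} {l : List D} (h : IsOrbitPath f d l e) :
    l = List.iterate f d l.length ∧ e = f^[l.length] d := by
  induction l generalizing d with
  | nil => exact ⟨rfl, Eq.symm h⟩
  | cons x l ih =>
    obtain ⟨rfl, h⟩ := h
    exact ⟨congrArg _ (ih h).1, (ih h).2⟩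

theorem head_mem {d e : D} {l : List D} (h : IsOrbitPath f d l e) (hl : l ≠ []) : d ∈ l := by
  cases l with
  | nil => exact absurd rfl hl
  | cons x l => exact h.1 ▸ List.mem_cons_self

theorem exists_last {d e : D} {l : List D} (h : IsOrbitPath f d l e) (hl : l ≠ []) :
    ∃ c ∈ l, f c = e := by
  induction l generalizing d with
  | nil => exact absurd rfl hl
  | cons x l ih =>
    obtain ⟨rfl, h⟩ := h
    by_cases hl : l = []
    · subst hl; exact ⟨x, List.mem_cons_self, h⟩
    · obtain ⟨c, hc, h'⟩ := ih h hl
      exact ⟨c, List.mem_cons_of_mem _ hc, h'⟩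

theorem map {D' : Type*} {f' : D' → D'} {g : D → D'} {d e : D} {l : List D}
    (h : IsOrbitPath f d l e) (hg : ∀ x ∈ l, f' (g x) = g (f x)) :
    IsOrbitPath f' (g d) (l.map g) (g e) := by
  induction l generalizing d with
  | nil => exact congrArg g h
  | cons x l ih =>
    obtain ⟨rfl, h⟩ := h
    refine ⟨rfl, ?_⟩
    rw [hg x List.mem_cons_self]
    exact ih h fun y hy => hg y (List.mem_cons_of_mem _ hy)

/-- The image of a path whose last step is diverted. -/
theorem map_of_last {D' : Type*} {f' : D' → D'} {g : D → D'} {d e : D} {e' : D'} {l : List D}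
    (h : IsOrbitPath f d l e) (hl : l ≠ []) (he : e ∉ l.tail)
    (hg : ∀ x ∈ l, f x ≠ e → f' (g x) = g (f x)) (hg' : ∀ x, f x = e → f' (g x) = e') :
    IsOrbitPath f' (g d) (l.map g) e' := by
  induction l generalizing d with
  | nil => exact absurd rfl hl
  | cons x l ih =>
    obtain ⟨rfl, h⟩ := h
    refine ⟨rfl, ?_⟩
    by_cases hl : l = []
    · subst hl; exact hg' x h
    · have hx : f x ≠ e := fun hx => he (hx ▸ h.head_mem hl)
      rw [hg x List.mem_cons_self hx]
      exact ih h hl (fun h' => he (List.mem_of_mem_tail h'))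
        fun y hy => hg y (List.mem_cons_of_mem _ hy)

end List.IsOrbitPath

namespace RootedMap

section Star

variable {M : RootedMap}

theorem minimalPeriod_next_pos (d : M.Dart) : 0 < Function.minimalPeriod M.next d :=
  Function.minimalPeriod_pos_of_mem_periodicPts ⟨orderOf M.next, orderOf_pos _, by
    rw [Function.IsPeriodicPt, Equiv.Perm.iterate_eq_pow, pow_orderOf_eq_one]; rfl⟩

theorem isOrbitPath_star (d : M.Dart) : List.IsOrbitPath M.next d (M.star d) d := by
  have := List.IsOrbitPath.iterate (f := M.next) (Function.minimalPeriod M.next d) d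
  rwa [Function.iterate_minimalPeriod] at this

theorem star_ne_nil (d : M.Dart) : M.star d ≠ [] := by
  rw [star, ne_eq, List.iterate_eq_nil]
  exact (minimalPeriod_next_pos d).ne'

theorem mem_star_iff {d x : M.Dart} : x ∈ M.star d ↔ M.tail x = M.tail d := by
  rw [star, List.mem_iterate]
  constructor
  · rintro ⟨m, -, rfl⟩
    rw [Equiv.Perm.iterate_eq_pow, tail_eq_iff]
    exact Equiv.Perm.sameCycle_pow_left.2 (.refl _ _)
  · intro h
    obtain ⟨i, -, hi⟩ := (tail_eq_iff.1 h.symm).exists_pow_eq'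
    refine ⟨i % Function.minimalPeriod M.next d, Nat.mod_lt _ (minimalPeriod_next_pos d), ?_⟩
    rw [Function.iterate_mod_minimalPeriod_eq, Equiv.Perm.iterate_eq_pow, hi]

theorem nodup_star (d : M.Dart) : (M.star d).Nodup := by
  rw [List.nodup_iff_injective_getElem]
  rintro ⟨i, hi⟩ ⟨j, hj⟩ h
  simp only [star, List.getElem_iterate] at h
  rw [star, List.length_iterate] at hi hj
  exact Fin.ext (Function.iterate_injOn_Iio_minimalPeriod hi hj h)

/-- A closed path without repetition goes round the vertex exactly once, since an earlier return
would list `d` twice. This is how the stars of a sum are computed. -/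
theorem star_eq_of_isOrbitPath {d : M.Dart} {l : List M.Dart} (hl : l ≠ []) (hn : l.Nodup)
    (h : List.IsOrbitPath M.next d l d) : M.star d = l := by
  obtain ⟨h1, h2⟩ := h.eq_iterate
  have hpos : 0 < l.length := List.length_pos_iff.2 hl
  suffices Function.minimalPeriod M.next d = l.length by rw [star, this, ← h1]
  have hle := Function.IsPeriodicPt.minimalPeriod_le hpos (f := M.next) (x := d) h2.symm
  by_contra hne
  have hlt : Function.minimalPeriod M.next d < l.length := lt_of_le_of_ne hle hne
  have e1 : l[Function.minimalPeriod M.next d] = d := by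
    have : l[Function.minimalPeriod M.next d]? = some d := by
      rw [h1, List.getElem?_iterate _ _ _ _ hlt, Function.iterate_minimalPeriod]
    exact (List.getElem?_eq_some_iff.1 this).2
  have e2 : l[0] = d := by
    have : l[0]? = some d := by
      rw [h1, List.getElem?_iterate _ _ _ _ hpos]; rfl
    exact (List.getElem?_eq_some_iff.1 this).2
  have := (List.Nodup.getElem_inj_iff hn).1 (e1.trans e2.symm)
  exact (minimalPeriod_next_pos d).ne' this

theorem mem_star_self (d : M.Dart) : d ∈ M.star d := mem_star_iff.2 rfl

end Star

section Search

variable {M : RootedMap}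

theorem search_succ_of_some {i : ℕ} {d : M.Dart} (h : (M.search i)[i]? = some d)
    (hd : M.rev d ∉ M.search i) : M.search (i + 1) = M.search i ++ M.star (M.rev d) := by
  rw [search, h]; simp only [if_neg hd]

theorem search_succ_cases (M : RootedMap) (i : ℕ) : M.search (i + 1) = M.search i ∨
    ∃ d, (M.search i)[i]? = some d ∧ M.rev d ∉ M.search i ∧
      M.search (i + 1) = M.search i ++ M.star (M.rev d) := by
  cases h : (M.search i)[i]? with
  | none => exact Or.inl (by rw [search, h])
  | some d =>
    by_cases hd : M.rev d ∈ M.search i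
    · exact Or.inl (by rw [search, h]; simp only [if_pos hd])
    · exact Or.inr ⟨d, rfl, hd, search_succ_of_some h hd⟩

theorem search_prefix_succ (M : RootedMap) (i : ℕ) : M.search i <+: M.search (i + 1) := by
  rcases M.search_succ_cases i with h | ⟨d, -, -, h⟩
  · rw [h]
  · rw [h]; exact List.prefix_append _ _

/-- The list is at every time a concatenation of complete stars. -/
theorem search_tail_closed {i : ℕ} {x y : M.Dart} (h : M.tail x = M.tail y)
    (hx : x ∈ M.search i) : y ∈ M.search i := by
  induction i with
  | zero =>
    rw [search, mem_star_iff] at hx ⊢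
    rw [← h, hx]
  | succ i ih =>
    rcases M.search_succ_cases i with h' | ⟨d, -, -, h'⟩
    · rw [h'] at hx ⊢; exact ih hx
    · rw [h', List.mem_append, mem_star_iff] at hx ⊢
      rw [← h]
      exact hx.imp_left ih

theorem nodup_search (M : RootedMap) (i : ℕ) : (M.search i).Nodup := by
  induction i with
  | zero => exact nodup_star _
  | succ i ih =>
    rcases M.search_succ_cases i with h | ⟨d, -, hd, h⟩
    · rwa [h]
    · rw [h]
      refine List.Nodup.append ih (nodup_star _) fun x hx hx' => hd ?_
      exact search_tail_closed (mem_star_iff.1 hx') hx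

theorem rev_mem_search {i j : ℕ} (hj : j < i) {d : M.Dart} (h : (M.search i)[j]? = some d) :
    M.rev d ∈ M.search i := by
  induction i with
  | zero => omega
  | succ i ih =>
    have hp := M.search_prefix_succ i
    by_cases hji : j < i
    · rcases lt_or_ge j (M.search i).length with hl | hl
      · rw [← hp.choose_spec, List.getElem?_append_left hl] at h
        exact hp.subset (ih hji h)
      · have : M.search (i + 1) = M.search i := by
          rw [search, List.getElem?_eq_none (by omega)]
        rw [this, List.getElem?_eq_none hl] at h
        exact absurd h (by simp)
    · obtain rfl : j = i := by omega
      rcases lt_or_ge j (M.search j).length with hl | hl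
      · rw [← hp.choose_spec, List.getElem?_append_left hl] at h
        by_cases hd : M.rev d ∈ M.search j
        · exact hp.subset hd
        · rw [search_succ_of_some h hd]
          exact List.mem_append_right _ (mem_star_self _)
      · have : M.search (j + 1) = M.search j := by
          rw [search, List.getElem?_eq_none (by omega)]
        rw [this, List.getElem?_eq_none hl] at h
        exact absurd h (by simp)

theorem length_search_le (M : RootedMap) (i : ℕ) : (M.search i).length ≤ M.numDarts := by
  simpa using (M.nodup_search i).length_le_card

theorem nodup_dartList (M : RootedMap) : M.dartList.Nodup := M.nodup_search _

theorem root_mem_search (M : RootedMap) (i : ℕ) : M.root ∈ M.search i := by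
  induction i with
  | zero => exact mem_star_self _
  | succ i ih => exact (M.search_prefix_succ i).subset ih

/-- The list has no repetition, hence at most `M.numDarts` entries, and all of them have been
inspected after that many steps. So it is closed under rotation and under reversal, and contains the
root. -/
theorem mem_dartList (d : M.Dart) : d ∈ M.dartList := by
  refine dart_induction (Pd := fun d => d ∈ M.dartList) (M.root_mem_search _) (fun d h => ?_)
    (fun d h => ?_) d
  · exact search_tail_closed (tail_next d).symm h
  · obtain ⟨j, hj⟩ := List.mem_iff_getElem?.1 h
    refine rev_mem_search (j := j) ?_ hj
    exact (List.getElem?_eq_some_iff.1 hj).1.trans_le (M.length_search_le _)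

end Search

/-! ### Breadth-first search inside a part of a map -/

section CoreSearch

open Classical in
/-- A breadth-first search in which the darts around a vertex are given by `st`. -/
noncomputable def coreSearch {D : Type} (l : List D) (r : D → D) (st : D → List D) : ℕ → List D
  | 0 => l
  | i + 1 =>
    match (coreSearch l r st i)[i]? with
    | none => coreSearch l r st i
    | some d => if r d ∈ coreSearch l r st i then coreSearch l r st i
      else coreSearch l r st i ++ st (r d)

theorem coreSearch_succ_of_some {D : Type} {l : List D} {r : D → D} {st : D → List D} {i : ℕ}
    {d : D} (h : (coreSearch l r st i)[i]? = some d) : (r d ∈ coreSearch l r st i ∧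
      coreSearch l r st (i + 1) = coreSearch l r st i) ∨ (r d ∉ coreSearch l r st i ∧
      coreSearch l r st (i + 1) = coreSearch l r st i ++ st (r d)) := by
  by_cases hd : r d ∈ coreSearch l r st i
  · exact Or.inl ⟨hd, by rw [coreSearch, h]; simp only [if_pos hd]⟩
  · exact Or.inr ⟨hd, by rw [coreSearch, h]; simp only [if_neg hd]⟩

theorem coreSearch_eq_of_le {D : Type} {l : List D} {r : D → D} {st : D → List D} {i j : ℕ}
    (hi : (coreSearch l r st i).length ≤ i) (hij : i ≤ j) :
    coreSearch l r st j = coreSearch l r st i := by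
  induction j, hij using Nat.le_induction with
  | base => rfl
  | succ j hij ih => rw [coreSearch, ih, List.getElem?_eq_none (by omega)]

/-- The predicate `K` is carried along because `g` respects reversal and stars only on the darts
that the search actually meets. -/
theorem coreSearch_map {D D' : Type} {l : List D} {r : D → D} {st : D → List D} {r' : D' → D'}
    {st' : D' → List D'} {g : D → D'} (hg : Function.Injective g) {K : D → Prop}
    (hl : ∀ d ∈ l, K d) (hst : ∀ d, K d → ∀ x ∈ st d, K x) (hr : ∀ d, K d → K (r d))
    (hr' : ∀ d, K d → r' (g d) = g (r d)) (hst' : ∀ d, K d → st' (g d) = (st d).map g) (i : ℕ) :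
    coreSearch (l.map g) r' st' i = (coreSearch l r st i).map g ∧
      ∀ d ∈ coreSearch l r st i, K d := by
  induction i with
  | zero => exact ⟨rfl, hl⟩
  | succ i ih =>
    obtain ⟨ih, hK⟩ := ih
    rw [coreSearch, coreSearch, ih, List.getElem?_map]
    cases h : (coreSearch l r st i)[i]? with
    | none => exact ⟨rfl, hK⟩
    | some d =>
      have hd := hK d (List.mem_of_getElem? h)
      have hiff : r' (g d) ∈ (coreSearch l r st i).map g ↔ r d ∈ coreSearch l r st i := by
        rw [hr' d hd, List.mem_map_of_injective hg]
      simp only [Option.map_some]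
      by_cases hm : r d ∈ coreSearch l r st i
      · rw [if_pos (hiff.2 hm), if_pos hm]
        exact ⟨rfl, hK⟩
      · rw [if_neg fun h => hm (hiff.1 h), if_neg hm, List.map_append, hr' d hd, hst' _ (hr d hd)]
        refine ⟨rfl, fun x hx => ?_⟩
        rcases List.mem_append.1 hx with hx | hx
        · exact hK x hx
        · exact hst _ (hr d hd) x hx

/-- The breadth-first order, restricted to a set of darts that is closed under reversal and meets
its complement at the tail of `p` only, is obtained by a search inside this set. -/
theorem exists_filter_dartList_eq_coreSearch {M : RootedMap} (K : M.Dart → Prop) [DecidablePred K]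
    (p : M.Dart) (hl : ∀ d, M.tail d ≠ M.head d) (hroot : K M.root)
    (hrev : ∀ d, K d → K (M.rev d))
    (hp : ∀ d, ¬ K d → M.tail d = M.tail p ∨ ∀ x, M.tail x = M.tail d → ¬ K x) :
    ∃ i, (M.dartList.filter K).length ≤ i ∧ M.dartList.filter K =
      coreSearch ((M.star M.root).filter K) M.rev (fun d => (M.star d).filter K) i := by
  have hrev' : ∀ d, ¬ K d → ¬ K (M.rev d) := fun d hd h => hd (by
    rw [← M.rev_rev d]; exact hrev _ h)
  -- A vertex that carries no dart of `K` can only be reached through the tail of `p`, so that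
  -- vertex is discovered earlier.
  have inv : ∀ i, ∀ d ∈ M.search i, (∀ x, M.tail x = M.tail d → ¬ K x) → p ∈ M.search i := by
    intro i
    induction i with
    | zero => exact fun d hd h => absurd hroot (h _ (mem_star_iff.1 hd).symm)
    | succ i ih =>
      intro x hx h
      rcases M.search_succ_cases i with h' | ⟨d, hd, -, h'⟩
      · rw [h'] at hx ⊢; exact ih x hx h
      · have hd := List.mem_of_getElem? hd
        rw [h', List.mem_append] at hx ⊢
        left
        rcases hx with hx | hx
        · exact ih x hx h
        · rw [mem_star_iff] at hx
          have h1 : ¬ K d := fun hd => h _ hx.symm (hrev _ hd)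
          rcases hp d h1 with h2 | h2
          · exact search_tail_closed h2 hd
          · exact ih d hd h2
  -- A dart outside `K` never discovers a vertex with darts in `K`: that vertex would be the tail of
  -- `p`, reached from a vertex without darts in `K`, and by `inv` it was already known.
  have outer : ∀ i, ∀ d ∈ M.search i, ¬ K d → M.rev d ∉ M.search i →
      (M.star (M.rev d)).filter K = [] := by
    intro i d hd hK hnot
    rw [List.filter_eq_nil_iff]
    intro x hx hxK
    rw [decide_eq_true_eq] at hxK
    rw [mem_star_iff] at hx
    have h1 : M.tail (M.rev d) = M.tail p := (hp _ (hrev' d hK)).resolve_right fun h => h x hx hxK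
    have h2 := (hp d hK).resolve_left fun h => hl d (h.trans h1.symm)
    exact hnot (search_tail_closed h1.symm (inv i d hd h2))
  -- The clock of the inner search: the number of darts of `K` among those inspected before step
  -- `i`. Inspecting a dart outside `K` stops this clock and contributes nothing to the filtered
  -- list.
  let c : ℕ → ℕ := fun i => (((M.search i).take i).filter K).length
  have key : ∀ i, (M.search i).filter K =
      coreSearch ((M.star M.root).filter K) M.rev (fun d => (M.star d).filter K) (c i) := by
    intro i
    induction i with
    | zero => simp [c, search, coreSearch]
    | succ i ih =>
      set core := coreSearch ((M.star M.root).filter K) M.rev (fun d => (M.star d).filter K)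
      cases h : (M.search i)[i]? with
      | none =>
        have h1 : M.search (i + 1) = M.search i := by rw [search, h]
        have h2 := List.getElem?_eq_none_iff.1 h
        have h3 : c (i + 1) = c i := by
          simp only [c, h1]
          rw [List.take_of_length_le h2, List.take_of_length_le (by omega)]
        rw [h1, h3, ih]
      | some d =>
        have hd := List.mem_of_getElem? h
        obtain ⟨hi, hid⟩ := List.getElem?_eq_some_iff.1 h
        have htake : (M.search (i + 1)).take (i + 1) = (M.search i).take i ++ [d] := by
          have : (M.search (i + 1)).take (i + 1) = (M.search i).take (i + 1) := by
            obtain ⟨t, ht⟩ := M.search_prefix_succ i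
            rw [← ht, List.take_append_of_le_length (by omega)]
          rw [this, List.take_add_one, h]; rfl
        by_cases hK : K d
        · have hc : c (i + 1) = c i + 1 := by
            simp [c, htake, List.filter_append, hK]
          have hsplit : M.search i = (M.search i).take i ++ d :: (M.search i).drop (i + 1) := by
            rw [← hid, List.getElem_cons_drop, List.take_append_drop]
          have hget : (core (c i))[c i]? = some d := by
            rw [← ih]
            conv_lhs => rw [hsplit]
            rw [List.filter_append, List.filter_cons_of_pos (by simpa using hK)]
            simp [c]
          rw [hc]
          have hmem : M.rev d ∈ core (c i) ↔ M.rev d ∈ M.search i := by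
            rw [← ih, List.mem_filter]
            simp [hrev d hK]
          rcases coreSearch_succ_of_some hget with ⟨h1, h2⟩ | ⟨h1, h2⟩
          · change _ = coreSearch _ _ _ _
            rw [h2]
            have : M.search (i + 1) = M.search i := by
              rw [search, h]; simp only [if_pos (hmem.1 h1)]
            rw [this, ih]
          · change _ = coreSearch _ _ _ _
            rw [h2, search_succ_of_some h fun h => h1 (hmem.2 h), List.filter_append, ih]
        · have hc : c (i + 1) = c i := by
            simp [c, htake, List.filter_append, hK]
          rw [hc, ← ih]
          by_cases hr : M.rev d ∈ M.search i
          · have : M.search (i + 1) = M.search i := by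
              rw [search, h]; simp only [if_pos hr]
            rw [this]
          · rw [search_succ_of_some h hr, List.filter_append, outer i d hd hK hr, List.append_nil]
  refine ⟨c M.numDarts, ?_, key _⟩
  simp only [c]
  rw [List.take_of_length_le (M.length_search_le _)]
  rfl

end CoreSearch

namespace EdgeSum

variable {S M P : RootedMap} {p : M.Dart} (E : EdgeSum S M P p)

theorem star_inl_of_ne {d : M.Dart} (h₁ : M.tail d ≠ M.tail p) (h₂ : d ≠ M.rev p) :
    S.star (E.inl d) = (M.star d).map E.inl := by
  refine star_eq_of_isOrbitPath (by simpa using star_ne_nil d)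
    ((nodup_star d).map E.inl_injective) ((isOrbitPath_star d).map fun x hx => ?_)
  rw [mem_star_iff] at hx
  refine E.next_inl (fun h => h₁ ?_) fun h => h₂ ?_
  · rw [← hx, ← h, tail_next]
  · exact eq_of_tail_eq_of_leaf E.leaf (h ▸ hx)

/-- The star of `P.root` is inserted immediately before `p`. Starting at `d ≠ p` puts the insertion
after a nonempty initial segment, rather than at the end of the list. -/
theorem star_inl_of_eq {d : M.Dart} (h₁ : M.tail d = M.tail p) (h₂ : d ≠ p) :
    ∃ l l', M.star d = l ++ p :: l' ∧ S.star (E.inl d) =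
      l.map E.inl ++ ((P.star P.root).map E.inr ++ (p :: l').map E.inl) := by
  obtain ⟨l, l', hl⟩ := List.append_of_mem (mem_star_iff.2 h₁.symm)
  have hn := nodup_star d
  have hpath := isOrbitPath_star d
  have htail : ∀ x, x ∈ l ++ p :: l' → x ≠ M.rev p := by
    rintro x hx rfl
    rw [← hl, mem_star_iff, h₁] at hx
    exact E.tail_ne_head_left p hx.symm
  rw [hl] at hn hpath
  obtain ⟨c, hp1, hp2⟩ := List.IsOrbitPath.append_iff.1 hpath
  obtain rfl : p = c := hp2.1
  have hne : l ≠ [] := by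
    rintro rfl
    exact h₂ hp1
  obtain ⟨c, hc, hcp⟩ := hp1.exists_last hne
  have hdisj := List.disjoint_of_nodup_append hn
  refine ⟨l, l', hl, star_eq_of_isOrbitPath (by simp) ?_ ?_⟩
  · rw [← List.append_assoc, List.nodup_append_comm, ← List.append_assoc, ← List.map_append]
    refine List.Nodup.append ((List.nodup_append_comm.1 hn).map E.inl_injective)
      ((nodup_star _).map E.inr_injective) ?_
    intro x hx hx'
    obtain ⟨a, -, rfl⟩ := List.mem_map.1 hx
    obtain ⟨b, -, h⟩ := List.mem_map.1 hx'
    exact E.inl_ne_inr a b h.symm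
  · refine List.IsOrbitPath.append_iff.2 ⟨E.inr P.root, ?_, ?_⟩
    · refine hp1.map_of_last hne (fun h => hdisj (List.mem_of_mem_tail h) List.mem_cons_self)
        (fun x hx h => E.next_inl h (htail x (List.mem_append_left _ hx)))
        fun x h => E.next_inl_of_next_eq h
    refine List.IsOrbitPath.append_iff.2 ⟨E.inl p, ?_, ?_⟩
    · have hP := isOrbitPath_star P.root
      have hPn := nodup_star P.root
      refine hP.map_of_last (star_ne_nil _) ?_ (fun x hx h => E.next_inr h ?_)
        fun x h => E.next_inr_of_next_eq_root h
      · cases hs : P.star P.root with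
        | nil => simp
        | cons y m =>
          rw [hs] at hP hPn
          obtain ⟨rfl, -⟩ := hP
          exact (List.nodup_cons.1 hPn).1
      · intro h
        rw [mem_star_iff, ← tail_next, h] at hx
        exact E.tail_ne_head_right _ hx.symm
    · refine hp2.map fun x hx => E.next_inl (fun h => ?_) (htail x (List.mem_append_right _ hx))
      have : x = c := M.next.injective (h.trans hcp.symm)
      exact hdisj hc (this ▸ hx)

end EdgeSum

end RootedMap

/-! ### The canonical order of the faces, and its invariance under gluing -/

theorem List.idxOf_le_idxOf_filter_iff {D : Type*} [DecidableEq D] (K : D → Prop) [DecidablePred K]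
    {a b : D} (ha : K a) (hb : K b) {L : List D} (hbL : b ∈ L) :
    (L.filter K).idxOf a ≤ (L.filter K).idxOf b ↔ L.idxOf a ≤ L.idxOf b := by
  induction L with
  | nil => simp at hbL
  | cons x L ih =>
    by_cases hax : x = a
    · subst hax
      simp [ha]
    by_cases hbx : x = b
    · subst hbx
      simp [hb, List.idxOf_cons_ne _ hax]
    have hbL' : b ∈ L := (List.mem_cons.1 hbL).resolve_left fun h => hbx h.symm
    rw [List.idxOf_cons_ne _ hax, List.idxOf_cons_ne _ hbx]
    by_cases hx : K x
    · rw [List.filter_cons_of_pos (by simpa using hx), List.idxOf_cons_ne _ hax,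
        List.idxOf_cons_ne _ hbx]
      simpa using ih hbL'
    · rw [List.filter_cons_of_neg (by simpa using hx)]
      simpa using ih hbL'

theorem List.idxOf_map_of_injective {D D' : Type*} [DecidableEq D] [DecidableEq D'] {g : D → D'}
    (hg : Function.Injective g) (a : D) (L : List D) : (L.map g).idxOf (g a) = L.idxOf a := by
  induction L with
  | nil => rfl
  | cons x L ih =>
    by_cases h : x = a
    · subst h; simp
    · rw [List.map_cons, List.idxOf_cons_ne _ (hg.ne h), List.idxOf_cons_ne _ h, ih]

namespace RootedMap

section OrderedFaces

variable {M : RootedMap}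

theorem eq_of_rank_eq {a b : M.Dart} (h : M.rank a = M.rank b) : a = b :=
  (List.idxOf_inj (mem_dartList a)).1 h

theorem mem_orderedFaces {f : M.BlockFace} : f ∈ M.orderedFaces ↔ f ∈ M.digonFaces := by
  simp only [orderedFaces, List.mem_map, List.mem_filter, decide_eq_true_eq, mem_dartList,
    true_and]
  constructor
  · rintro ⟨d, hd, rfl⟩
    exact hd.1
  · intro hf
    obtain ⟨a, b, -, -, h⟩ := id hf
    have hne : (M.boundary f).Nonempty := ⟨a, by rw [h]; exact Or.inl rfl⟩
    obtain ⟨d, hd, hmin⟩ := Set.exists_min_image (M.boundary f) M.rank (Set.toFinite _) hne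
    obtain ⟨h1, rfl⟩ := id hd
    exact ⟨d, ⟨hf, hd, hmin⟩, rfl⟩

theorem nodup_orderedFaces (M : RootedMap) : M.orderedFaces.Nodup := by
  refine List.Nodup.map_on ?_ (M.nodup_dartList.filter _)
  intro a ha b hb hab
  simp only [List.mem_filter, decide_eq_true_eq] at ha hb
  exact eq_of_rank_eq (le_antisymm (ha.2.2.2 b (hab ▸ hb.2.2.1)) (hb.2.2.2 a (hab ▸ ha.2.2.1)))

theorem length_orderedFaces (M : RootedMap) : M.orderedFaces.length = M.digonFaces.ncard := by
  classical
  rw [← List.toFinset_card_of_nodup M.nodup_orderedFaces, ← Set.ncard_coe_finset]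
  congr 1
  ext f
  simp [mem_orderedFaces]

end OrderedFaces

namespace EdgeSum

variable {S M P : RootedMap} {p : M.Dart} (E : EdgeSum S M P p)

/-- The darts of the first summand that are not on the edge of gluing. -/
def IsKept (d : S.Dart) : Prop := ∃ a, (a ≠ p ∧ a ≠ M.rev p) ∧ E.inl a = d

theorem isKept_inl {d : M.Dart} : E.IsKept (E.inl d) ↔ d ≠ p ∧ d ≠ M.rev p := by
  constructor
  · rintro ⟨a, ha, h⟩
    rwa [← E.inl_injective h]
  · exact fun h => ⟨d, h, rfl⟩

theorem not_isKept_inr (d : P.Dart) : ¬ E.IsKept (E.inr d) := by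
  rintro ⟨a, -, h⟩
  exact E.inl_ne_inr a d h

theorem tail_ne_head (E : EdgeSum S M P p) (d : S.Dart) : S.tail d ≠ S.head d := by
  rcases E.exists_inl_or_inr d with ⟨a, rfl⟩ | ⟨a, rfl⟩
  · rw [tail_inl, head_inl]
    exact E.vertexInl_injective.ne (E.tail_ne_head_left a)
  · rw [tail_inr, head_inr]
    exact E.vertexInr_injective.ne (E.tail_ne_head_right a)

open Classical in
theorem filter_star {d : M.Dart} (hd : d ≠ p ∧ d ≠ M.rev p) :
    (S.star (E.inl d)).filter (fun x => E.IsKept x) =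
      ((M.star d).filter fun x => x ≠ p ∧ x ≠ M.rev p).map E.inl := by
  have hcomp : (fun x => decide (E.IsKept x)) ∘ E.inl =
      fun x => decide (x ≠ p ∧ x ≠ M.rev p) := by
    funext x
    exact decide_eq_decide.2 E.isKept_inl
  by_cases h : M.tail d = M.tail p
  · obtain ⟨l, l', h1, h2⟩ := E.star_inl_of_eq h hd.1
    have h3 : ((P.star P.root).map E.inr).filter (fun x => E.IsKept x) = [] := by
      rw [List.filter_eq_nil_iff]
      intro x hx
      obtain ⟨y, -, rfl⟩ := List.mem_map.1 hx
      simpa using E.not_isKept_inr y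
    rw [h1, h2, List.filter_append, List.filter_append, h3, List.nil_append, ← List.filter_append,
      ← List.map_append, List.filter_map, hcomp]
  · rw [E.star_inl_of_ne h hd.2, List.filter_map, hcomp]

-- Both sides are results of restricted searches, and away from `P` and the slit edge these have the
-- same stars and reversals. Their step counts `i` and `j` may differ, so both are run up to `max i
-- j`; beyond its length a search is stationary.
open Classical in
theorem filter_dartList : S.dartList.filter (fun x => E.IsKept x) =
    (M.dartList.filter fun x => x ≠ p ∧ x ≠ M.rev p).map E.inl := by
  have hrevM : ∀ d, (d ≠ p ∧ d ≠ M.rev p) → (M.rev d ≠ p ∧ M.rev d ≠ M.rev p) := by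
    rintro d ⟨h1, h2⟩
    exact ⟨fun h => h2 (by rw [← h, rev_rev]), fun h => h1 (M.rev.injective h)⟩
  have hrevS : ∀ d, (d ≠ p ∧ d ≠ M.rev p) → S.rev (E.inl d) = E.inl (M.rev d) :=
    fun d hd => E.rev_inl hd.1 hd.2
  obtain ⟨i, hi, hi'⟩ := exists_filter_dartList_eq_coreSearch (M := M)
    (fun x => x ≠ p ∧ x ≠ M.rev p) p E.tail_ne_head_left ⟨E.root_ne, E.root_ne_rev⟩ hrevM (by
      intro d hd
      by_cases h : d = p
      · exact Or.inl (by rw [h])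
      · have h' : d = M.rev p := by
          by_contra h'
          exact hd ⟨h, h'⟩
        refine Or.inr fun x hx hK => hK.2 ?_
        rw [h'] at hx
        exact eq_of_tail_eq_of_leaf E.leaf hx.symm)
  obtain ⟨j, hj, hj'⟩ := exists_filter_dartList_eq_coreSearch (M := S) (fun x => E.IsKept x)
    (E.inl p) E.tail_ne_head (by
      rw [root_eq, isKept_inl]; exact ⟨E.root_ne, E.root_ne_rev⟩) (by
      rintro _ ⟨d, hd, rfl⟩
      rw [hrevS d hd, isKept_inl]
      exact hrevM d hd) (by
      intro d hd
      by_cases hdp : S.tail d = S.tail (E.inl p)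
      · exact Or.inl hdp
      have main : S.tail d = E.vertexInl (M.head p) → ∀ x, S.tail x = S.tail d → ¬ E.IsKept x := by
        rintro h _ hx ⟨a, ha, rfl⟩
        rw [tail_inl, h, E.vertexInl_injective.eq_iff] at hx
        exact ha.2 (eq_of_tail_eq_of_leaf E.leaf hx.symm)
      right
      rcases E.exists_inl_or_inr d with ⟨a, rfl⟩ | ⟨a, rfl⟩
      · refine main ?_
        rw [isKept_inl] at hd
        have : a = M.rev p := by
          by_contra h
          exact hd ⟨fun h' => hdp (by rw [h']), h⟩
        rw [this]; rfl
      · rintro _ hx ⟨b, hb, rfl⟩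
        rw [tail_inl, tail_inr] at hx
        by_cases hbp : M.tail b = M.head p
        · exact hb.2 (eq_of_tail_eq_of_leaf E.leaf hbp.symm)
        · refine hdp ?_
          rw [tail_inr, (E.eq_of_vertexInl_eq_vertexInr hx hbp).2, tail_inl, vertexInl_left])
  have hmap := coreSearch_map (l := (M.star M.root).filter fun x => x ≠ p ∧ x ≠ M.rev p)
    (r := M.rev) (st := fun d => (M.star d).filter fun x => x ≠ p ∧ x ≠ M.rev p) (r' := S.rev)
    (st' := fun d => (S.star d).filter fun x => E.IsKept x) E.inl_injective
    (K := fun x => x ≠ p ∧ x ≠ M.rev p) (fun d hd => by simpa using (List.mem_filter.1 hd).2)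
    (fun d _ x hx => by simpa using (List.mem_filter.1 hx).2) hrevM hrevS
    (fun d hd => E.filter_star hd) (max i j)
  rw [hi'] at hi
  rw [hj'] at hj
  rw [hi', hj', ← coreSearch_eq_of_le hi (le_max_left i j), ← hmap.1,
    ← coreSearch_eq_of_le hj (le_max_right i j)]
  congr 1
  rw [root_eq]
  exact E.filter_star ⟨E.root_ne, E.root_ne_rev⟩

theorem ne_of_mem_blockDarts (E : EdgeSum S M P p) {d : M.Dart} (h : d ∈ M.blockDarts) :
    d ≠ p ∧ d ≠ M.rev p :=
  ⟨fun h' => E.left_notMem_blockDarts (h' ▸ h), fun h' => E.rev_left_notMem_blockDarts (h' ▸ h)⟩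

theorem rank_inl_le_iff {a b : M.Dart} (ha : a ∈ M.blockDarts) (hb : b ∈ M.blockDarts) :
    S.rank (E.inl a) ≤ S.rank (E.inl b) ↔ M.rank a ≤ M.rank b := by
  classical
  have h1 := E.ne_of_mem_blockDarts ha
  have h2 := E.ne_of_mem_blockDarts hb
  have e1 := List.idxOf_le_idxOf_filter_iff (fun x => E.IsKept x) (E.isKept_inl.2 h1)
    (E.isKept_inl.2 h2) (mem_dartList (E.inl b))
  have e2 := List.idxOf_le_idxOf_filter_iff (fun x => x ≠ p ∧ x ≠ M.rev p) h1 h2 (mem_dartList b)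
  rw [rank, rank, rank, rank]
  rw [E.filter_dartList, List.idxOf_map_of_injective E.inl_injective,
    List.idxOf_map_of_injective E.inl_injective] at e1
  exact e1.symm.trans e2

theorem isLeading_inl {d : M.Dart} : S.IsLeading (E.inl d) ↔ M.IsLeading d := by
  rw [IsLeading, IsLeading, blockFace_inl, faceMap_mem_digonFaces, inl_mem_boundary,
    boundary_faceMap, Set.forall_mem_image]
  refine and_congr_right fun _ => and_congr_right fun hd => forall₂_congr fun d' hd' => ?_
  exact E.rank_inl_le_iff hd.1 hd'.1

/-- Leading darts belong to the pre-root-block, hence survive the removal of `P` and of the slit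
edge, which leaves the order of the other darts as it was in `M`. -/
theorem orderedFaces_eq : S.orderedFaces = M.orderedFaces.map E.faceMap := by
  classical
  have hS : S.dartList.filter (fun d => S.IsLeading d) =
      (S.dartList.filter fun x => E.IsKept x).filter fun d => S.IsLeading d := by
    rw [List.filter_filter]
    refine List.filter_congr fun d _ => ?_
    have : S.IsLeading d → E.IsKept d := by
      intro h
      rcases E.exists_inl_or_inr d with ⟨a, rfl⟩ | ⟨a, rfl⟩
      · exact E.isKept_inl.2 (E.ne_of_mem_blockDarts (E.inl_mem_blockDarts.1 h.2.1.1))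
      · exact absurd h.2.1.1 (E.inr_notMem_blockDarts a)
    by_cases h : S.IsLeading d <;> simp [h, this]
  have hM : M.dartList.filter (fun d => M.IsLeading d) =
      (M.dartList.filter fun x => x ≠ p ∧ x ≠ M.rev p).filter fun d => M.IsLeading d := by
    rw [List.filter_filter]
    refine List.filter_congr fun d _ => ?_
    have : M.IsLeading d → (d ≠ p ∧ d ≠ M.rev p) := fun h => E.ne_of_mem_blockDarts h.2.1.1
    by_cases h : M.IsLeading d
    · simp [h, this h]
    · simp [h]
  have e1 : S.orderedFaces = (S.dartList.filter fun d => S.IsLeading d).map S.blockFace := by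
    unfold orderedFaces; congr
  have e2 : M.orderedFaces = (M.dartList.filter fun d => M.IsLeading d).map M.blockFace := by
    unfold orderedFaces; congr
  rw [e1, e2, hS, hM, filter_dartList, List.filter_map, List.map_map, List.map_map]
  congr 1
  refine List.filter_congr fun d _ => ?_
  exact decide_eq_decide.2 E.isLeading_inl

end EdgeSum

end RootedMap

/-! ### Ears and the maximality of the pre-root-block -/

theorem SimpleGraph.Preconnected.induce_insert {V : Type} {G : SimpleGraph V} {A : Set V}
    (h : (G.induce A).Preconnected) {a z : V} (ha : a ∈ A) (haz : G.Adj a z) :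
    (G.induce (insert z A)).Preconnected := by
  have := SimpleGraph.connected_induce_union (s := A) (t := {z}) h
    SimpleGraph.Preconnected.of_subsingleton ha rfl haz
  rw [Set.union_singleton] at this
  exact this.preconnected

/-- Adding an ear with at most two inner vertices to a `2`-connected set. -/
theorem TwoConnectedOn.insert_insert {V : Type} {G : SimpleGraph V} {T : Set V}
    (hT : TwoConnectedOn G T) {u v x y : V} (hu : u ∈ T) (hv : v ∈ T) (huv : u ≠ v)
    (hx : x ∉ T) (hy : y ∉ T) (hux : G.Adj u x) (hxy : x = y ∨ G.Adj x y) (hyv : G.Adj y v) :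
    TwoConnectedOn G (insert x (insert y T)) := by
  have key : ∀ w, w ≠ x → w ≠ y → (G.induce (insert x (insert y T) \ {w})).Preconnected := by
    intro w hwx hwy
    rw [Set.insert_sdiff_of_notMem _ (by simpa using hwx.symm),
      Set.insert_sdiff_of_notMem _ (by simpa using hwy.symm)]
    have h0 := hT.preconnected_sdiff w
    by_cases huw : u = w
    · have hvw : v ∈ T \ {w} := ⟨hv, fun h => huv (huw.trans (Eq.symm h))⟩
      have h1 := h0.induce_insert hvw hyv.symm
      rcases hxy with rfl | hxy
      · rwa [Set.insert_idem]
      · exact h1.induce_insert (Set.mem_insert _ _) hxy.symm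
    · have huw' : u ∈ T \ {w} := ⟨hu, huw⟩
      have h1 := h0.induce_insert huw' hux
      rcases hxy with rfl | hxy
      · rwa [Set.insert_idem]
      · rw [Set.insert_comm]
        exact h1.induce_insert (Set.mem_insert _ _) hxy
  have hTx : (G.induce (insert x T)).Preconnected := hT.1.preconnected.induce_insert hu hux
  have hTy : (G.induce (insert y T)).Preconnected := hT.1.preconnected.induce_insert hv hyv.symm
  have hne : Nonempty ↥(insert x (insert y T)) := ⟨⟨x, Set.mem_insert _ _⟩⟩
  refine ⟨SimpleGraph.Connected.mk ?_, fun w _ => ?_⟩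
  · rcases hxy with rfl | hxy
    · rwa [Set.insert_idem]
    · exact hTy.induce_insert (Set.mem_insert _ _) hxy.symm
  · by_cases hwx : w = x
    · subst hwx
      rcases hxy with rfl | hxy
      · rw [Set.insert_idem, Set.insert_sdiff_of_mem _ (Set.mem_singleton _), Set.sdiff_singleton_eq_self hx]
        exact hT.1.preconnected
      · rw [Set.insert_sdiff_of_mem _ (Set.mem_singleton _), Set.sdiff_singleton_eq_self]
        · exact hTy
        · rintro (h | h)
          · exact hxy.ne h
          · exact hx h
    by_cases hwy : w = y
    · subst hwy
      rw [Set.insert_comm, Set.insert_sdiff_of_mem _ (Set.mem_singleton _), Set.sdiff_singleton_eq_self]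
      · exact hTx
      · rintro (h | h)
        · exact hwx h
        · exact hy h
    · exact key w hwx hwy

namespace RootedMap

section Block

variable {M : RootedMap}

theorem graph_adj (hl : ∀ d, M.tail d ≠ M.head d) (d : M.Dart) :
    M.graph.Adj (M.tail d) (M.head d) := graph_adj_iff.2 ⟨hl d, d, rfl, rfl⟩

/-- The pre-root-block is `2`-connected. -/
theorem twoConnectedOn_blockVertices (hl : ∀ d, M.tail d ≠ M.head d) :
    M.tail M.root ∈ M.blockVertices ∧ M.head M.root ∈ M.blockVertices ∧
      TwoConnectedOn M.graph M.blockVertices := by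
  let F : Set (Set M.Vertex) :=
    {S | M.tail M.root ∈ S ∧ M.head M.root ∈ S ∧ TwoConnectedOn M.graph S}
  have hne : F.Nonempty := by
    refine ⟨{M.tail M.root, M.head M.root}, Or.inl rfl, Or.inr rfl,
      SimpleGraph.induce_pair_connected_of_adj (graph_adj hl _), ?_⟩
    intro w hw
    have : Subsingleton ↥(({M.tail M.root, M.head M.root} : Set M.Vertex) \ {w}) := by
      refine ⟨fun a b => Subtype.ext ?_⟩
      obtain ⟨a, ha, ha'⟩ := a
      obtain ⟨b, hb, hb'⟩ := b
      simp only [Set.mem_insert_iff, Set.mem_singleton_iff] at hw ha hb ha' hb' ⊢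
      rcases hw with rfl | rfl <;> rcases ha with rfl | rfl <;> rcases hb with rfl | rfl <;>
        first | rfl | exact absurd rfl ha' | exact absurd rfl hb'
    exact SimpleGraph.Preconnected.of_subsingleton
  have : Finite M.Vertex := Quotient.finite _
  -- A candidate of maximal size contains every other one: both share the two ends of the root edge,
  -- so their union is again a candidate.
  obtain ⟨T, hT, hmax⟩ := Set.exists_max_image F Set.ncard (Set.toFinite _) hne
  suffices M.blockVertices = T by rw [this]; exact hT
  refine Set.Subset.antisymm (Set.sUnion_subset fun T' hT' => ?_) (Set.subset_sUnion_of_mem hT)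
  have h1 : T ∪ T' ∈ F := ⟨Or.inl hT.1, Or.inl hT.2.1,
    hT.2.2.union hT'.2.2 (hl M.root) hT.1 hT'.1 hT.2.1 hT'.2.1⟩
  have h2 := Set.eq_of_subset_of_ncard_le Set.subset_union_left (hmax _ h1) (Set.toFinite _)
  rw [h2]
  exact Set.subset_union_right

theorem root_mem_blockDarts (hl : ∀ d, M.tail d ≠ M.head d) : M.root ∈ M.blockDarts :=
  ⟨(twoConnectedOn_blockVertices hl).1, (twoConnectedOn_blockVertices hl).2.1⟩

theorem subset_blockVertices (hl : ∀ d, M.tail d ≠ M.head d) {T : Set M.Vertex}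
    (h : M.blockVertices ⊆ T) (hT : TwoConnectedOn M.graph T) : T ⊆ M.blockVertices :=
  Set.subset_sUnion_of_mem ⟨h (twoConnectedOn_blockVertices hl).1,
    h (twoConnectedOn_blockVertices hl).2.1, hT⟩

/-- There are no ears with one or two inner vertices at the pre-root-block. -/
theorem mem_blockVertices_of_ear (hl : ∀ d, M.tail d ≠ M.head d) {u v x y : M.Vertex}
    (hu : u ∈ M.blockVertices) (hv : v ∈ M.blockVertices) (huv : u ≠ v) (hux : M.graph.Adj u x)
    (hxy : x = y ∨ M.graph.Adj x y) (hyv : M.graph.Adj y v) :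
    x ∈ M.blockVertices ∨ y ∈ M.blockVertices := by
  by_contra! h
  refine h.1 (subset_blockVertices hl ?_ ((twoConnectedOn_blockVertices hl).2.2.insert_insert
    hu hv huv h.1 h.2 hux hxy hyv) (Set.mem_insert _ _))
  exact (Set.subset_insert _ _).trans (Set.subset_insert _ _)

/-- The two edges of the `2`-cycle supply an edge of the block other than that of `b`, and a leaf
lies in no `2`-connected set with a further edge. -/
theorem not_leaf_of_mem_blockDarts (hl : ∀ d, M.tail d ≠ M.head d) (hd : M.digonFaces.Nonempty)
    {b : M.Dart} (hb : b ∈ M.blockDarts) : M.next b ≠ b := by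
  intro hleaf
  obtain ⟨f, a, c, hac, har, hf⟩ := hd
  have ha : a ∈ M.blockDarts := by
    have : a ∈ M.boundary f := by rw [hf]; exact Or.inl rfl
    exact this.1
  have hc : c ∈ M.blockDarts := by
    have : c ∈ M.boundary f := by rw [hf]; exact Or.inr rfl
    exact this.1
  obtain ⟨r, hr, hrb, hrb'⟩ : ∃ r ∈ M.blockDarts, r ≠ b ∧ r ≠ M.rev b := by
    by_contra! h
    have h1 := h a ha
    have h2 := h c hc
    by_cases e1 : a = b
    · by_cases e2 : c = b
      · exact hac (e1.trans e2.symm)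
      · exact har (by rw [h2 e2, rev_rev, e1])
    · by_cases e2 : c = b
      · exact har (by rw [h1 e1, e2])
      · exact hac ((h1 e1).trans (h2 e2).symm)
  exact tail_notMem_of_leaf hleaf hl hrb hrb' (twoConnectedOn_blockVertices hl).2.2 hr.1 hr.2 hb.1

theorem faceNext_four (h : M.IsQuadrangulation) (h' : M.numDarts ≠ 2) (d : M.Dart) :
    M.faceNext (M.faceNext (M.faceNext (M.faceNext d))) = d := by
  have := Function.iterate_minimalPeriod (f := M.faceNext) (x := d)
  rwa [h.2.resolve_left h' d] at this

theorem numDarts_ne_two_of_digon (hd : M.digonFaces.Nonempty) : M.numDarts ≠ 2 := by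
  intro h
  obtain ⟨f, a, c, hac, har, hf⟩ := hd
  have h1 : ({a, c, M.rev c} : Finset M.Dart).card ≤ M.numDarts := by
    simpa using Finset.card_le_univ ({a, c, M.rev c} : Finset M.Dart)
  rw [Finset.card_eq_three.2 ⟨a, c, M.rev c, hac, har, (M.rev_ne c).symm, rfl⟩] at h1
  omega

/-- The face of a quadrangulation along which the boundary of the pre-root-block meets a pendant
submap. -/
theorem face_of_notMem_blockDarts (h : M.IsQuadrangulation) (hd : M.digonFaces.Nonempty)
    {b p q a : M.Dart} (hb : b ∈ M.blockDarts) (hp : p ∉ M.blockDarts) (hbp : M.faceNext b = p)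
    (hpq : M.faceNext p = q) (hqa : M.faceNext q = a) :
    q ∉ M.blockDarts ∧ a ∈ M.blockDarts ∧ M.faceNext a = b ∧ a ≠ b ∧ a ≠ M.rev b ∧
      M.head q = M.tail p := by
  have hl := h.tail_ne_head
  have hab : M.faceNext a = b := by
    rw [← hqa, ← hpq, ← hbp]
    exact faceNext_four h (numDarts_ne_two_of_digon hd) b
  have t1 : M.tail p = M.head b := by rw [← hbp, tail_faceNext]
  have t2 : M.tail q = M.head p := by rw [← hpq, tail_faceNext]
  have t3 : M.tail a = M.head q := by rw [← hqa, tail_faceNext]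
  have t4 : M.tail b = M.head a := by rw [← hab, tail_faceNext]
  have hx : M.head p ∉ M.blockVertices := fun hx => hp ⟨t1 ▸ hb.2, hx⟩
  have huv : M.tail p ≠ M.tail b := by rw [t1]; exact (hl b).symm
  have hu : M.tail p ∈ M.blockVertices := t1 ▸ hb.2
  -- Otherwise the walk along the face that starts with `p` is an ear. It has one inner vertex if
  -- `M.head q` is in the block, and ends at `M.tail b` with two inner vertices if not.
  have hq : M.head q = M.tail p := by
    by_contra hne
    by_cases hy : M.head q ∈ M.blockVertices
    · have := mem_blockVertices_of_ear hl hu hy (Ne.symm hne) (graph_adj hl p) (Or.inl rfl)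
        (t2 ▸ graph_adj hl q)
      exact hx (this.elim id id)
    · have h3 := graph_adj hl a
      rw [t3, ← t4] at h3
      have := mem_blockVertices_of_ear hl hu hb.1 huv (graph_adj hl p)
        (Or.inr (t2 ▸ graph_adj hl q)) h3
      exact this.elim hx hy
  refine ⟨fun hq' => hx (t2 ▸ hq'.1), ⟨?_, ?_⟩, hab, ?_, ?_, hq⟩
  · rw [t3, hq]; exact hu
  · rw [← t4]; exact hb.1
  · rintro rfl
    exact huv (by rw [← hq, t3])
  -- If `a` and `b` were the two sides of one edge, their common end would be a leaf of `M` inside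
  -- the block.
  · intro har
    refine not_leaf_of_mem_blockDarts hl hd hb ?_
    calc M.next b = M.next (M.faceNext a) := by rw [hab]
      _ = b := by rw [next_faceNext, har, rev_rev]

end Block

end RootedMap

/-! ### Cutting a map into two planar components -/

namespace Equiv.Perm

theorem jointOrbit_subtypePerm {D : Type} {φ α : Equiv.Perm D} {Z : D → Prop}
    (hφ : ∀ x, Z (φ x) ↔ Z x) (hα : ∀ x, Z (α x) ↔ Z x) {a b : D} (h : jointOrbit φ α a b)
    (ha : Z a) (hb : Z b) :
    jointOrbit (φ.subtypePerm hφ) (α.subtypePerm hα) ⟨a, ha⟩ ⟨b, hb⟩ := by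
  let r : Setoid D :=
    { r := fun a b => (Z a ↔ Z b) ∧ ∀ (ha : Z a) (hb : Z b),
        jointOrbit (φ.subtypePerm hφ) (α.subtypePerm hα) ⟨a, ha⟩ ⟨b, hb⟩
      iseqv := ⟨fun a => ⟨Iff.rfl, fun _ _ => Setoid.refl' _ _⟩,
        fun h => ⟨h.1.symm, fun ha hb => Setoid.symm' _ (h.2 hb ha)⟩,
        fun h h' => ⟨h.1.trans h'.1, fun ha hc =>
          Setoid.trans' _ (h.2 ha (h.1.1 ha)) (h'.2 (h.1.1 ha) hc)⟩⟩ }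
  have : r a b := jointOrbit_le r
    (fun a => ⟨(hφ a).symm, fun ha _ =>
      jointOrbit_left (φ.subtypePerm hφ) (α.subtypePerm hα) ⟨a, ha⟩⟩)
    (fun a => ⟨(hα a).symm, fun ha _ =>
      jointOrbit_right (φ.subtypePerm hφ) (α.subtypePerm hα) ⟨a, ha⟩⟩) h
  exact this.2 ha hb

theorem card_orbits_subtypePerm_add {D : Type} [Finite D] (φ : Equiv.Perm D) {Z : D → Prop}
    (hφ : ∀ x, Z (φ x) ↔ Z x) (hφ' : ∀ x, ¬ Z (φ x) ↔ ¬ Z x) :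
    Nat.card (OrbitsOf (φ.subtypePerm hφ)) +
      Nat.card (OrbitsOf (φ.subtypePerm (p := fun x => ¬ Z x) hφ')) =
      Nat.card (OrbitsOf φ) := by
  classical
  rw [← card_orbits_sumCongr]
  refine card_orbits_of_semiconj (Equiv.sumCompl Z) ?_
  rintro (d | d) <;> rfl

/-- Euler's inequality for a connected rotation system. -/
theorem card_orbits_add_le_of_connected {D : Type} [Finite D] (φ α : Equiv.Perm D)
    (hα : ∀ a, α (α a) = a) (r : D) (h : ∀ d, jointOrbit φ α r d) :
    Nat.card (OrbitsOf (α * φ⁻¹)) + Nat.card (OrbitsOf φ) + Nat.card (OrbitsOf α) ≤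
      Nat.card D + 2 := by
  classical
  have h1 := card_orbits_add_le φ α hα
  have : Subsingleton (Quotient (jointOrbit φ α)) := by
    refine ⟨fun a b => ?_⟩
    induction a using Quotient.inductionOn with | h a => ?_
    induction b using Quotient.inductionOn with | h b => ?_
    exact Quotient.sound (Setoid.trans' _ (Setoid.symm' _ (h a)) (h b))
  have h2 : Nat.card (Quotient (jointOrbit φ α)) ≤ 1 := Finite.card_le_one_iff_subsingleton.2 this
  omega

theorem two_mul_card_orbits {D : Type} [Finite D] (α : Equiv.Perm D) (hα : ∀ a, α (α a) = a)
    (hne : ∀ a, α a ≠ a) : 2 * Nat.card (OrbitsOf α) = Nat.card D :=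
  mul_card_orbits α 2 fun d => Function.minimalPeriod_eq_prime (hα d) (hne d)

end Equiv.Perm

namespace RootedMap

open Equiv.Perm in
/-- If regluing disconnects a planar map into the components of `r` and `s`, then both are planar
maps. -/
theorem exists_components {D : Type} [Finite D] (φ α : Equiv.Perm D) (hα : ∀ d, α (α d) = d)
    (hne : ∀ d, α d ≠ d) (s r t : D)
    (hps : ∀ d, jointOrbit φ α r d ∨ jointOrbit φ α s d)
    (ht : ¬ jointOrbit φ α r t)
    (heuler : Nat.card (OrbitsOf (α * φ⁻¹)) + Nat.card (OrbitsOf φ) =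
      Nat.card (OrbitsOf α) + 4) :
    ∃ (M P : RootedMap) (e : M.Dart ⊕ P.Dart ≃ D),
      (∀ d, (∃ a, e (.inl a) = d) ↔ jointOrbit φ α r d) ∧
      (∀ a, φ (e (.inl a)) = e (.inl (M.faceNext a))) ∧
      (∀ a, φ (e (.inr a)) = e (.inr (P.faceNext a))) ∧
      (∀ a, α (e (.inl a)) = e (.inl (M.rev a))) ∧
      (∀ a, α (e (.inr a)) = e (.inr (P.rev a))) ∧
      e (.inl M.root) = r ∧ e (.inr P.root) = t := by
  classical
  let Z : D → Prop := fun d => jointOrbit φ α r d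
  have hφ : ∀ x, Z (φ x) ↔ Z x := fun x =>
    ⟨fun h => Setoid.trans' _ h (Setoid.symm' _ (jointOrbit_left φ α x)),
      fun h => Setoid.trans' _ h (jointOrbit_left φ α x)⟩
  have hαZ : ∀ x, Z (α x) ↔ Z x := fun x =>
    ⟨fun h => Setoid.trans' _ h (Setoid.symm' _ (jointOrbit_right φ α x)),
      fun h => Setoid.trans' _ h (jointOrbit_right φ α x)⟩
  have hφ' : ∀ x, ¬ Z (φ x) ↔ ¬ Z x := fun x => not_congr (hφ x)
  have hαZ' : ∀ x, ¬ Z (α x) ↔ ¬ Z x := fun x => not_congr (hαZ x)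
  have hσ : ∀ x, Z ((α * φ⁻¹) x) ↔ Z x := fun x => by
    rw [Equiv.Perm.mul_apply, hαZ, ← hφ]
    exact iff_of_eq (congrArg Z (φ.apply_symm_apply x))
  have hσ' : ∀ x, ¬ Z ((α * φ⁻¹) x) ↔ ¬ Z x := fun x => not_congr (hσ x)
  have i1 : ∀ x, α.subtypePerm hαZ (α.subtypePerm hαZ x) = x := fun x => Subtype.ext (hα x.1)
  have i2 : ∀ x, α.subtypePerm (p := fun x => ¬ Z x) hαZ'
      (α.subtypePerm (p := fun x => ¬ Z x) hαZ' x) = x :=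
    fun x => Subtype.ext (hα x.1)
  have n1 : ∀ x, α.subtypePerm hαZ x ≠ x := fun x h => hne x.1 (congrArg Subtype.val h)
  have n2 : ∀ x, α.subtypePerm (p := fun x => ¬ Z x) hαZ' x ≠ x :=
    fun x h => hne x.1 (congrArg Subtype.val h)
  have hr : Z r := Setoid.refl' _ _
  have hW : ∀ d, ¬ Z d → jointOrbit φ α t d := fun d hd =>
    Setoid.trans' _ (Setoid.symm' _ ((hps t).resolve_left ht)) ((hps d).resolve_left hd)
  have c1 : ∀ d, jointOrbit (φ.subtypePerm hφ) (α.subtypePerm hαZ) ⟨r, hr⟩ d := fun d =>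
    jointOrbit_subtypePerm hφ hαZ d.2 hr d.2
  have c2 : ∀ d, jointOrbit (φ.subtypePerm (p := fun x => ¬ Z x) hφ')
      (α.subtypePerm (p := fun x => ¬ Z x) hαZ') ⟨t, ht⟩ d := fun d =>
    jointOrbit_subtypePerm (Z := fun x => ¬ Z x) hφ' hαZ' (hW d.1 d.2) ht d.2
  -- The two components each satisfy Euler's inequality, while together they have characteristic
  -- `4`. So both inequalities are equalities.
  have e1 := card_orbits_add_le_of_connected _ _ i1 _ c1
  have e2 := card_orbits_add_le_of_connected _ _ i2 _ c2
  have s1 : α.subtypePerm hαZ * (φ.subtypePerm hφ)⁻¹ = (α * φ⁻¹).subtypePerm hσ := rfl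
  have s2 : α.subtypePerm (p := fun x => ¬ Z x) hαZ' *
      (φ.subtypePerm (p := fun x => ¬ Z x) hφ')⁻¹ =
      (α * φ⁻¹).subtypePerm (p := fun x => ¬ Z x) hσ' := rfl
  have a1 := card_orbits_subtypePerm_add φ hφ hφ'
  have a2 := card_orbits_subtypePerm_add α hαZ hαZ'
  have a3 := card_orbits_subtypePerm_add (α * φ⁻¹) hσ hσ'
  have t1 := two_mul_card_orbits _ i1 n1
  have t2 := two_mul_card_orbits _ i2 n2
  rw [← s1, ← s2] at a3
  obtain ⟨M, eM, m1, m2, m3⟩ := exists_ofPerm (φ.subtypePerm hφ) (α.subtypePerm hαZ) ⟨r, hr⟩ i1 n1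
    c1 (by omega)
  obtain ⟨P, eP, p1, p2, p3⟩ := exists_ofPerm (φ.subtypePerm (p := fun x => ¬ Z x) hφ')
    (α.subtypePerm (p := fun x => ¬ Z x) hαZ') ⟨t, ht⟩ i2
    n2 c2 (by omega)
  refine ⟨M, P, (Equiv.sumCongr eM.symm eP.symm).trans (Equiv.sumCompl Z), ?_, ?_, ?_, ?_, ?_,
    ?_, ?_⟩
  · intro d
    constructor
    · rintro ⟨a, rfl⟩
      exact (eM.symm a).2
    · intro h
      exact ⟨eM ⟨d, h⟩, by simp⟩
  · intro a
    obtain ⟨a, rfl⟩ := eM.surjective a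
    simp [m1]
  · intro a
    obtain ⟨a, rfl⟩ := eP.surjective a
    simp [p1]
  · intro a
    obtain ⟨a, rfl⟩ := eM.surjective a
    simp [m2]
  · intro a
    obtain ⟨a, rfl⟩ := eP.surjective a
    simp [p2]
  · simp [m3]
  · simp [p3]

open Equiv.Perm in
/-- A pendant submap with more than one edge is the second summand of an `EdgeSum`. -/
theorem exists_edgeSum_of_face {S : RootedMap} (h : S.IsQuadrangulation)
    (hd : S.digonFaces.Nonempty) {b p q a : S.Dart} (hb : b ∈ S.blockDarts)
    (hp : p ∉ S.blockDarts) (hbp : S.faceNext b = p) (hpq : S.faceNext p = q)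
    (hqa : S.faceNext q = a) (hne : q ≠ S.rev p) :
    ∃ (M P : RootedMap) (p' : M.Dart) (E : EdgeSum S M P p'), M.IsQuadrangulation ∧
      P.IsQuadrangulation ∧ (∀ d, Function.minimalPeriod P.faceNext d = 4) ∧ E.inl p' = p := by
  classical
  obtain ⟨hq, ha, hab, -, -, hqp⟩ := face_of_notMem_blockDarts h hd hb hp hbp hpq hqa
  have hl := h.tail_ne_head
  set s := S.rev p with hs
  set t := S.rev q with ht
  have hsp : S.rev s = p := S.rev_rev p
  have htq : S.rev t = q := S.rev_rev q
  have t1 : S.tail p = S.head b := by rw [← hbp, tail_faceNext]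
  have t2 : S.tail q = S.head p := by rw [← hpq, tail_faceNext]
  have t3 : S.tail s = S.head p := rfl
  have t4 : S.tail t = S.tail p := hqp
  have hux : S.tail p ≠ S.head p := hl p
  have hx : S.head p ∉ S.blockVertices := fun hx => hp ⟨t1 ▸ hb.2, hx⟩
  have npq : p ≠ q := fun e => hux (by rw [← t2, ← e])
  have nps : p ≠ s := (S.rev_ne p).symm
  have npt : p ≠ t := fun e => hne (by rw [hs, e, ht, rev_rev])
  have nqt : q ≠ t := (S.rev_ne q).symm
  have nst : s ≠ t := fun e => npq (S.rev.injective e)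
  -- The two edges are zipped together: `p` is paired with `q` on the side of the face, and `s` with
  -- `t` on the far sides.
  let α : Equiv.Perm S.Dart := Equiv.swap q s * (Equiv.swap p t * S.rev)
  have ap : α p = q := by
    simp [α, ← hs, Equiv.swap_apply_of_ne_of_ne nps.symm nst]
  have aq : α q = p := by
    simp [α, ← ht, Equiv.swap_apply_of_ne_of_ne npq nps]
  have as : α s = t := by
    simp [α, hsp, Equiv.swap_apply_of_ne_of_ne nqt.symm nst.symm]
  have at' : α t = s := by
    simp [α, htq, Equiv.swap_apply_of_ne_of_ne npq.symm nqt]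
  have ao : ∀ d, d ≠ p → d ≠ q → d ≠ s → d ≠ t → α d = S.rev d := by
    intro d h1 h2 h3 h4
    have e1 : S.rev d ≠ p := fun e => h3 (S.rev.injective (e.trans hsp.symm))
    have e2 : S.rev d ≠ q := fun e => h4 (S.rev.injective (e.trans htq.symm))
    have e3 : S.rev d ≠ s := fun e => h1 (S.rev.injective e)
    have e4 : S.rev d ≠ t := fun e => h2 (S.rev.injective e)
    simp [α, Equiv.swap_apply_of_ne_of_ne e1 e4, Equiv.swap_apply_of_ne_of_ne e2 e3]
  have hα : ∀ d, α (α d) = d := by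
    intro d
    by_cases h1 : d = p
    · rw [h1, ap, aq]
    by_cases h2 : d = q
    · rw [h2, aq, ap]
    by_cases h3 : d = s
    · rw [h3, as, at']
    by_cases h4 : d = t
    · rw [h4, at', as]
    rw [ao d h1 h2 h3 h4, ao, rev_rev]
    · exact fun e => h3 (S.rev.injective (e.trans hsp.symm))
    · exact fun e => h4 (S.rev.injective (e.trans htq.symm))
    · exact fun e => h1 (S.rev.injective e)
    · exact fun e => h2 (S.rev.injective e)
  have hαne : ∀ d, α d ≠ d := by
    intro d
    by_cases h1 : d = p
    · rw [h1, ap]; exact npq.symm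
    by_cases h2 : d = q
    · rw [h2, aq]; exact npq
    by_cases h3 : d = s
    · rw [h3, as]; exact nst.symm
    by_cases h4 : d = t
    · rw [h4, at']; exact nst
    rw [ao d h1 h2 h3 h4]; exact S.rev_ne d
  have hnq : S.next q = s := by rw [← hpq, next_faceNext]
  have hσ : α * S.faceNext⁻¹ = Equiv.swap q s * (Equiv.swap p t * S.next) := by
    rw [← rev_mul_faceNext_inv]; rfl
  -- The darts `p`, `t` share a tail, and so do `q`, `s`; each transposition splits that vertex in
  -- two, while faces and the number of edges stay.
  have v1 := card_orbits_swap_mul_of_sameCycle npt (tail_eq_iff.1 t4.symm)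
  have v2 : Nat.card (OrbitsOf (Equiv.swap q s * (Equiv.swap p t * S.next))) =
      Nat.card (OrbitsOf (Equiv.swap p t * S.next)) + 1 := by
    refine card_orbits_swap_mul_of_sameCycle hne ⟨1, ?_⟩
    rw [zpow_one, Equiv.Perm.mul_apply, hnq, Equiv.swap_apply_of_ne_of_ne nps.symm nst]
  have hE := S.euler
  change Nat.card (OrbitsOf S.next) + Nat.card (OrbitsOf S.faceNext) = _ at hE
  have hE2 := two_mul_card_orbits α hα hαne
  have hE3 := two_mul_card_orbits S.rev S.rev_rev S.rev_ne
  have heuler : Nat.card (OrbitsOf (α * S.faceNext⁻¹)) + Nat.card (OrbitsOf S.faceNext) =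
      Nat.card (OrbitsOf α) + 4 := by
    have hEE : Nat.card (OrbitsOf α) = Nat.card (OrbitsOf S.rev) := by
      have := hE2.trans hE3.symm
      omega
    rw [hσ, hEE]; omega
  let J := jointOrbit S.faceNext α
  have J1 : ∀ d, J d (S.faceNext d) := jointOrbit_left _ _
  have J2 : ∀ d, J d (α d) := jointOrbit_right _ _
  have Jpq : J p q := hpq ▸ J1 p
  have Jst : J s t := as ▸ J2 s
  -- Undoing the zip only reconnects `p` with `s` and `q` with `t`, so there are at most two
  -- components.
  have hJ : ∀ d, J p d ∨ J s d := by
    intro d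
    have := rel_of_faceNext_of_rev (M := S)
      ⟨fun c d => (J p c ∨ J s c) ↔ (J p d ∨ J s d), fun _ => Iff.rfl, Iff.symm, Iff.trans⟩
      (fun d => ?_) (fun d => ?_) p d
    · exact this.1 (Or.inl (Setoid.refl' _ _))
    · have h1 := J1 d
      exact ⟨fun h => h.imp (Setoid.trans' _ · h1) (Setoid.trans' _ · h1), fun h =>
        h.imp (Setoid.trans' _ · (Setoid.symm' _ h1)) (Setoid.trans' _ · (Setoid.symm' _ h1))⟩
    · change (J p d ∨ J s d) ↔ (J p (S.rev d) ∨ J s (S.rev d))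
      by_cases h1 : d = p
      · rw [h1]
        exact iff_of_true (Or.inl (Setoid.refl' _ _)) (Or.inr (Setoid.refl' _ _))
      by_cases h2 : d = q
      · rw [h2]; exact iff_of_true (Or.inl Jpq) (Or.inr Jst)
      by_cases h3 : d = s
      · rw [h3, hsp]
        exact iff_of_true (Or.inr (Setoid.refl' _ _)) (Or.inl (Setoid.refl' _ _))
      by_cases h4 : d = t
      · rw [h4, htq]; exact iff_of_true (Or.inr Jst) (Or.inl Jpq)
      have h1 := J2 d
      rw [ao d ‹_› h2 h3 h4] at h1
      exact ⟨fun h => h.imp (Setoid.trans' _ · h1) (Setoid.trans' _ · h1), fun h =>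
        h.imp (Setoid.trans' _ · (Setoid.symm' _ h1)) (Setoid.trans' _ · (Setoid.symm' _ h1))⟩
  -- A connected system has characteristic at most `2`, but this one has `4`.
  have hnps : ¬ J p s := by
    intro hps
    have := card_orbits_add_le_of_connected S.faceNext α hα p fun d =>
      (hJ d).elim id fun h => Setoid.trans' _ hps h
    omega
  have hnpt : ¬ J p t := fun h => hnps (Setoid.trans' _ h (Setoid.symm' _ Jst))
  have Jpb : J p b := Setoid.symm' _ (hbp ▸ J1 b)
  have JZφ : ∀ d, J p (S.faceNext d) ↔ J p d := fun d =>
    ⟨fun h => Setoid.trans' _ h (Setoid.symm' _ (J1 d)), fun h => Setoid.trans' _ h (J1 d)⟩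
  have JZα : ∀ d, J p (α d) ↔ J p d := fun d =>
    ⟨fun h => Setoid.trans' _ h (Setoid.symm' _ (J2 d)), fun h => Setoid.trans' _ h (J2 d)⟩
  have hnext : ∀ d, S.next d ≠ p → S.next d ≠ q → S.next d ≠ s → S.next d ≠ t →
      (J p (S.next d) ↔ J p d) := by
    intro d h1 h2 h3 h4
    rw [next_eq] at h1 h2 h3 h4 ⊢
    rw [← ao, JZα, ← JZφ, Equiv.apply_symm_apply]
    · rintro e; exact h3 (by rw [e])
    · rintro e; exact h4 (by rw [e])
    · rintro e; exact h1 (by rw [e, hsp])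
    · rintro e; exact h2 (by rw [e, htq])
  have hroot := root_mem_blockDarts hl
  have hs' : s ∉ S.blockDarts := fun h => hp (rev_mem_blockDarts.1 h)
  have ht' : t ∉ S.blockDarts := fun h => hq (rev_mem_blockDarts.1 h)
  have hrev : J p (S.rev S.root) ↔ J p S.root := by
    rw [← ao, JZα]
    · rintro e; exact hp (e ▸ hroot)
    · rintro e; exact hq (e ▸ hroot)
    · rintro e; exact hs' (e ▸ hroot)
    · rintro e; exact ht' (e ▸ hroot)
  -- the component of the block contains the root
  have hJroot : J p S.root := by
    by_contra hr
    have hvert : ∀ d, S.tail d ≠ S.tail p → S.tail d ≠ S.head p → J p d → ∀ d',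
        S.tail d' = S.tail d → J p d' := by
      intro d h1 h2 h3 d' h'
      refine (tail_induction (M := S) (Pd := fun e => S.tail e = S.tail d ∧ J p e)
        (fun e he => ⟨(tail_next e).trans he.1, ?_⟩) h'.symm ⟨rfl, h3⟩).2
      have ht1 : S.tail (S.next e) = S.tail d := (tail_next e).trans he.1
      refine (hnext e ?_ ?_ ?_ ?_).2 he.2
      · rintro e'; exact h1 (by rw [← ht1, e'])
      · rintro e'; exact h2 (by rw [← ht1, e', t2])
      · rintro e'; exact h2 (by rw [← ht1, e', t3])
      · rintro e'; exact h1 (by rw [← ht1, e', t4])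
    -- Rotating around `S.head p` from `q` leads at once to `s`, which is in the other component,
    -- and the component can change back only at `q`.
    have hxq : ∀ e, S.tail e = S.head p → J p e → e = q := by
      intro e he hJe
      have := (tail_induction (M := S) (Pd := fun e => S.tail e = S.head p ∧ (e = q ∨ ¬ J p e))
        (fun e he => ⟨(tail_next e).trans he.1, ?_⟩) (t2.trans he.symm) ⟨t2, Or.inl rfl⟩).2
      · exact this.resolve_right fun h => h hJe
      · rcases he.2 with h' | h'
        · rw [h', hnq]; exact Or.inr hnps
        · by_cases e1 : S.next e = q
          · exact Or.inl e1
          right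
          by_cases e2 : S.next e = s
          · rw [e2]; exact hnps
          have ht1 : S.tail (S.next e) = S.head p := (tail_next e).trans he.1
          rwa [hnext e _ e1 e2 _]
          · rintro e'; exact hux (by rw [← ht1, e'])
          · rintro e'; exact hux (by rw [← ht1, e', t4])
    -- If the root were in the other component, `S.tail p` would be a cut vertex between `C`, which
    -- contains the block vertex `S.tail b`, and the root edge.
    let C : Set S.Vertex := {v | v ≠ S.tail p ∧ v ≠ S.head p ∧ ∃ d, S.tail d = v ∧ J p d}
    have hC : ∀ x ∈ C, ∀ y, S.graph.Adj x y → y ∈ C ∨ y = S.tail p := by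
      rintro x ⟨h1, h2, d, rfl, h3⟩ y hadj
      obtain ⟨-, e, he, rfl⟩ := graph_adj_iff.1 hadj
      have h4 := hvert d h1 h2 h3 e he
      by_cases hy : S.head e = S.tail p
      · exact Or.inr hy
      left
      rw [← he] at h1 h2
      have h5 : J p (S.rev e) := by
        rw [← ao, JZα]
        · exact h4
        · rintro rfl; exact h1 rfl
        · rintro rfl; exact h2 t2
        · rintro rfl; exact h2 t3
        · rintro rfl; exact h1 t4
      refine ⟨hy, fun h6 => ?_, S.rev e, rfl, h5⟩
      have h7 := hxq (S.rev e) h6 h5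
      exact h1 (by rw [← rev_rev S e, h7, tail_rev, hqp])
    have hbC : S.tail b ∈ C := by
      refine ⟨?_, fun h => hx (h ▸ hb.1), b, rfl, Jpb⟩
      rw [t1]; exact hl b
    have hrC : ∀ e, S.tail e ∈ C → J p e := by
      rintro e ⟨h1, h2, d, h3, h4⟩
      exact hvert d (h3 ▸ h1) (h3 ▸ h2) h4 e h3.symm
    have huC : S.tail p ∉ C := fun h => h.1 rfl
    have hB := (twoConnectedOn_blockVertices hl).2.2
    by_cases hru : S.tail S.root = S.tail p
    · refine hB.notMem_of_cut hC huC hroot.2 (fun h => hr (hrev.1 (hrC _ h))) ?_ hb.1 hbC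
      rw [← hru]; exact (hl _).symm
    · exact hB.notMem_of_cut hC huC hroot.1 (fun h => hr (hrC _ h)) hru hb.1 hbC
  have hJr : ∀ d, J S.root d ↔ J p d := fun d =>
    ⟨fun h => Setoid.trans' _ hJroot h, fun h => Setoid.trans' _ (Setoid.symm' _ hJroot) h⟩
  obtain ⟨M, P, e, e1, e2, e3, e4, e5, e6, e7⟩ := exists_components S.faceNext α hα hαne s S.root t
    (fun d => (hJ d).imp_left (hJr d).2)
    (fun h => hnpt ((hJr _).1 h)) heuler
  obtain ⟨p', hp'⟩ := (e1 p).2 (Setoid.symm' _ hJroot)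
  have hq' : e (.inl (M.rev p')) = q := by rw [← e4, hp', ap]
  have hs'' : e (.inr (P.rev P.root)) = s := by rw [← e5, e7, at']
  have hMφ : M.faceNext p' = M.rev p' := by
    apply Sum.inl_injective (β := P.Dart)
    apply e.injective
    rw [hq', ← e2, hp', hpq]
  have hoM : ∀ d, d ≠ p' → d ≠ M.rev p' → S.rev (e (.inl d)) = e (.inl (M.rev d)) := by
    intro d h1 h2
    rw [← e4, ao]
    · rw [← hp']; exact fun h => h1 (Sum.inl_injective (e.injective h))
    · rw [← hq']; exact fun h => h2 (Sum.inl_injective (e.injective h))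
    · rw [← hs'']; exact fun h => Sum.inl_ne_inr (e.injective h)
    · rw [← e7]; exact fun h => Sum.inl_ne_inr (e.injective h)
  have hoP : ∀ d, d ≠ P.root → d ≠ P.rev P.root → S.rev (e (.inr d)) = e (.inr (P.rev d)) := by
    intro d h1 h2
    rw [← e5, ao]
    · rw [← hp']; exact fun h => Sum.inr_ne_inl (e.injective h)
    · rw [← hq']; exact fun h => Sum.inr_ne_inl (e.injective h)
    · rw [← hs'']; exact fun h => h2 (Sum.inr_injective (e.injective h))
    · rw [← e7]; exact fun h => h1 (Sum.inr_injective (e.injective h))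
  obtain ⟨c, c1, c2⟩ := S.exists_coloring_iff.1 h.1
  -- Consecutive darts of a face have opposite colours, so the new pairs are bicoloured too and both
  -- components are bipartite.
  have hcα : ∀ d, c (α d) = !c d := by
    have cq : c q = !c p := by rw [← hpq, c1]
    have cs : c s = !c p := by rw [hs, c2]
    have ct : c t = c p := by rw [ht, c2, cq, Bool.not_not]
    intro d
    by_cases h1 : d = p
    · rw [h1, ap, cq]
    by_cases h2 : d = q
    · rw [h2, aq, cq, Bool.not_not]
    by_cases h3 : d = s
    · rw [h3, as, ct, cs, Bool.not_not]
    by_cases h4 : d = t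
    · rw [h4, at', ct, cs]
    rw [ao d h1 h2 h3 h4, c2]
  have h4 := h.2.resolve_left (numDarts_ne_two_of_digon hd)
  have hM4 : ∀ d, Function.minimalPeriod M.faceNext d = 4 := fun d => by
    rw [← h4 (e (.inl d)), ← Function.minimalPeriod_eq_of_semiconj
      (g := fun d => e (.inl d)) (e.injective.comp Sum.inl_injective) fun d => (e2 d).symm]
  have hP4 : ∀ d, Function.minimalPeriod P.faceNext d = 4 := fun d => by
    rw [← h4 (e (.inr d)), ← Function.minimalPeriod_eq_of_semiconj
      (g := fun d => e (.inr d)) (e.injective.comp Sum.inr_injective) fun d => (e3 d).symm]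
  have hM : M.IsQuadrangulation := ⟨M.exists_coloring_iff.2 ⟨fun d => c (e (.inl d)),
    fun d => by simp only [← e2, c1], fun d => by simp only [← e4, hcα]⟩, Or.inr hM4⟩
  have hP : P.IsQuadrangulation := ⟨P.exists_coloring_iff.2 ⟨fun d => c (e (.inr d)),
    fun d => by simp only [← e3, c1], fun d => by simp only [← e5, hcα]⟩, Or.inr hP4⟩
  refine ⟨M, P, p', ⟨e, e2, e3, hoM, hoP, ?_, ?_, e6.symm, ?_, ?_, ?_, hM.tail_ne_head,
    hP.tail_ne_head⟩, hM, hP, hP4, hp'⟩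
  · rw [hp', hs'']
  · rw [hq', e7]
  · rw [← hMφ, next_faceNext, hMφ]
  · intro h
    exact hp (by rw [← hp', ← h, e6]; exact hroot)
  · intro h
    exact hq (by rw [← hq', ← h, e6]; exact hroot)

end RootedMap

/-! ### The structure of pendant submaps -/

theorem Set.ncard_biUnion_of_pairwiseDisjoint {α β : Type*} [Finite β] {t : α → Set β}
    (s : Finset α) (h : (s : Set α).PairwiseDisjoint t) :
    (⋃ f ∈ s, t f).ncard = ∑ f ∈ s, (t f).ncard := by
  classical
  induction s using Finset.induction_on with
  | empty => simp
  | insert a s ha ih =>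
    rw [Finset.set_biUnion_insert, Set.ncard_union_eq, Finset.sum_insert ha, ih]
    · exact h.subset (by simp)
    · refine Set.disjoint_iUnion₂_right.2 fun f hf => ?_
      exact h (by simp) (by simp [hf]) fun e => ha (e ▸ hf)

namespace RootedMap

section Pendant

variable {S : RootedMap}

theorem root_notMem_of_closed {M : RootedMap} {W : Set M.Dart}
    (h₁ : ∀ d, M.faceNext d ∈ W ↔ d ∈ W) (h₂ : ∀ d, M.rev d ∈ W ↔ d ∈ W) (hr : M.root ∉ W)
    (d : M.Dart) : d ∉ W := by
  have := rel_of_faceNext_of_rev (M := M)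
    ⟨fun c d => c ∈ W ↔ d ∈ W, fun _ => Iff.rfl, Iff.symm, Iff.trans⟩
    (fun d => (h₁ d).symm) (fun d => (h₂ d).symm) M.root d
  exact fun h => hr (this.2 h)

/-- A pendant submap is attached to the boundary of its face. -/
theorem exists_attaching_dart (h : S.IsQuadrangulation) (hd : S.digonFaces.Nonempty) {d : S.Dart}
    (hdB : d ∉ S.blockDarts) :
    ∃ b ∈ S.blockDarts, S.faceNext b ∉ S.blockDarts ∧
      S.blockFace (S.faceNext b) = S.blockFace d := by
  by_contra! hcon
  -- If no dart of this block face leads from the block into its complement, then, faces being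
  -- cyclic of length four, none leads back either. The darts outside the block in this block face
  -- are then closed under face steps and reversal; connectedness would put the root among them.
  have h0 : ∀ e, S.blockFace e = S.blockFace d → e ∈ S.blockDarts → S.faceNext e ∈ S.blockDarts :=
    fun e he heB => by_contra fun h' => hcon e heB h' ((blockFace_faceNext e).trans he)
  refine root_notMem_of_closed (W := {e | e ∉ S.blockDarts ∧ S.blockFace e = S.blockFace d})
    (fun e => ?_) (fun e => ?_) (fun h' => h'.1 (root_mem_blockDarts h.tail_ne_head)) d ⟨hdB, rfl⟩
  · simp only [Set.mem_ofPred_eq, blockFace_faceNext]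
    refine and_congr_left fun he => not_congr ⟨fun h1 => ?_, h0 e he⟩
    have h2 := h0 _ ((blockFace_faceNext e).trans he) h1
    have h3 := h0 _ (by rw [blockFace_faceNext, blockFace_faceNext, he]) h2
    have h4 := h0 _ (by rw [blockFace_faceNext, blockFace_faceNext, blockFace_faceNext, he]) h3
    rwa [faceNext_four h (numDarts_ne_two_of_digon hd)] at h4
  · simp only [Set.mem_ofPred_eq, rev_mem_blockDarts]
    exact and_congr_right fun he => by rw [blockFace_rev he]

/-- A face whose pendant submap is a single edge. -/
theorem blockFace_eq_iff_of_leaf {b p q a : S.Dart} (hb : b ∈ S.blockDarts)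
    (ha : a ∈ S.blockDarts) (hbp : S.faceNext b = p) (hpq : S.faceNext p = q)
    (hqa : S.faceNext q = a) (hab : S.faceNext a = b) (hq : q = S.rev p) {d : S.Dart} :
    S.blockFace d = S.blockFace p ↔ d = a ∨ d = b ∨ d = p ∨ d = q := by
  constructor
  · intro hdp
    have := blockFace_map_eq (M := S) (fun d => d = a ∨ d = b ∨ d = p ∨ d = q)
      (fun d => propext ?_) (fun d hdB => propext ?_) hdp
    · exact (iff_of_eq this).2 (Or.inr (Or.inr (Or.inl rfl)))
    · constructor
      · rintro (e | e | e | e)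
        · exact Or.inr (Or.inr (Or.inr (S.faceNext.injective (e.trans hqa.symm))))
        · exact Or.inl (S.faceNext.injective (e.trans hab.symm))
        · exact Or.inr (Or.inl (S.faceNext.injective (e.trans hbp.symm)))
        · exact Or.inr (Or.inr (Or.inl (S.faceNext.injective (e.trans hpq.symm))))
      · rintro (rfl | rfl | rfl | rfl)
        · exact Or.inr (Or.inl hab)
        · exact Or.inr (Or.inr (Or.inl hbp))
        · exact Or.inr (Or.inr (Or.inr hpq))
        · exact Or.inl hqa
    · constructor
      · rintro (e | e | e | e)
        · exact absurd (rev_mem_blockDarts.1 (e ▸ ha)) hdB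
        · exact absurd (rev_mem_blockDarts.1 (e ▸ hb)) hdB
        · exact Or.inr (Or.inr (Or.inr (by rw [hq, ← e, rev_rev])))
        · exact Or.inr (Or.inr (Or.inl (S.rev.injective (e.trans hq))))
      · rintro (rfl | rfl | rfl | rfl)
        · exact absurd ha hdB
        · exact absurd hb hdB
        · exact Or.inr (Or.inr (Or.inr hq.symm))
        · exact Or.inr (Or.inr (Or.inl (by rw [hq, rev_rev])))
  · have e1 : S.blockFace q = S.blockFace p := by rw [← hpq, blockFace_faceNext]
    have e2 : S.blockFace a = S.blockFace p := by rw [← hqa, blockFace_faceNext, e1]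
    have e3 : S.blockFace b = S.blockFace p := by rw [← hbp, blockFace_faceNext]
    rintro (rfl | rfl | rfl | rfl)
    exacts [e2, e3, rfl, e1]

/-- `p` is the dart that enters the pendant submap of `f`. -/
structure IsEntrance (S : RootedMap) (f : S.BlockFace) (p : S.Dart) : Prop where
  notMem : p ∉ S.blockDarts
  pred_mem : S.faceNext.symm p ∈ S.blockDarts
  blockFace_eq : S.blockFace p = f

/-- The structure of a pendant submap in a face enclosed by a `2`-cycle. -/
structure IsPendantEntrance (S : RootedMap) (f : S.BlockFace) (p : S.Dart) : Prop
    extends IsEntrance S f p where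
  mem_digonFaces : f ∈ S.digonFaces
  eq_of_isEntrance : ∀ p', S.IsEntrance f p' → p' = p
  pendantVertices_inter : S.pendantVertices f ∩ S.blockVertices = {S.tail p}
  leaf_or_sum :
    (S.faceNext p = S.rev p ∧ (S.pendantVertices f).ncard = 2 ∧
      ∀ d, d ∉ S.blockDarts → S.blockFace d = f → d = p ∨ d = S.rev p) ∨
    (3 ≤ (S.pendantVertices f).ncard ∧ ∃ (M P : RootedMap) (p' : M.Dart) (E : EdgeSum S M P p'),
      M.IsQuadrangulation ∧ P.IsQuadrangulation ∧ P.numDarts ≠ 2 ∧ E.inl p' = p ∧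
      (M.pendantVertices (M.blockFace p')).ncard = 2)

theorem tail_mem_of_pred_mem {b p : S.Dart} (hb : b ∈ S.blockDarts) (hbp : S.faceNext b = p) :
    S.tail p ∈ S.blockVertices := by
  rw [← hbp, tail_faceNext]; exact hb.2

/-- An entrance follows a boundary dart of the face. There are only two, and `a` is followed by `b`,
which lies in the block. -/
theorem eq_of_isEntrance_of_boundary {a b p : S.Dart} {f : S.BlockFace}
    (hb : b ∈ S.blockDarts) (hbp : S.faceNext b = p) (hab : S.faceNext a = b)
    (hf : S.boundary f = {a, b}) {p' : S.Dart} (hp' : S.IsEntrance f p') : p' = p := by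
  have h1 : S.faceNext.symm p' ∈ S.boundary f := by
    refine ⟨hp'.pred_mem, ?_⟩
    rw [← blockFace_faceNext, Equiv.apply_symm_apply, hp'.blockFace_eq]
  rw [hf] at h1
  rcases h1 with h1 | h1
  · rw [Equiv.symm_apply_eq, hab] at h1
    exact absurd (h1 ▸ hb) hp'.notMem
  · rw [Set.mem_singleton_iff, Equiv.symm_apply_eq, hbp] at h1
    exact h1

theorem pendantVertices_of_leaf {b p q a : S.Dart} (h : S.IsQuadrangulation)
    (hp : p ∉ S.blockDarts) (hb : b ∈ S.blockDarts)
    (ha : a ∈ S.blockDarts) (hbp : S.faceNext b = p) (hpq : S.faceNext p = q)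
    (hqa : S.faceNext q = a) (hab : S.faceNext a = b) (hq : q = S.rev p) :
    S.boundary (S.blockFace p) = {a, b} ∧
    (∀ d, d ∉ S.blockDarts → S.blockFace d = S.blockFace p → d = p ∨ d = S.rev p) ∧
    S.pendantVertices (S.blockFace p) = {S.tail p, S.head p} ∧
    (S.pendantVertices (S.blockFace p)).ncard = 2 := by
  have key := fun d : S.Dart => blockFace_eq_iff_of_leaf hb ha hbp hpq hqa hab hq (d := d)
  have hqB : q ∉ S.blockDarts := by rwa [hq, rev_mem_blockDarts]
  have h2 : ∀ d, d ∉ S.blockDarts → S.blockFace d = S.blockFace p → d = p ∨ d = S.rev p := by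
    intro d hdB hd
    rcases (key d).1 hd with rfl | rfl | rfl | rfl
    · exact absurd ha hdB
    · exact absurd hb hdB
    · exact Or.inl rfl
    · exact Or.inr hq
  have h3 : S.pendantVertices (S.blockFace p) = {S.tail p, S.head p} := by
    ext v
    constructor
    · rintro ⟨d, ⟨h4, h5⟩, rfl⟩
      rcases h2 d h4 h5 with rfl | rfl
      · exact Or.inl rfl
      · exact Or.inr rfl
    · rintro (rfl | rfl)
      · exact ⟨p, ⟨hp, rfl⟩, rfl⟩
      · exact ⟨S.rev p, ⟨hq ▸ hqB, blockFace_rev hp⟩, rfl⟩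
  refine ⟨?_, h2, h3, by rw [h3, Set.ncard_pair (h.tail_ne_head p)]⟩
  ext d
  constructor
  · rintro ⟨h4, h5⟩
    rcases (key d).1 h5 with rfl | rfl | rfl | rfl
    · exact Or.inl rfl
    · exact Or.inr rfl
    · exact absurd h4 hp
    · exact absurd h4 hqB
  · rintro (rfl | rfl)
    · exact ⟨ha, (key _).2 (Or.inl rfl)⟩
    · exact ⟨hb, (key _).2 (Or.inr (Or.inl rfl))⟩

/-- If the pendant submap is a single edge, its face of degree four shows everything. Otherwise it
is cut off by `exists_edgeSum_of_face`: the remaining map `M` has only the leaf edge of `p'` in this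
face, and the description is carried over to `S` by the sum. -/
theorem isPendantEntrance_of_face (h : S.IsQuadrangulation) (hd : S.digonFaces.Nonempty)
    {b p : S.Dart} (hb : b ∈ S.blockDarts) (hp : p ∉ S.blockDarts) (hbp : S.faceNext b = p) :
    S.IsPendantEntrance (S.blockFace p) p := by
  obtain ⟨hq, ha, hab, hne, hner, hqp⟩ := face_of_notMem_blockDarts h hd hb hp hbp rfl rfl
  have htp := tail_mem_of_pred_mem hb hbp
  have hent : S.IsEntrance (S.blockFace p) p := ⟨hp, by rwa [← hbp, Equiv.symm_apply_apply], rfl⟩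
  by_cases hqr : S.faceNext p = S.rev p
  · obtain ⟨h1, h2, h3, h4⟩ := pendantVertices_of_leaf h hp hb ha hbp rfl rfl hab hqr
    refine ⟨hent, ⟨_, b, hne, hner, h1⟩,
      fun p' => eq_of_isEntrance_of_boundary hb hbp hab h1, ?_, Or.inl ⟨hqr, h4, h2⟩⟩
    rw [h3]
    ext v
    constructor
    · rintro ⟨rfl | rfl, hv⟩
      · rfl
      · exact absurd ⟨htp, hv⟩ hp
    · rintro rfl
      exact ⟨Or.inl rfl, htp⟩
  · obtain ⟨M, P, p', E, hM, hP, hP4, rfl⟩ := exists_edgeSum_of_face h hd hb hp hbp rfl rfl hqr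
    have hdM : M.digonFaces.Nonempty := by
      rw [E.digonFaces_eq] at hd
      exact Set.image_nonempty.1 hd
    obtain ⟨b', hb'⟩ := M.faceNext.surjective p'
    have hbb : E.inl b' = b := by
      apply S.faceNext.injective
      rw [E.faceNext_inl, hb', hbp]
    have hb'B : b' ∈ M.blockDarts := by rw [← E.inl_mem_blockDarts, hbb]; exact hb
    obtain ⟨-, ha', hab', hne', hner', -⟩ :=
      face_of_notMem_blockDarts hM hdM hb'B E.left_notMem_blockDarts hb' rfl rfl
    obtain ⟨h1, -, -, h4⟩ := pendantVertices_of_leaf hM E.left_notMem_blockDarts hb'B ha' hb' rfl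
      rfl hab' E.faceNext_left
    have hbd : S.boundary (S.blockFace (E.inl p')) =
        {E.inl (M.faceNext (M.faceNext p')), b} := by
      rw [E.blockFace_inl, E.boundary_faceMap, h1, Set.image_pair, hbb]
    have hab'' : S.faceNext (E.inl (M.faceNext (M.faceNext p'))) = b := by
      rw [E.faceNext_inl, hab', hbb]
    have hdig : S.blockFace (E.inl p') ∈ S.digonFaces := by
      rw [E.blockFace_inl, E.faceMap_mem_digonFaces]
      exact ⟨_, b', hne', hner', h1⟩
    have h5 := E.pendantVertices_left h4
    refine ⟨hent, hdig,
      fun p'' => eq_of_isEntrance_of_boundary hb hbp hab'' hbd, ?_, Or.inr ⟨?_, M, P, p', E, hM, hP,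
        ?_, rfl, h4⟩⟩
    · rw [E.blockFace_inl, h5, E.tail_inl, E.vertexInl_left]
      ext v
      constructor
      · rintro ⟨⟨w, rfl⟩, hv⟩
        rw [E.vertexInr_mem_blockVertices hv]
        rfl
      · rintro rfl
        refine ⟨⟨_, rfl⟩, ?_⟩
        rw [← E.vertexInl_left, ← E.tail_inl]
        exact htp
    · rw [E.blockFace_inl, E.ncard_pendantVertices_left h4]
      exact three_le_numVertices hP4
    · intro h2
      have h6 := hP4 P.root
      have h7 := hP.tail_ne_head P.root
      have h8 := three_le_numVertices hP4
      have := P.numVertices_le_numDarts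
      omega

/-- Without such a dart the face would consist of two darts only, which leaves no room for a face
cycle of length four. -/
theorem exists_notMem_of_mem_digonFaces (h : S.IsQuadrangulation) {f : S.BlockFace}
    (hf : f ∈ S.digonFaces) : ∃ d, d ∉ S.blockDarts ∧ S.blockFace d = f := by
  obtain ⟨a, c, hac, har, hbd⟩ := hf
  have h4 := h.2.resolve_left (numDarts_ne_two_of_digon ⟨f, a, c, hac, har, hbd⟩) a
  by_contra! hcon
  have hmem : ∀ d, S.blockFace d = f → d = a ∨ d = c := by
    intro d hd
    have : d ∈ S.boundary f := ⟨by_contra fun h' => hcon d h' hd, hd⟩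
    rw [hbd] at this
    exact this
  have ha : S.blockFace a = f := by
    have : a ∈ S.boundary f := by rw [hbd]; exact Or.inl rfl
    exact this.2
  have n1 : S.faceNext a ≠ a := fun e => by
    have : Function.minimalPeriod S.faceNext a ∣ 1 :=
      Function.IsPeriodicPt.minimalPeriod_dvd (n := 1) e
    rw [h4] at this; omega
  have n2 : S.faceNext (S.faceNext a) ≠ a := fun e => by
    have : Function.minimalPeriod S.faceNext a ∣ 2 :=
      Function.IsPeriodicPt.minimalPeriod_dvd (n := 2) e
    rw [h4] at this; omega
  have m1 := (hmem _ ((blockFace_faceNext a).trans ha)).resolve_left n1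
  have m2 := (hmem _ ((blockFace_faceNext _).trans ((blockFace_faceNext a).trans ha))).resolve_left n2
  exact n1 (S.faceNext.injective (m2.trans m1.symm))

theorem exists_isPendantEntrance_of_notMem (h : S.IsQuadrangulation) (hd : S.digonFaces.Nonempty)
    {d : S.Dart} (hdB : d ∉ S.blockDarts) : ∃ p, S.IsPendantEntrance (S.blockFace d) p := by
  obtain ⟨b, hb, hp, hf⟩ := exists_attaching_dart h hd hdB
  exact ⟨_, hf ▸ isPendantEntrance_of_face h hd hb hp rfl⟩

theorem exists_isPendantEntrance (h : S.IsQuadrangulation) {f : S.BlockFace}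
    (hf : f ∈ S.digonFaces) : ∃ p, S.IsPendantEntrance f p := by
  obtain ⟨d, hdB, rfl⟩ := exists_notMem_of_mem_digonFaces h hf
  exact exists_isPendantEntrance_of_notMem h ⟨_, hf⟩ hdB

theorem two_le_ncard_pendantVertices (h : S.IsQuadrangulation) {f : S.BlockFace}
    (hf : f ∈ S.digonFaces) : 2 ≤ (S.pendantVertices f).ncard := by
  obtain ⟨p, hp⟩ := exists_isPendantEntrance h hf
  rcases hp.leaf_or_sum with h | h
  · exact h.2.1.ge
  · exact le_trans (by norm_num) h.1

/-- The darts at a vertex outside the pre-root-block lie in the same face of it. -/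
theorem blockFace_eq_of_tail_eq {d e : S.Dart} (hd : S.tail d ∉ S.blockVertices)
    (h : S.tail d = S.tail e) : S.blockFace e = S.blockFace d := by
  refine (tail_induction (M := S)
    (Pd := fun e => S.tail e = S.tail d ∧ S.blockFace e = S.blockFace d) (fun e he => ?_) h
    ⟨rfl, rfl⟩).2
  have ht : S.tail (S.next e) = S.tail d := (tail_next e).trans he.1
  refine ⟨ht, ?_⟩
  have h1 : S.rev (S.faceNext.symm e) ∉ S.blockDarts := fun h' =>
    hd (ht ▸ (next_eq S e).symm ▸ h'.1)
  rw [next_eq, blockFace_rev fun h' => h1 (rev_mem_blockDarts.2 h'), ← he.2,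
    ← blockFace_faceNext, Equiv.apply_symm_apply]

theorem ncard_pendantVertices_sdiff (h : S.IsQuadrangulation) {f : S.BlockFace}
    (hf : f ∈ S.digonFaces) :
    (S.pendantVertices f \ S.blockVertices).ncard = (S.pendantVertices f).ncard - 1 := by
  obtain ⟨p, hp⟩ := exists_isPendantEntrance h hf
  have := Set.ncard_inter_add_ncard_sdiff_eq_ncard (S.pendantVertices f) S.blockVertices
    (Set.toFinite _)
  rw [hp.pendantVertices_inter, Set.ncard_singleton] at this
  omega

/-- A map consists of its root block and of the pendant submaps. -/
theorem numVertices_eq_add_sum (h : S.IsQuadrangulation) (hd : S.digonFaces.Nonempty) :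
    S.numVertices = S.rootBlockSize + (S.pendantSizes.map (· - 1)).sum := by
  classical
  have h1 : S.rootBlockSize + (S.blockVerticesᶜ).ncard = S.numVertices :=
    Set.ncard_add_ncard_compl _
  -- A vertex outside the block has all its darts in one block face, so these vertices are
  -- partitioned by the faces. Each pendant submap loses exactly its attaching vertex to the block.
  have h2 : S.blockVerticesᶜ =
      ⋃ f ∈ S.orderedFaces.toFinset, S.pendantVertices f \ S.blockVertices := by
    ext v
    simp only [Set.mem_iUnion, List.mem_toFinset, mem_orderedFaces, exists_prop]
    constructor
    · intro hv
      obtain ⟨d, rfl⟩ := S.tail_surjective v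
      have hdB : d ∉ S.blockDarts := fun h' => hv h'.1
      obtain ⟨p, hp⟩ := exists_isPendantEntrance_of_notMem h hd hdB
      exact ⟨_, hp.mem_digonFaces, ⟨d, ⟨hdB, rfl⟩, rfl⟩, hv⟩
    · rintro ⟨f, -, hv⟩
      exact hv.2
  have h3 : (S.blockVerticesᶜ).ncard =
      ∑ f ∈ S.orderedFaces.toFinset, (S.pendantVertices f \ S.blockVertices).ncard := by
    rw [h2]
    refine Set.ncard_biUnion_of_pairwiseDisjoint _ fun f _ g _ hfg => ?_
    refine Set.disjoint_left.2 ?_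
    rintro _ ⟨⟨d, hd, rfl⟩, hv⟩ ⟨⟨e, he, hde⟩, -⟩
    exact hfg (by rw [← hd.2, ← he.2, blockFace_eq_of_tail_eq hv hde.symm])
  rw [← h1, h3, pendantSizes, List.map_map, List.sum_toFinset _ S.nodup_orderedFaces]
  congr 2
  refine List.map_congr_left fun f hf => ?_
  exact ncard_pendantVertices_sdiff h (mem_orderedFaces.1 hf)

end Pendant

end RootedMap

/-! ### Gluing and cutting up to isomorphism -/

namespace RootedMap

theorem Iso.map_orderedFaces {M M' : RootedMap} (e : Iso M M') :
    M'.orderedFaces = M.orderedFaces.map e.faceEquiv := by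
  simp only [orderedFaces, e.map_dartList, List.filter_map, List.map_map]
  simp only [Function.comp_def, e.map_blockFace]
  rw [List.filter_congr fun d _ => decide_eq_decide.2 (e.isLeading_iff d)]

theorem Iso.isEntrance {M M' : RootedMap} (e : Iso M M') {f : M.BlockFace} {p : M.Dart}
    (h : M.IsEntrance f p) : M'.IsEntrance (e.faceEquiv f) (e.toEquiv p) where
  notMem := by rw [e.mem_blockDarts_iff]; exact h.notMem
  pred_mem := by
    have : M'.faceNext.symm (e.toEquiv p) = e.toEquiv (M.faceNext.symm p) := by
      rw [Equiv.symm_apply_eq, ← e.map_faceNext, Equiv.apply_symm_apply]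
    rw [this, e.mem_blockDarts_iff]
    exact h.pred_mem
  blockFace_eq := by rw [e.map_blockFace, h.blockFace_eq]

theorem IsEntrance.eq {M : RootedMap} (hM : M.IsQuadrangulation) {f : M.BlockFace}
    (hf : f ∈ M.digonFaces) {p p' : M.Dart} (h : M.IsEntrance f p) (h' : M.IsEntrance f p') :
    p = p' := by
  obtain ⟨p₀, h₀⟩ := exists_isPendantEntrance hM hf
  rw [h₀.eq_of_isEntrance p h, h₀.eq_of_isEntrance p' h']

/-- `p` is the entrance of the pendant submap in the `i`-th face, and this submap is an edge. -/
structure IsSlot (M : RootedMap) (i : ℕ) (p : M.Dart) : Prop where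
  getElem? : M.orderedFaces[i]? = some (M.blockFace p)
  isPendantEntrance : M.IsPendantEntrance (M.blockFace p) p
  ncard_eq : (M.pendantVertices (M.blockFace p)).ncard = 2

theorem IsSlot.leaf {M : RootedMap} {i : ℕ} {p : M.Dart} (h : M.IsSlot i p) :
    M.faceNext p = M.rev p ∧
      ∀ d, d ∉ M.blockDarts → M.blockFace d = M.blockFace p → d = p ∨ d = M.rev p := by
  rcases h.isPendantEntrance.leaf_or_sum with h' | h'
  · exact ⟨h'.1, h'.2.2⟩
  · have := h.ncard_eq
    omega

theorem exists_isSlot {M : RootedMap} (hM : M.IsQuadrangulation) {i : ℕ}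
    (hi : M.pendantSizes[i]? = some 2) : ∃ p, M.IsSlot i p := by
  rw [pendantSizes, List.getElem?_map, Option.map_eq_some_iff] at hi
  obtain ⟨f, hf, h2⟩ := hi
  obtain ⟨p, hp⟩ := exists_isPendantEntrance hM (mem_orderedFaces.1 (List.mem_of_getElem? hf))
  obtain rfl := hp.blockFace_eq
  exact ⟨p, hf, hp, h2⟩

namespace IsSlot

variable {M : RootedMap} {i : ℕ} {p : M.Dart}

theorem pendantSizes_getElem? (h : M.IsSlot i p) : M.pendantSizes[i]? = some 2 := by
  rw [pendantSizes, List.getElem?_map, h.getElem?, Option.map_some, h.ncard_eq]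

theorem next_rev (h : M.IsSlot i p) : M.next (M.rev p) = M.rev p := by
  rw [← h.leaf.1, next_faceNext, h.leaf.1]

theorem exists_edgeSum (h : M.IsSlot i p) (hM : M.IsQuadrangulation) {P : RootedMap}
    (hP : P.IsQuadrangulation) : ∃ S, Nonempty (EdgeSum S M P p) := by
  have hr := root_mem_blockDarts hM.tail_ne_head
  refine RootedMap.exists_edgeSum M P p hM.tail_ne_head hP.tail_ne_head h.next_rev ?_ ?_
  · rintro e; exact h.isPendantEntrance.notMem (e ▸ hr)
  · rintro e; exact h.isPendantEntrance.notMem (rev_mem_blockDarts.1 (e ▸ hr))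

theorem map {M' : RootedMap} {p' : M'.Dart} (hM' : M'.IsQuadrangulation) (h : M.IsSlot i p)
    (h' : M'.IsSlot i p') (e : Iso M M') : e.toEquiv p = p' := by
  refine IsEntrance.eq hM' h'.isPendantEntrance.mem_digonFaces ?_ h'.isPendantEntrance.toIsEntrance
  have h1 := e.isEntrance h.isPendantEntrance.toIsEntrance
  have h2 := h'.getElem?
  rw [e.map_orderedFaces, List.getElem?_map, h.getElem?, Option.map_some, Option.some_inj] at h2
  rwa [h2] at h1

end IsSlot

namespace EdgeSum

variable {S M P : RootedMap} {p : M.Dart} (E : EdgeSum S M P p) {i : ℕ}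

/-- The entrance is one of the two darts of the only pendant edge. It is not `M.rev p`, because that
dart is preceded on its face by `p`, which is outside the block. -/
theorem isSlot (E : EdgeSum S M P p) (hM : M.IsQuadrangulation)
    (hi : M.orderedFaces[i]? = some (M.blockFace p))
    (h2 : (M.pendantVertices (M.blockFace p)).ncard = 2) : M.IsSlot i p := by
  obtain ⟨p₀, h₀⟩ := exists_isPendantEntrance hM (mem_orderedFaces.1 (List.mem_of_getElem? hi))
  rcases h₀.leaf_or_sum with h | h
  · rcases h.2.2 p E.left_notMem_blockDarts rfl with rfl | hp
    · exact ⟨hi, h₀, h2⟩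
    · have h1 := E.faceNext_left
      rw [hp, rev_rev] at h1
      have h3 := h₀.pred_mem
      rw [← h1, Equiv.symm_apply_apply, rev_mem_blockDarts] at h3
      exact absurd h3 h₀.notMem
  · omega

theorem isEntrance_inl {f : M.BlockFace} {d : M.Dart} (h : M.IsEntrance f d) :
    S.IsEntrance (E.faceMap f) (E.inl d) where
  notMem := by rw [E.inl_mem_blockDarts]; exact h.notMem
  pred_mem := by
    have : S.faceNext.symm (E.inl d) = E.inl (M.faceNext.symm d) := by
      rw [Equiv.symm_apply_eq, E.faceNext_inl, Equiv.apply_symm_apply]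
    rw [this, E.inl_mem_blockDarts]
    exact h.pred_mem
  blockFace_eq := by rw [E.blockFace_inl, h.blockFace_eq]

theorem pendantSizes_eq (E : EdgeSum S M P p) (h : M.IsSlot i p) :
    S.pendantSizes = M.pendantSizes.set i P.numVertices := by
  rw [pendantSizes, pendantSizes, E.orderedFaces_eq, List.map_map]
  refine List.ext_getElem? fun j => ?_
  rw [List.getElem?_set]
  split_ifs with h1 h2
  · subst h1
    rw [List.getElem?_map, h.getElem?, Option.map_some, Function.comp_apply,
      E.ncard_pendantVertices_left h.ncard_eq]
  · subst h1
    rw [List.getElem?_map, h.getElem?] at *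
    have := (List.getElem?_eq_some_iff.1 h.getElem?).1
    simp only [List.length_map] at h2
    exact absurd this h2
  · rw [List.getElem?_map, List.getElem?_map]
    cases hj : M.orderedFaces[j]? with
    | none => rfl
    | some f =>
      rw [Option.map_some, Option.map_some, Function.comp_apply, E.ncard_pendantVertices]
      rintro rfl
      have h3 := (List.getElem?_eq_some_iff.1 h.getElem?)
      have h4 := (List.getElem?_eq_some_iff.1 hj)
      obtain ⟨h3, h3'⟩ := h3
      obtain ⟨h4, h4'⟩ := h4
      exact h1 ((M.nodup_orderedFaces.getElem_inj_iff).1 (h3'.trans h4'.symm))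

theorem getElem?_orderedFaces (h : M.IsSlot i p) :
    S.orderedFaces[i]? = some (S.blockFace (E.inl p)) := by
  rw [E.orderedFaces_eq, List.getElem?_map, h.getElem?, Option.map_some, E.blockFace_inl]

/-- The right-hand side speaks of `P` only through `S` and the two slit darts, so that an
isomorphism which matches the slit darts also matches the darts of `P`. -/
theorem exists_inr_iff (h : M.IsSlot i p) {d : S.Dart} :
    (∃ x, E.inr x = d) ↔ d ∉ S.blockDarts ∧ S.blockFace d = S.blockFace (E.inl p) ∧
      d ≠ E.inl p ∧ d ≠ E.inl (M.rev p) := by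
  constructor
  · rintro ⟨x, rfl⟩
    exact ⟨E.inr_notMem_blockDarts x, E.blockFace_inr x, (E.inl_ne_inr _ _).symm,
      (E.inl_ne_inr _ _).symm⟩
  · rintro ⟨h1, h2, h3, h4⟩
    rcases E.exists_inl_or_inr d with ⟨x, rfl⟩ | hx
    · rw [E.inl_mem_blockDarts] at h1
      rw [E.blockFace_inl, E.blockFace_inl] at h2
      rcases h.leaf.2 x h1 (E.faceMap_injective h2) with rfl | rfl
      · exact absurd rfl h3
      · exact absurd rfl h4
    · exact hx

/-- The sum depends only on the isomorphism classes of the summands. -/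
theorem nonempty_iso (E : EdgeSum S M P p) {S' M' P' : RootedMap} {p' : M'.Dart} (E' : EdgeSum S' M' P' p')
    (g : Iso M M') (k : Iso P P') (hp : g.toEquiv p = p') : Nonempty (Iso S S') := by
  let e : S.Dart ≃ S'.Dart :=
    E.equiv.symm.trans ((Equiv.sumCongr g.toEquiv k.toEquiv).trans E'.equiv)
  have e1 : ∀ d, e (E.inl d) = E'.inl (g.toEquiv d) := fun d => by simp [e, inl]
  have e2 : ∀ d, e (E.inr d) = E'.inr (k.toEquiv d) := fun d => by simp [e, inr]
  have hp' : g.toEquiv (M.rev p) = M'.rev p' := by rw [g.map_rev, hp]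
  have hr' : k.toEquiv (P.rev P.root) = P'.rev P'.root := by rw [k.map_rev, k.map_root]
  refine ⟨Iso.ofFaceNext e (fun d => ?_) (fun d => ?_) ?_⟩
  · rcases E.exists_inl_or_inr d with ⟨d, rfl⟩ | ⟨d, rfl⟩
    · rw [E.faceNext_inl, e1, e1, E'.faceNext_inl, g.map_faceNext]
    · rw [E.faceNext_inr, e2, e2, E'.faceNext_inr, k.map_faceNext]
  · rcases E.exists_inl_or_inr d with ⟨d, rfl⟩ | ⟨d, rfl⟩
    · by_cases h1 : d = p
      · rw [h1, E.rev_left, e1, hp, e2, hr', E'.rev_left]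
      by_cases h2 : d = M.rev p
      · rw [h2, E.rev_right, e1, hp', e2, k.map_root, E'.rev_right]
      rw [E.rev_inl h1 h2, e1, e1, E'.rev_inl, g.map_rev]
      · rw [← hp]; exact fun h => h1 (g.toEquiv.injective h)
      · rw [← hp']; exact fun h => h2 (g.toEquiv.injective h)
    · by_cases h1 : d = P.root
      · rw [h1, E.rev_root, e1, hp', e2, k.map_root, E'.rev_root]
      by_cases h2 : d = P.rev P.root
      · rw [h2, E.rev_rev_root, e1, hp, e2, hr', E'.rev_rev_root]
      rw [E.rev_inr h1 h2, e2, e2, E'.rev_inr, k.map_rev]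
      · rw [← k.map_root]; exact fun h => h1 (k.toEquiv.injective h)
      · rw [← hr']; exact fun h => h2 (k.toEquiv.injective h)
  · rw [E.root_eq, e1, g.map_root, E'.root_eq]

/-- The summands can be recovered from the sum. -/
theorem nonempty_iso_summands (E : EdgeSum S M P p) {S' M' P' : RootedMap} {p' : M'.Dart}
    (E' : EdgeSum S' M' P' p')
    (hS' : S'.IsQuadrangulation) (h : M.IsSlot i p) (h' : M'.IsSlot i p') (e : Iso S S') :
    Nonempty (Iso M M') ∧ Nonempty (Iso P P') := by
  have hface : e.faceEquiv (S.blockFace (E.inl p)) = S'.blockFace (E'.inl p') := by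
    have h2 := E'.getElem?_orderedFaces h'
    rwa [e.map_orderedFaces, List.getElem?_map, E.getElem?_orderedFaces h, Option.map_some,
      Option.some_inj] at h2
  -- Isomorphisms respect the order of the faces, and the `i`-th face has only one entrance. This
  -- makes the cut canonical.
  have hp : e.toEquiv (E.inl p) = E'.inl p' := by
    refine IsEntrance.eq hS' ?_ ?_ (E'.isEntrance_inl h'.isPendantEntrance.toIsEntrance)
    · rw [E'.faceMap_mem_digonFaces]; exact h'.isPendantEntrance.mem_digonFaces
    · have := e.isEntrance (E.isEntrance_inl h.isPendantEntrance.toIsEntrance)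
      rw [← E.blockFace_inl, hface] at this
      exact this
  have hq : e.toEquiv (E.inl (M.rev p)) = E'.inl (M'.rev p') := by
    rw [← E.faceNext_left, ← E.faceNext_inl, e.map_faceNext, hp, E'.faceNext_inl, E'.faceNext_left]
  have hinr : ∀ d, (∃ x, E'.inr x = e.toEquiv d) ↔ ∃ x, E.inr x = d := by
    intro d
    rw [E.exists_inr_iff h, E'.exists_inr_iff h', e.mem_blockDarts_iff, e.map_blockFace, ← hface,
      ← hp, ← hq, e.faceEquiv.injective.eq_iff, e.toEquiv.injective.ne_iff,
      e.toEquiv.injective.ne_iff]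
  have hinl : ∀ d, (∃ x, E'.inl x = e.toEquiv d) ↔ ∃ x, E.inl x = d := by
    intro d
    constructor
    · rintro ⟨x, hx⟩
      refine (E.exists_inl_or_inr d).resolve_right fun hd => ?_
      obtain ⟨y, hy⟩ := (hinr d).2 hd
      exact E'.inl_ne_inr _ _ (hx.trans hy.symm)
    · rintro ⟨x, hx⟩
      refine (E'.exists_inl_or_inr _).resolve_right fun hd => ?_
      obtain ⟨y, hy⟩ := (hinr d).1 hd
      exact E.inl_ne_inr _ _ (hx.trans hy.symm)
  choose g hg using fun x => (hinl (E.inl x)).2 ⟨x, rfl⟩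
  choose k hk using fun x => (hinr (E.inr x)).2 ⟨x, rfl⟩
  have hgb : Function.Bijective g := by
    constructor
    · intro a b hab
      apply E.inl_injective
      apply e.toEquiv.injective
      rw [← hg, ← hg, hab]
    · intro y
      obtain ⟨d, hd⟩ := e.toEquiv.surjective (E'.inl y)
      obtain ⟨x, rfl⟩ := (hinl d).1 ⟨y, hd.symm⟩
      exact ⟨x, E'.inl_injective ((hg x).trans hd)⟩
  have hkb : Function.Bijective k := by
    constructor
    · intro a b hab
      apply E.inr_injective
      apply e.toEquiv.injective
      rw [← hk, ← hk, hab]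
    · intro y
      obtain ⟨d, hd⟩ := e.toEquiv.surjective (E'.inr y)
      obtain ⟨x, rfl⟩ := (hinr d).1 ⟨y, hd.symm⟩
      exact ⟨x, E'.inr_injective ((hk x).trans hd)⟩
  have gp : g p = p' := E'.inl_injective ((hg p).trans hp)
  have gq : g (M.rev p) = M'.rev p' := E'.inl_injective ((hg _).trans hq)
  have kr : k P.root = P'.root := by
    apply E'.inr_injective
    rw [hk, ← E.rev_right, e.map_rev, hq, E'.rev_right]
  have kr' : k (P.rev P.root) = P'.rev P'.root := by
    apply E'.inr_injective
    rw [hk, ← E.rev_left, e.map_rev, hp, E'.rev_left]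
  refine ⟨⟨Iso.ofFaceNext (Equiv.ofBijective g hgb) (fun d => ?_) (fun d => ?_) ?_⟩,
    ⟨Iso.ofFaceNext (Equiv.ofBijective k hkb) (fun d => ?_) (fun d => ?_) kr⟩⟩
  · apply E'.inl_injective
    simp only [Equiv.ofBijective_apply]
    rw [hg, ← E.faceNext_inl, e.map_faceNext, ← hg, E'.faceNext_inl]
  · simp only [Equiv.ofBijective_apply]
    by_cases h1 : d = p
    · rw [h1, gq, gp]
    by_cases h2 : d = M.rev p
    · rw [h2, rev_rev, gp, gq, rev_rev]
    apply E'.inl_injective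
    rw [hg, ← E.rev_inl h1 h2, e.map_rev, ← hg, E'.rev_inl]
    · rw [← gp]; exact fun h => h1 (hgb.1 h)
    · rw [← gq]; exact fun h => h2 (hgb.1 h)
  · apply E'.inl_injective
    simp only [Equiv.ofBijective_apply]
    rw [hg, ← E.root_eq, e.map_root, E'.root_eq]
  · apply E'.inr_injective
    simp only [Equiv.ofBijective_apply]
    rw [hk, ← E.faceNext_inr, e.map_faceNext, ← hk, E'.faceNext_inr]
  · simp only [Equiv.ofBijective_apply]
    by_cases h1 : d = P.root
    · rw [h1, kr', kr]
    by_cases h2 : d = P.rev P.root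
    · rw [h2, rev_rev, kr, kr', rev_rev]
    apply E'.inr_injective
    rw [hk, ← E.rev_inr h1 h2, e.map_rev, ← hk, E'.rev_inr]
    · rw [← kr]; exact fun h => h1 (hkb.1 h)
    · rw [← kr']; exact fun h => h2 (hkb.1 h)

end EdgeSum

/-- A pendant submap with at least three vertices can be cut off. -/
theorem exists_edgeSum_of_pendantSizes {S : RootedMap} (hS : S.IsQuadrangulation) {i k : ℕ}
    (hk : 3 ≤ k) (hi : S.pendantSizes[i]? = some k) :
    ∃ (M P : RootedMap) (p : M.Dart), Nonempty (EdgeSum S M P p) ∧ M.IsQuadrangulation ∧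
      P.IsQuadrangulation ∧ P.numVertices = k ∧ M.IsSlot i p := by
  rw [pendantSizes, List.getElem?_map, Option.map_eq_some_iff] at hi
  obtain ⟨f, hf, hfk⟩ := hi
  obtain ⟨d, hd⟩ := exists_isPendantEntrance hS (mem_orderedFaces.1 (List.mem_of_getElem? hf))
  rcases hd.leaf_or_sum with h | ⟨-, M, P, p, E, hM, hP, -, rfl, h2⟩
  · omega
  · obtain rfl := hd.blockFace_eq
    refine ⟨M, P, p, ⟨E⟩, hM, hP, ?_, E.isSlot hM ?_ h2⟩
    · rw [← E.ncard_pendantVertices_left h2, ← hfk, E.blockFace_inl]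
    · rw [E.orderedFaces_eq, List.getElem?_map, Option.map_eq_some_iff] at hf
      obtain ⟨f', hf', h⟩ := hf
      rw [hf', E.faceMap_injective (h.trans (E.blockFace_inl p))]

/-! ### The map with a single edge -/

theorem numDarts_eq_two_iff {P : RootedMap} (hP : P.IsQuadrangulation) :
    P.numDarts = 2 ↔ P.numVertices = 2 := by
  constructor
  · intro h
    have h1 := P.numVertices_le_numDarts
    have h2 : 2 ≤ P.numVertices := by
      rw [numVertices, Nat.succ_le_iff, Finite.one_lt_card_iff_nontrivial]
      exact ⟨_, _, hP.tail_ne_head P.root⟩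
    omega
  · intro h
    refine hP.2.resolve_right fun h4 => ?_
    have := three_le_numVertices h4
    omega

theorem nonempty_iso_of_numDarts_eq_two {P P' : RootedMap} (hP : P.IsQuadrangulation)
    (hP' : P'.IsQuadrangulation) (h : P.numDarts = 2) (h' : P'.numDarts = 2) :
    Nonempty (Iso P P') := by
  have key : ∀ {P : RootedMap}, P.IsQuadrangulation → P.numDarts = 2 →
      (∀ d, d = P.root ∨ d = P.rev P.root) ∧ ∀ d, P.faceNext d = P.rev d := by
    intro P hP h
    have h1 : ∀ d, d = P.root ∨ d = P.rev P.root := by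
      intro d
      by_contra! hd
      have h3 : ({P.root, P.rev P.root, d} : Finset P.Dart).card ≤ P.numDarts := by
        simpa using Finset.card_le_univ ({P.root, P.rev P.root, d} : Finset P.Dart)
      rw [Finset.card_eq_three.2 ⟨_, _, _, (P.rev_ne _).symm, hd.1.symm, hd.2.symm, rfl⟩] at h3
      omega
    have h2 : ∀ d e, e = d ∨ e = P.rev d := by
      intro d e
      rcases h1 d with rfl | rfl
      · exact h1 e
      · rw [rev_rev]; exact (h1 e).symm
    -- A dart fixed by the face permutation would be a loop, which leaves only reversal.
    refine ⟨h1, fun d => (h2 d _).resolve_left fun h3 => hP.tail_ne_head d ?_⟩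
    rw [← tail_faceNext, h3]
  obtain ⟨h1, h2⟩ := key hP h
  obtain ⟨h1', h2'⟩ := key hP' h'
  classical
  have hr := P.rev_ne P.root
  have hr' := P'.rev_ne P'.root
  let g : P.Dart → P'.Dart := fun d => if d = P.root then P'.root else P'.rev P'.root
  have g1 : g P.root = P'.root := if_pos rfl
  have g2 : g (P.rev P.root) = P'.rev P'.root := if_neg hr
  have hg : Function.Bijective g := by
    constructor
    · intro a b hab
      rcases h1 a with rfl | rfl <;> rcases h1 b with rfl | rfl
      · rfl
      · rw [g1, g2] at hab; exact absurd hab.symm hr'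
      · rw [g1, g2] at hab; exact absurd hab hr'
      · rfl
    · intro y
      rcases h1' y with rfl | rfl
      exacts [⟨_, g1⟩, ⟨_, g2⟩]
  have hrev : ∀ d, g (P.rev d) = P'.rev (g d) := by
    intro d
    rcases h1 d with rfl | rfl
    · rw [g1, g2]
    · rw [rev_rev, g1, g2, rev_rev]
  refine ⟨Iso.ofFaceNext (Equiv.ofBijective g hg) (fun d => ?_) hrev g1⟩
  rw [h2, h2']
  exact hrev d

theorem exists_numDarts_eq_two : ∃ P : RootedMap, P.IsQuadrangulation ∧ P.numDarts = 2 := by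
  let α : Equiv.Perm (Fin 2) := Equiv.swap 0 1
  have h0 : ∀ d, α (α d) = d := by decide
  have h1 : ∀ d, α d ≠ d := by decide
  have hconn : ∀ d, Equiv.Perm.jointOrbit α α 0 d := by
    intro d
    have : d = 0 ∨ d = α 0 := by revert d; decide
    rcases this with rfl | rfl
    · exact Setoid.refl' _ _
    · exact Equiv.Perm.jointOrbit_left _ _ _
  have heuler : Nat.card (OrbitsOf (α * α⁻¹)) + Nat.card (OrbitsOf α) =
      Nat.card (OrbitsOf α) + 2 := by
    have := Equiv.Perm.mul_card_orbits (1 : Equiv.Perm (Fin 2)) 1 fun d =>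
      Function.minimalPeriod_eq_one_iff_isFixedPt.2 rfl
    rw [one_mul, Nat.card_fin] at this
    rw [mul_inv_cancel, this, add_comm]
  obtain ⟨P, e, h2, h3, -⟩ := exists_ofPerm α α 0 h0 h1 hconn heuler
  have hcard : P.numDarts = 2 := by simpa using (Fintype.card_congr e).symm
  refine ⟨P, ⟨P.exists_coloring_iff.2 ⟨fun d => decide (e.symm d = 0), fun d => ?_, fun d => ?_⟩,
    Or.inl hcard⟩, hcard⟩
  · obtain ⟨d, rfl⟩ := e.surjective d
    simp only [h2, Equiv.symm_apply_apply]
    revert d; decide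
  · obtain ⟨d, rfl⟩ := e.surjective d
    simp only [h3, Equiv.symm_apply_apply]
    revert d; decide

end RootedMap

/-! ### Counting quadrangulations by their pendant sizes -/

/-- The rooted quadrangulations with given size of the root block and given sizes of the submaps
pendant to it. -/
def quadrangulationsOfSizes (r : ℕ) (L : List ℕ) : Set RootedMapClass :=
  {q | q.IsQuadrangulation ∧ q.rootBlockSize = r ∧ q.pendantSizes = L}

/-- The class `q` arises by gluing `x.2` into the `i`-th face of `x.1`. -/
def RootedMapClass.IsGluing (i : ℕ) (x : RootedMapClass × RootedMapClass) (q : RootedMapClass) :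
    Prop :=
  ∃ (S M P : RootedMap) (p : M.Dart), Nonempty (RootedMap.EdgeSum S M P p) ∧ M.IsSlot i p ∧
    M.IsQuadrangulation ∧ S.IsQuadrangulation ∧ x = (⟦M⟧, ⟦P⟧) ∧ q = ⟦S⟧

/-- Gluing is defined through representatives, hence is handled as a relation; being total and
unique in both directions, it is a bijection. -/
theorem Set.ncard_eq_of_rel {α β : Type*} {s : Set α} {t : Set β} (R : α → β → Prop)
    (h₁ : ∀ a ∈ s, ∃ b ∈ t, R a b) (h₂ : ∀ b ∈ t, ∃ a ∈ s, R a b)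
    (h₃ : ∀ a b b', R a b → R a b' → b = b') (h₄ : ∀ a a' b, R a b → R a' b → a = a') :
    s.ncard = t.ncard := by
  choose f hf using h₁
  refine Set.ncard_congr f (fun a ha => (hf a ha).1)
    (fun a b ha hb hab => h₄ a b _ (hf a ha).2 (hab ▸ (hf b hb).2)) fun b hb => ?_
  obtain ⟨a, ha, hab⟩ := h₂ b hb
  exact ⟨a, ha, h₃ a _ _ (hf a ha).2 hab⟩

theorem RootedMapClass.IsGluing.right_unique {i : ℕ} {x : RootedMapClass × RootedMapClass}
    {q q' : RootedMapClass} (h : IsGluing i x q) (h' : IsGluing i x q') : q = q' := by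
  obtain ⟨S, M, P, p, ⟨E⟩, hp, hM, hS, rfl, rfl⟩ := h
  obtain ⟨S', M', P', p', ⟨E'⟩, hp', hM', hS', hx, rfl⟩ := h'
  obtain ⟨h1, h2⟩ := Prod.mk.inj hx
  obtain ⟨g⟩ := Quotient.exact h1
  obtain ⟨k⟩ := Quotient.exact h2
  exact Quotient.sound (E.nonempty_iso E' g k (hp.map hM' hp' g))

theorem RootedMapClass.IsGluing.left_unique {i : ℕ} {x x' : RootedMapClass × RootedMapClass}
    {q : RootedMapClass} (h : IsGluing i x q) (h' : IsGluing i x' q) : x = x' := by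
  obtain ⟨S, M, P, p, ⟨E⟩, hp, hM, hS, rfl, rfl⟩ := h
  obtain ⟨S', M', P', p', ⟨E'⟩, hp', hM', hS', rfl, hq⟩ := h'
  obtain ⟨e⟩ := Quotient.exact hq
  obtain ⟨g, k⟩ := E.nonempty_iso_summands E' hS' hp hp' e
  exact Prod.ext (Quotient.sound g) (Quotient.sound k)

/-- Gluing into the face of index `A.length` is a bijection from pairs: a map with a single edge in
that face, and a rooted quadrangulation with `k` vertices. The bound on `k` excludes the single edge
as second summand. -/
theorem ncard_quadrangulationsOfSizes_append_cons (r : ℕ) (A C : List ℕ) {k : ℕ} (hk : 3 ≤ k) :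
    (quadrangulationsOfSizes r (A ++ k :: C)).ncard =
      (quadrangulationsOfSizes r (A ++ 2 :: C)).ncard * (quadrangulations k).ncard := by
  rw [← Set.ncard_prod]
  refine (Set.ncard_eq_of_rel (RootedMapClass.IsGluing A.length) ?_ ?_
    (fun _ _ _ h h' => h.right_unique h') fun _ _ _ h h' => h.left_unique h').symm
  · rintro ⟨m, π⟩ ⟨⟨hm, hr, hL⟩, hπ, hk'⟩
    induction m using Quotient.inductionOn with | h M => ?_
    induction π using Quotient.inductionOn with | h P => ?_
    change M.IsQuadrangulation at hm
    change M.rootBlockSize = r at hr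
    change M.pendantSizes = _ at hL
    change P.IsQuadrangulation at hπ
    change P.numVertices = k at hk'
    obtain ⟨p, hp⟩ := RootedMap.exists_isSlot hm (i := A.length) (by rw [hL]; simp)
    obtain ⟨S, ⟨E⟩⟩ := hp.exists_edgeSum hm hπ
    have hS := E.isQuadrangulation hm hπ fun h2 => by
      rw [RootedMap.numDarts_eq_two_iff hπ] at h2
      omega
    refine ⟨⟦S⟧, ⟨hS, E.rootBlockSize_eq.trans hr, (E.pendantSizes_eq hp).trans ?_⟩,
      S, M, P, p, ⟨E⟩, hp, hm, hS, rfl, rfl⟩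
    rw [hL, hk']
    simp
  · rintro q ⟨hq, hr, hL⟩
    induction q using Quotient.inductionOn with | h S => ?_
    change S.IsQuadrangulation at hq
    change S.rootBlockSize = r at hr
    change S.pendantSizes = _ at hL
    obtain ⟨M, P, p, ⟨E⟩, hM, hP, hPk, hp⟩ :=
      RootedMap.exists_edgeSum_of_pendantSizes hq (i := A.length) hk (by rw [hL]; simp)
    refine ⟨(⟦M⟧, ⟦P⟧), ⟨⟨hM, E.rootBlockSize_eq.symm.trans hr, ?_⟩, hP, hPk⟩,
      S, M, P, p, ⟨E⟩, hp, hM, hq, rfl, rfl⟩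
    change M.pendantSizes = _
    have h1 := E.pendantSizes_eq hp
    rw [hL, hPk] at h1
    have h2 : (M.pendantSizes.set A.length k).set A.length 2 = M.pendantSizes := by
      rw [List.set_set]
      obtain ⟨h3, h4⟩ := List.getElem?_eq_some_iff.1 hp.pendantSizes_getElem?
      conv_lhs => rw [← h4]
      exact List.set_getElem_self h3
    rw [← h2, ← h1]
    simp

theorem ncard_quadrangulations_two : (quadrangulations 2).ncard = 1 := by
  rw [Set.ncard_eq_one]
  obtain ⟨P, hP, hP2⟩ := RootedMap.exists_numDarts_eq_two
  refine ⟨⟦P⟧, Set.eq_singleton_iff_unique_mem.2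
    ⟨⟨hP, (RootedMap.numDarts_eq_two_iff hP).1 hP2⟩, ?_⟩⟩
  rintro q ⟨hq, hq2⟩
  induction q using Quotient.inductionOn with | h P' => ?_
  exact Quotient.sound (RootedMap.nonempty_iso_of_numDarts_eq_two hq hP
    ((RootedMap.numDarts_eq_two_iff hq).2 hq2) hP2)

/-- The entries of `A` are turned into `2` one by one, each at the cost of its factor; an entry that
is already `2` has the factor `1`. The list `C` is general so that the induction can carry the
untreated entries. -/
theorem ncard_quadrangulationsOfSizes_append (r : ℕ) (A C : List ℕ) (hA : ∀ k ∈ A, 2 ≤ k) :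
    (quadrangulationsOfSizes r (A ++ C)).ncard =
      (quadrangulationsOfSizes r (List.replicate A.length 2 ++ C)).ncard *
        (A.map fun k => (quadrangulations k).ncard).prod := by
  induction A using List.reverseRecOn generalizing C with
  | nil => simp
  | append_singleton A k ih =>
    have h1 : (quadrangulationsOfSizes r (List.replicate A.length 2 ++ k :: C)).ncard =
        (quadrangulationsOfSizes r (List.replicate A.length 2 ++ 2 :: C)).ncard *
          (quadrangulations k).ncard := by
      rcases (hA k (by simp)).eq_or_lt with rfl | h
      · rw [ncard_quadrangulations_two, mul_one]
      · exact ncard_quadrangulationsOfSizes_append_cons r _ C h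
    have h2 : List.replicate (A ++ [k]).length 2 ++ C = List.replicate A.length 2 ++ 2 :: C := by
      rw [List.length_append, List.length_singleton, List.replicate_succ']
      simp
    rw [List.append_assoc, List.singleton_append, ih _ fun j hj => hA j (by simp [hj]), h1, h2,
      List.map_append, List.prod_append, List.map_singleton, List.prod_singleton]
    ring

/-- Each pendant submap can be chosen freely among the rooted quadrangulations of its size. -/
theorem ncard_quadrangulationsOfSizes (r : ℕ) (L : List ℕ) (hL : ∀ k ∈ L, 2 ≤ k) :
    (quadrangulationsOfSizes r L).ncard =
      (quadrangulationsOfSizes r (List.replicate L.length 2)).ncard *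
        (L.map fun k => (quadrangulations k).ncard).prod := by
  simpa using ncard_quadrangulationsOfSizes_append r L [] hL

theorem RootedMapClass.length_pendantSizes (q : RootedMapClass) :
    q.pendantSizes.length = q.numDigonFaces := by
  induction q using Quotient.inductionOn with | h S => ?_
  exact (List.length_map _).trans S.length_orderedFaces

theorem RootedMapClass.two_le_of_mem_pendantSizes {q : RootedMapClass} (hq : q.IsQuadrangulation)
    {k : ℕ} (hk : k ∈ q.pendantSizes) : 2 ≤ k := by
  induction q using Quotient.inductionOn with | h S => ?_
  obtain ⟨f, hf, rfl⟩ := List.mem_map.1 hk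
  exact RootedMap.two_le_ncard_pendantVertices hq (RootedMap.mem_orderedFaces.1 hf)

theorem RootedMapClass.numVertices_eq_add_sum {q : RootedMapClass} (hq : q.IsQuadrangulation)
    (hN : q.numDigonFaces ≠ 0) :
    q.numVertices = q.rootBlockSize + (q.pendantSizes.map (· - 1)).sum := by
  induction q using Quotient.inductionOn with | h S => ?_
  exact RootedMap.numVertices_eq_add_sum hq (Set.nonempty_of_ncard_ne_zero hN)

theorem RootedMapClass.pendantSizes_eq_ofFn_iff {q : RootedMapClass} (hq : q.IsQuadrangulation)
    {N : ℕ} (hN : q.numDigonFaces = N) {y : Fin N → ℕ} :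
    q.pendantSizes = List.ofFn (fun i => y i + 1) ↔ ∀ i : Fin N, q.Y i = y i := by
  have hlen : q.pendantSizes.length = N := q.length_pendantSizes.trans hN
  -- Pendant sizes are at least `2` and the index is within the list, so neither the truncated
  -- subtraction nor the default value in `Y` plays a part.
  have h2 : ∀ (i : ℕ) (hi : i < q.pendantSizes.length), q.Y i + 1 = q.pendantSizes[i] := by
    intro i hi
    have := two_le_of_mem_pendantSizes hq (List.getElem_mem hi)
    rw [Y, List.getD_eq_getElem _ _ hi]
    omega
  constructor
  · intro h i
    have h3 := h2 i (by omega)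
    simp only [h, List.getElem_ofFn] at h3
    exact Nat.succ_injective h3
  · intro h
    refine List.ext_getElem (by simp [hlen]) fun i hi _ => ?_
    rw [← h2 i hi, List.getElem_ofFn]
    exact congrArg (· + 1) (h ⟨i, hlen ▸ hi⟩)

theorem RootedMapClass.Y_mem {n r N : ℕ} (hN : 1 ≤ N) {q : RootedMapClass}
    (hq : q ∈ quadrangulationsWith n r N) :
    (∀ i : Fin N, 1 ≤ q.Y i) ∧ ∑ i : Fin N, q.Y i = n - r := by
  obtain ⟨⟨hq, rfl⟩, rfl, hN'⟩ := hq
  have hlen : q.pendantSizes.length = N := q.length_pendantSizes.trans hN'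
  have h := (pendantSizes_eq_ofFn_iff hq hN').2 fun i => rfl
  constructor
  · intro i
    have := two_le_of_mem_pendantSizes hq (k := q.Y i + 1) (by rw [h]; simp)
    omega
  · rw [numVertices_eq_add_sum hq (by omega), h, List.map_ofFn]
    simp [Function.comp_def, List.sum_ofFn]

/-- The list of sizes already determines `N`, as its length, and together with `r` also `n`, by
counting vertices. -/
theorem quadrangulationsWith_inter {n r N : ℕ} (hN : 1 ≤ N) (hn : r ≤ n) {y : Fin N → ℕ}
    (hsum : ∑ i, y i = n - r) :
    quadrangulationsWith n r N ∩ {q | ∀ i : Fin N, q.Y i = y i} =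
      quadrangulationsOfSizes r (List.ofFn fun i => y i + 1) := by
  ext q
  constructor
  · rintro ⟨⟨⟨hq, hn⟩, hr, hN'⟩, hY⟩
    exact ⟨hq, hr, (RootedMapClass.pendantSizes_eq_ofFn_iff hq hN').2 hY⟩
  · rintro ⟨hq, hr, hL⟩
    have hN' : q.numDigonFaces = N := by
      rw [← q.length_pendantSizes, hL, List.length_ofFn]
    refine ⟨⟨⟨hq, ?_⟩, hr, hN'⟩, (RootedMapClass.pendantSizes_eq_ofFn_iff hq hN').1 hL⟩
    rw [RootedMapClass.numVertices_eq_add_sum hq (by omega), hr, hL, List.map_ofFn]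
    simp only [Function.comp_def, List.sum_ofFn, Nat.add_sub_cancel, hsum]
    omega

/-- The number of quadrangulations with given pendant sizes is a product. -/
theorem ncard_quadrangulationsWith_inter {n r N : ℕ} (hN : 1 ≤ N) (hn : r ≤ n) {y : Fin N → ℕ}
    (hy : ∀ i, 1 ≤ y i) (hsum : ∑ i, y i = n - r) :
    (quadrangulationsWith n r N ∩ {q | ∀ i : Fin N, q.Y i = y i}).ncard =
      (quadrangulationsOfSizes r (List.replicate N 2)).ncard *
        ∏ i, (quadrangulations (y i + 1)).ncard := by
  rw [quadrangulationsWith_inter hN hn hsum, ncard_quadrangulationsOfSizes, List.length_ofFn,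
    List.map_ofFn, List.prod_ofFn]
  · rfl
  · intro k hk
    obtain ⟨i, rfl⟩ := List.mem_ofFn.1 hk
    have := hy i
    omega

/-! ### Weights, and the comparison of the two laws -/

theorem weight_eq {k : ℕ} (hk : 1 ≤ k) :
    weight k = (quadrangulations (k + 1)).ncard * (√Real.pi / 2) * 12 * (12 ^ k)⁻¹ := by
  obtain ⟨j, rfl⟩ := Nat.exists_eq_add_of_le' hk
  have h : ((j + 1 : ℕ) : ℝ) ^ (5 / 2 : ℝ) ≠ 0 := by positivity
  rw [weight, psi, Nat.add_sub_cancel]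
  field_simp
  ring

/-- By `weight_eq` each weight carries a factor `12 ^ (-y i)`; their product depends on the total
`m` alone, so up to a constant only the counts remain. -/
theorem prod_xiProb {N m : ℕ} {y : Fin N → ℕ} (hy : ∀ i, 1 ≤ y i) (hsum : ∑ i, y i = m) :
    ∏ i, xiProb (y i) = (√Real.pi / 2 * 12 / ∑' l : ℕ, weight (l + 1)) ^ N * (12 ^ m)⁻¹ *
      ∏ i, ((quadrangulations (y i + 1)).ncard : ℝ) := by
  have h : ∀ i, xiProb (y i) = (√Real.pi / 2 * 12 / ∑' l : ℕ, weight (l + 1)) * (12 ^ y i)⁻¹ *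
      ((quadrangulations (y i + 1)).ncard : ℝ) := fun i => by
    rw [xiProb, weight_eq (hy i)]; ring
  simp only [h, Finset.prod_mul_distrib, Finset.prod_const, Finset.card_univ, Fintype.card_fin,
    Finset.prod_inv_distrib, Finset.prod_pow_eq_pow_sum, hsum]

theorem measureReal_eq_sum_of_ae_mem {Ω α : Type*} [MeasurableSpace Ω] (P : Measure Ω)
    [IsFiniteMeasure P] {X : Ω → α} (T : Finset α) {A : Set Ω} (hA : ∀ᵐ ω ∂P, ω ∈ A ↔ X ω ∈ T)
    (hX : ∀ z ∈ T, MeasurableSet {ω | X ω = z}) :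
    P.real A = ∑ z ∈ T, P.real {ω | X ω = z} := by
  rw [← measureReal_biUnion_finset _ hX]
  · refine measureReal_congr ?_
    filter_upwards [hA] with ω hω
    refine propext (hω.trans ?_)
    change _ ↔ ω ∈ ⋃ z ∈ T, {ω | X ω = z}
    simp
  · intro z _ z' _ hzz
    exact Set.disjoint_left.2 fun ω h h' => hzz (h.symm.trans h')

/-- If the sum vanished (as it also would by convention for a divergent series), division by zero
would make all point probabilities `0`, and `ξ` would have no value to take. -/
theorem tsum_weight_ne_zero {Ω : Type*} [MeasurableSpace Ω] {P : Measure Ω}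
    [IsProbabilityMeasure P] {ξ : Ω → ℕ} (hpos : ∀ᵐ ω ∂P, 1 ≤ ξ ω)
    (hlaw : ∀ k, 1 ≤ k → P.real {ω | ξ ω = k} = xiProb k) : ∑' l : ℕ, weight (l + 1) ≠ 0 := by
  intro h0
  have h : ∀ k, ∀ᵐ ω ∂P, ξ ω ≠ k + 1 := by
    intro k
    have := hlaw (k + 1) (by omega)
    rw [xiProb, h0, div_zero, measureReal_eq_zero_iff] at this
    rw [ae_iff]
    simpa using this
  have : ∀ᵐ _ ∂P, False := by
    filter_upwards [hpos, ae_all_iff.2 h] with ω h1 h2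
    obtain ⟨k, hk⟩ := Nat.exists_eq_add_of_le' h1
    exact h2 k hk
  simp [ae_iff] at this

theorem proposition2p1 (n r N : ℕ) (hr : 1 < r) (hN : 1 ≤ N) (hNn : N + r ≤ n)
    -- an allocation of `n - r` balls in `N` boxes, with no empty box
    (y : Fin N → ℕ) (hy : ∀ i, 1 ≤ y i) (hysum : ∑ i, y i = n - r)
    -- a uniformly random element of the set of quadrangulations
    {Ω : Type*} [MeasurableSpace Ω] (P : Measure Ω) [IsProbabilityMeasure P]
    (Q : Ω → RootedMapClass) (hQ : Measurable Q)
    (hQlaw : P.map Q = uniformOn (quadrangulationsWith n r N))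
    -- independent copies of `ξ`
    {Ω' : Type*} [MeasurableSpace Ω'] (P' : Measure Ω') [IsProbabilityMeasure P']
    (ξ : Fin N → Ω' → ℕ) (hξ : ∀ i, Measurable (ξ i)) (hξindep : iIndepFun ξ P')
    (hξpos : ∀ i, ∀ᵐ ω ∂P', 1 ≤ ξ i ω)
    (hξlaw : ∀ i k, 1 ≤ k → P'.real {ω | ξ i ω = k} = xiProb k) :
    P' {ω | ∑ i, ξ i ω = n - r} ≠ 0 ∧
      P {ω | ∀ i : Fin N, (Q ω).Y i = y i} =
        P'[|{ω | ∑ i, ξ i ω = n - r}] {ω | ∀ i, ξ i ω = y i} := by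
  let F := quadrangulationsWith n r N
  -- The allocations without empty box: almost surely `(Y_i)` lies in `T`, and `(ξ_i)` lies in `T`
  -- exactly when its sum is `n - r`.
  let T : Finset (Fin N → ℕ) := (Finset.univ.piAntidiag (n - r)).filter fun z => ∀ i, 1 ≤ z i
  have hT : ∀ z, z ∈ T ↔ ∑ i, z i = n - r ∧ ∀ i, 1 ≤ z i := fun z => by
    simp [T, Finset.mem_piAntidiag]
  let w : (Fin N → ℕ) → ℝ := fun z => ∏ i, ((quadrangulations (z i + 1)).ncard : ℝ)
  have hdisc : ∀ s : Set RootedMapClass, MeasurableSet s := fun _ => trivial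
  -- That `F` is finite and nonempty is read off from the law of `Q`: otherwise the uniform measure
  -- on `F` would not have mass `1`.
  have : IsProbabilityMeasure (uniformOn F) :=
    hQlaw ▸ Measure.isProbabilityMeasure_map hQ.aemeasurable
  have hF : F.Finite := finite_of_uniformOn_ne_zero (t := Set.univ) (by simp)
  have hF' : F.Nonempty := Set.nonempty_iff_ne_empty.2 fun h => by
    have h1 : uniformOn F Set.univ = 1 := measure_univ
    simp [h] at h1
  have hPQ : ∀ s : Set RootedMapClass, P.real (Q ⁻¹' s) = (F.ncard : ℝ)⁻¹ * (F ∩ s).ncard := by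
    intro s
    rw [measureReal_def, ← Measure.map_apply hQ (hdisc s), hQlaw, uniformOn, cond_apply (hdisc F),
      Measure.count_apply (hdisc _), Measure.count_apply (hdisc _),
      ← hF.cast_ncard_eq, ← (hF.inter_of_left s).cast_ncard_eq]
    simp
  let c : ℝ := (F.ncard : ℝ)⁻¹ * (quadrangulationsOfSizes r (List.replicate N 2)).ncard
  let c' : ℝ := (√Real.pi / 2 * 12 / ∑' l : ℕ, weight (l + 1)) ^ N * (12 ^ (n - r))⁻¹
  have hY : ∀ z ∈ T, P.real {ω | (fun i : Fin N => (Q ω).Y i) = z} = c * w z := by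
    intro z hz
    obtain ⟨h1, h2⟩ := (hT z).1 hz
    have h3 : {ω | (fun i : Fin N => (Q ω).Y i) = z} = Q ⁻¹' {q | ∀ i : Fin N, q.Y i = z i} := by
      ext ω; exact funext_iff
    rw [h3, hPQ, ncard_quadrangulationsWith_inter hN (by omega) h2 h1]
    push_cast
    ring
  have hQF : ∀ᵐ ω ∂P, Q ω ∈ F := by
    have h1 : ∀ᵐ q ∂(P.map Q), q ∈ F := by
      rw [hQlaw]
      exact (prob_compl_eq_zero_iff (hdisc F)).2 (uniformOn_self hF hF')
    exact ae_of_ae_map hQ.aemeasurable h1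
  -- The total mass of the law of `(Y_i)`. It fixes the normalisation and also shows that the sum of
  -- the products is nonzero.
  have hYsum : 1 = c * ∑ z ∈ T, w z := by
    rw [Finset.mul_sum, ← Finset.sum_congr rfl hY, ← measureReal_eq_sum_of_ae_mem P
      (X := fun ω (i : Fin N) => (Q ω).Y i) (A := Set.univ)]
    · simp
    · filter_upwards [hQF] with ω hω
      have := RootedMapClass.Y_mem hN hω
      simp [hT, this]
    · intro z _
      exact hQ (hdisc {q | (fun i : Fin N => q.Y i) = z})
  have hξz : ∀ z ∈ T, P'.real {ω | (fun i => ξ i ω) = z} = c' * w z := by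
    intro z hz
    obtain ⟨h1, h2⟩ := (hT z).1 hz
    have h3 : {ω | (fun i => ξ i ω) = z} = ⋂ i ∈ Finset.univ, ξ i ⁻¹' {z i} := by
      ext ω; simp [funext_iff]
    rw [h3, measureReal_def, hξindep.measure_inter_preimage_eq_mul Finset.univ
      fun i _ => measurableSet_singleton (z i), ENNReal.toReal_prod, ← prod_xiProb h2 h1]
    exact Finset.prod_congr rfl fun i _ => hξlaw i (z i) (h2 i)
  have hmeas : ∀ z, MeasurableSet {ω | (fun i => ξ i ω) = z} := fun z =>
    measurable_pi_lambda (fun ω i => ξ i ω) hξ (measurableSet_singleton z)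
  have hξsum : P'.real {ω | ∑ i, ξ i ω = n - r} = c' * ∑ z ∈ T, w z := by
    rw [Finset.mul_sum, ← Finset.sum_congr rfl hξz, ← measureReal_eq_sum_of_ae_mem P'
      (X := fun ω i => ξ i ω)]
    · filter_upwards [ae_all_iff.2 hξpos] with ω hω
      simp [hT, hω]
    · exact fun z _ => hmeas z
  have hc' : c' ≠ 0 := by
    have := tsum_weight_ne_zero (hξpos ⟨0, hN⟩) (hξlaw ⟨0, hN⟩)
    have := Real.pi_pos
    positivity
  have hw : ∑ z ∈ T, w z ≠ 0 := right_ne_zero_of_mul (hYsum ▸ one_ne_zero)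
  have hS : MeasurableSet {ω | ∑ i, ξ i ω = n - r} :=
    Finset.measurable_sum _ (fun i _ => hξ i) (measurableSet_singleton _)
  have hyT : y ∈ T := (hT y).2 ⟨hysum, hy⟩
  refine ⟨fun h0 => mul_ne_zero hc' hw (by rw [← hξsum, measureReal_def, h0]; rfl), ?_⟩
  have h1 : {ω | ∀ i : Fin N, (Q ω).Y i = y i} = {ω | (fun i : Fin N => (Q ω).Y i) = y} := by
    simp only [funext_iff]
  have h2 : {ω | ∑ i, ξ i ω = n - r} ∩ {ω | ∀ i, ξ i ω = y i} = {ω | (fun i => ξ i ω) = y} := by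
    ext ω
    simp only [Set.mem_inter_iff, Set.mem_ofPred_eq, funext_iff, and_iff_right_iff_imp]
    intro h
    simp only [h, hysum]
  have h3 : (P'[|{ω | ∑ i, ξ i ω = n - r}]).real {ω | ∀ i, ξ i ω = y i} =
      P.real {ω | ∀ i : Fin N, (Q ω).Y i = y i} := by
    rw [measureReal_def, cond_apply hS, h2, ENNReal.toReal_mul, ENNReal.toReal_inv,
      ← measureReal_def, ← measureReal_def, hξsum, hξz y hyT, h1, hY y hyT]
    -- The constant `c'` cancels between numerator and denominator, and `hYsum` identifies the
    -- inverse of the sum over `T` with `c`.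
    field_simp
    linear_combination w y * hYsum
  exact ((measureReal_eq_measureReal_iff (measure_ne_top _ _) (measure_ne_top _ _)).1 h3).symm
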